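/- Theorem 1 (Reynolds transport theorem). Let $J\subset\mathbb R$ be an open interval, $\Omega\subset\mathbb R^3$ open, and let $\mathbf v\in L^\infty(J\times\Omega;\mathbb R^3)$ be Lipschitz continuous in $\mathbf x$ uniformly in $t$: for some $L\ge 0$, $|\mathbf v(t,\mathbf x)-\mathbf v(t,\mathbf y)|\le L|\mathbf x-\mathbf y|$ for all $t\in J$, $\mathbf x,\mathbf y\in\Omega$. Let $t_0\in J$ and let $G_0\subset\Omega$ be a compact Lipschitz domain (each boundary point has a neighborhood that a bi-Lipschitz homeomorphism onto an open set maps so that the part in $G_0$ becomes the part in a closed half space). Let $r>0$ be such that, for every $\mathbf x_0\in G_0$, the initial value problem $\dot{\mathbf x}(t)=\mathbf v(t,\mathbf x(t))$, $\mathbf x(t_0)=\mathbf x_0$, has a solution with values in $\Omega$ on $J_0:=(t_0-r,t_0+r)\cap J$, in the sense $\mathbf x(t)=\mathbf x_0+\int_{t_0}^t\mathbf v(s,\mathbf x(s))\,ds$. Then these solutions are unique; denoting them by $\Phi_{t_0}^t(\mathbf x_0)$, the co-moving volumes $G(t)=\Phi_{t_0}^t(G_0)$ exist for all $t\in J_0$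 and are compact subsets of $\Omega$. Moreover: (a) Let $\psi\in W^{1,1}(J\times\Omega;\mathbb R)$. Then $\psi$ has a representative for which $t\mapsto\psi(t,\cdot)$ is continuous from $J$ to $L^1(\Omega)$, the distributional spatial divergence $\operatorname{div}(\psi\mathbf v)$ belongs to $L^1(J\times\Omega)$, and, for every such representative, for almost every $t\in J_0$ the function $s\mapsto\int_{G(s)}\psi(s,\mathbf x)\,d\mathbf x$ is differentiable at $t$ with $$\frac{d}{dt}\int_{G(t)}\psi(t,\mathbf x)\,d\mathbf x=\int_{G(t)}\big(\partial_t\psi(t,\mathbf x)+\operatorname{div}(\psi\mathbf v)(t,\mathbf x)\big)\,d\mathbf x ,$$ where $\partial_t\psi$ is the weak time derivative. (b) If $\mathbf v$ is continuous on $J\times\Omega$, $\mathbf v(t,\cdot)$ is differentiable on $\Omega$ for every $t\in J$, $\nabla_{\mathbf x}\mathbf v$ is continuous on $J\times\Omega$, and $\psi\in C^1(J\times\Omega;\mathbb R)$, then the same identity (with classical derivatives) holds for every $t\in J_0$. All integrals over $G(t)$ in these identities are integrals of integrable functions. -/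

import Mathlib

open Set Filter Topology MeasureTheory
open scoped NNReal ENNReal ContDiff

/-- Three-dimensional Euclidean space `ℝ³`. -/
abbrev E3 : Type := EuclideanSpace ℝ (Fin 3)

/-- `x` is a (Carathéodory) solution on the time interval `I`, with values in `Ω`, of the initial
value problem `x' = v(t, x)`, `x(t₀) = x₀`, in its integral form. -/
structure IsSolution (v : ℝ × E3 → E3) (Ω : Set E3) (I : Set ℝ) (t₀ : ℝ) (x₀ : E3)
    (x : ℝ → E3) : Prop where
  mem : ∀ t ∈ I, x t ∈ Ω
  initial : x t₀ = x₀
  integrable : ∀ t ∈ I, IntervalIntegrable (fun s => v (s, x s)) volume t₀ t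
  eq : ∀ t ∈ I, x t = x₀ + ∫ s in t₀..t, v (s, x s)

open Classical in
/-- The flow map `Φ_{t₀}^t(x₀)`: the value at time `t` of the solution on `I` that starts
in `x₀` at time `t₀` (and `x₀` if there is no solution on `I`). -/
noncomputable def flowMap (v : ℝ × E3 → E3) (Ω : Set E3) (I : Set ℝ) (t₀ t : ℝ) (x₀ : E3) : E3 :=
  if h : ∃ x : ℝ → E3, IsSolution v Ω I t₀ x₀ x then h.choose t else x₀

/-- The co-moving volume `G(t) = Φ_{t₀}^t(G₀)`. -/
noncomputable def comovingVolume (v : ℝ × E3 → E3) (Ω : Set E3) (I : Set ℝ) (t₀ : ℝ)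
    (G₀ : Set E3) (t : ℝ) : Set E3 :=
  flowMap v Ω I t₀ t '' G₀

/-- A compact Lipschitz domain: a compact set which, near each of its boundary points, is mapped
to a half space by a bi-Lipschitz homeomorphism between open sets. Every compact set that is
locally the epigraph of a Lipschitz function is of this kind. -/
structure IsCompactLipschitzDomain (G : Set E3) : Prop where
  isCompact : IsCompact G
  chart : ∀ p ∈ frontier G, ∃ (e : OpenPartialHomeomorph E3 E3) (K : ℝ≥0), p ∈ e.source ∧
    LipschitzOnWith K e e.source ∧ LipschitzOnWith K e.symm e.target ∧
    ∀ x ∈ e.source, (x ∈ G ↔ 0 ≤ e x 0)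

/-- Test functions on a set `U ⊆ ℝ × ℝ³`: smooth functions with compact support in `U`. -/
structure IsTestFunction (U : Set (ℝ × E3)) (φ : ℝ × E3 → ℝ) : Prop where
  smooth : ContDiff ℝ ∞ φ
  compact : HasCompactSupport φ
  support : tsupport φ ⊆ U

/-- `g ∈ L¹(U)` is the weak derivative of `ψ` on `U` in the space-time direction `w`. -/
def HasWeakDeriv (U : Set (ℝ × E3)) (w : ℝ × E3) (ψ g : ℝ × E3 → ℝ) : Prop :=
  IntegrableOn g U ∧ ∀ φ : ℝ × E3 → ℝ, IsTestFunction U φ →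
    ∫ p in U, ψ p * fderiv ℝ φ p w = - ∫ p in U, g p * φ p

/-- `g ∈ L¹(U)` is the weak time derivative `∂ₜψ` of `ψ` on `U`. -/
def HasWeakTimeDeriv (U : Set (ℝ × E3)) (ψ g : ℝ × E3 → ℝ) : Prop :=
  HasWeakDeriv U (1, 0) ψ g

/-- `ψ ∈ W^{1,1}(U)`, for `U ⊆ ℝ × ℝ³`. -/
structure MemW11 (U : Set (ℝ × E3)) (ψ : ℝ × E3 → ℝ) : Prop where
  integrable : IntegrableOn ψ U
  time : ∃ g : ℝ × E3 → ℝ, HasWeakTimeDeriv U ψ g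
  space : ∀ i : Fin 3, ∃ g : ℝ × E3 → ℝ, HasWeakDeriv U (0, EuclideanSpace.single i 1) ψ g

/-- `d ∈ L¹(U)` is the weak (distributional) spatial divergence on `U` of the vector field `w`:
`∫ w · ∇ₓφ = - ∫ d φ` for all test functions `φ`. -/
def HasWeakSpaceDiv (U : Set (ℝ × E3)) (w : ℝ × E3 → E3) (d : ℝ × E3 → ℝ) : Prop :=
  IntegrableOn d U ∧ ∀ φ : ℝ × E3 → ℝ, IsTestFunction U φ →
    ∫ p in U, fderiv ℝ φ p (0, w p) = - ∫ p in U, d p * φ p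

/-- `ψ'` is a representative of the almost-everywhere class of `ψ` on `J × Ω` for which
`t ↦ ψ'(t, ·)` is continuous from `J` to `L¹(Ω)`. -/
structure IsTimeContinuousRep (J : Set ℝ) (Ω : Set E3) (ψ ψ' : ℝ × E3 → ℝ) : Prop where
  ae_eq : ψ' =ᵐ[volume.restrict (J ×ˢ Ω)] ψ
  integrable : ∀ t ∈ J, IntegrableOn (fun x => ψ' (t, x)) Ω
  continuous : ∀ t ∈ J,
    Tendsto (fun s => ∫ x in Ω, |ψ' (s, x) - ψ' (t, x)|) (𝓝[J] t) (𝓝 0)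

/-- The classical time derivative `∂ₜψ(t, x)`. -/
noncomputable def timeDeriv (ψ : ℝ × E3 → ℝ) (p : ℝ × E3) : ℝ :=
  deriv (fun s => ψ (s, p.2)) p.1

/-- The classical spatial divergence `∑ᵢ ∂ᵢ wᵢ(t, x)`. -/
noncomputable def spaceDiv (w : ℝ × E3 → E3) (p : ℝ × E3) : ℝ :=
  ∑ i : Fin 3, (fderiv ℝ (fun y => w (p.1, y)) p.2 (EuclideanSpace.single i 1)) i

/-!
The transport identity is obtained without changing variables, hence without Jacobians, and only
the compactness of the initial domain is used, not the regularity of its boundary.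

The idea is to test the weak identities for `∂ₜψ` and `div(ψv)` with the product `η(t) u(t, x)`,
where `u(t, x) = f(X(t₁, t, x))` and `X(t₁, t, ·)` is the flow from time `t` back to time `t₁`. Such
a function `u` is Lipschitz, and it satisfies the transport equation `∂ₜu + v · ∇u = 0` almost
everywhere: it is differentiable almost everywhere by Rademacher's theorem, and it is constant along
the trajectories, whose velocity is `v` except for a null set of times that is the same for all
trajectories (`IsFlow.ae_transport`). Only the term with `η'` survives on one side, so that
`t ↦ ∫ ψ u dx` has the weak derivative `t ↦ ∫ (∂ₜψ + div(ψv)) u dx`. Letting the Lipschitz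
cutoff `f` decrease to the indicator function of `G(t₁)`, the function `u` becomes the indicator
function of the co-moving volumes, and the increments of `t ↦ ∫_{G(t)} ψ dx` are the integrals in
time of `∫_{G(t)} (∂ₜψ + div(ψv)) dx` (`integral_comoving_sub`). Lebesgue's differentiation
theorem gives the identity at almost every time. In the classical case the density is continuous
in time, because the volume of the symmetric difference of `G(t)` and `G(t₁)` tends to zero, and the
fundamental theorem of calculus gives the identity at every time.

Everything is local in time. McShane's formula along a dense sequence of points replaces the
velocity, at almost every time and at all points of `Ω`, by a measurable field on the whole space
that is bounded and Lipschitz (`exists_caratheodory_extension`), and cutting this field off to a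
short time interval makes the Picard operator a contraction. The flow obtained in this way agrees
locally with the given solutions (`IsSolution.eq_flow`). Uniqueness and continuous dependence on the
initial value therefore hold locally, and propagate along the interval `J₀` by connectedness.

The test functions are merely Lipschitz, or Lipschitz in space only, so the weak identities
are first extended by mollification to bounded test functions with bounded weak derivatives
(`HasWeakDeriv.integral_mul_eq`, `HasWeakSpaceDiv.integral_mul_eq`). This extension also yields the
weak divergence of `ψv`, by testing the spatial derivatives of `ψ` with `vᵢ φ`
(`exists_hasWeakSpaceDiv`), and the time-continuous representative, by testing the time derivative
with the primitives in time of `φ`, corrected to have compact support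
(`exists_isTimeContinuousRep`).
-/

/-! ### A bounded measurable extension of the velocity field -/

instance : (volume : Measure (ℝ × E3)).IsAddHaarMeasure :=
  inferInstanceAs ((volume : Measure ℝ).prod (volume : Measure E3)).IsAddHaarMeasure

/-- Truncation of a real number to `[-M, M]`. -/
noncomputable def clampTo (M a : ℝ) : ℝ := max (-M) (min M a)

theorem abs_clampTo_le {M : ℝ} (hM : 0 ≤ M) (a : ℝ) : |clampTo M a| ≤ M := by
  unfold clampTo
  rw [abs_le]
  constructor
  · exact le_max_left _ _
  · exact max_le (by linarith) (min_le_left _ _)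

theorem clampTo_of_abs_le {M a : ℝ} (h : |a| ≤ M) : clampTo M a = a := by
  unfold clampTo
  rw [abs_le] at h
  rw [min_eq_right h.2, max_eq_right h.1]

theorem abs_clampTo_sub_le (M a b : ℝ) : |clampTo M a - clampTo M b| ≤ |a - b| := by
  unfold clampTo
  calc _ ≤ |min M a - min M b| := by
        simpa [max_comm] using abs_max_sub_max_le_abs (min M a) (min M b) (-M)
    _ ≤ _ := by
        have := abs_min_sub_min_le_max M a M b
        simpa using this

theorem measurable_clampTo (M : ℝ) : Measurable (clampTo M) := by
  unfold clampTo; fun_prop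

/-- McShane's formula for a Lipschitz extension from the range of a sequence: `d` enumerates the
points, `c` the values, and the extension is truncated to `[-M, M]`. -/
noncomputable def mcShane (M L : ℝ) (d : ℕ → E3) (c : ℕ → ℝ) (x : E3) : ℝ :=
  clampTo M (⨅ n, (clampTo M (c n) + L * ‖x - d n‖))

theorem abs_mcShane_le {M : ℝ} (hM : 0 ≤ M) (L : ℝ) (d : ℕ → E3) (c : ℕ → ℝ) (x : E3) :
    |mcShane M L d c x| ≤ M := abs_clampTo_le hM _

theorem bddBelow_mcShane {M L : ℝ} (hM : 0 ≤ M) (hL : 0 ≤ L) (d : ℕ → E3) (c : ℕ → ℝ) (x : E3) :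
    BddBelow (range fun n => clampTo M (c n) + L * ‖x - d n‖) := by
  refine ⟨-M, ?_⟩
  rintro _ ⟨n, rfl⟩
  have h1 := (abs_le.1 (abs_clampTo_le hM (c n))).1
  have h2 : 0 ≤ L * ‖x - d n‖ := by positivity
  simp only
  linarith

theorem abs_mcShane_sub_le {M L : ℝ} (hM : 0 ≤ M) (hL : 0 ≤ L) (d : ℕ → E3) (c : ℕ → ℝ)
    (x y : E3) : |mcShane M L d c x - mcShane M L d c y| ≤ L * ‖x - y‖ := by
  refine (abs_clampTo_sub_le _ _ _).trans ?_
  have key : ∀ x y : E3, (⨅ n, (clampTo M (c n) + L * ‖x - d n‖)) ≤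
      (⨅ n, (clampTo M (c n) + L * ‖y - d n‖)) + L * ‖x - y‖ := by
    intro x y
    rw [← sub_le_iff_le_add]
    refine le_ciInf fun n => ?_
    rw [sub_le_iff_le_add]
    refine (ciInf_le (bddBelow_mcShane hM hL d c x) n).trans ?_
    have : ‖x - d n‖ ≤ ‖y - d n‖ + ‖x - y‖ := by
      have := norm_add_le (y - d n) (x - y)
      simpa using this
    nlinarith [mul_le_mul_of_nonneg_left this hL]
  rw [abs_le]
  have h1 := key x y
  have h2 := key y x
  rw [norm_sub_rev y x] at h2
  constructor <;> linarith

theorem mcShane_eq {M L : ℝ} (hM : 0 ≤ M) (hL : 0 ≤ L) (d : ℕ → E3) (c : ℕ → ℝ)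
    (hc : ∀ n, |c n| ≤ M) (hd : ∀ n m, |c n - c m| ≤ L * ‖d n - d m‖) (m : ℕ) :
    mcShane M L d c (d m) = c m := by
  unfold mcShane
  rw [show (⨅ n, (clampTo M (c n) + L * ‖d m - d n‖)) = c m from ?_, clampTo_of_abs_le (hc m)]
  apply le_antisymm
  · refine (ciInf_le (bddBelow_mcShane hM hL d c (d m)) m).trans ?_
    simp [clampTo_of_abs_le (hc m)]
  · refine le_ciInf fun n => ?_
    rw [clampTo_of_abs_le (hc n)]
    have := (abs_le.1 (hd m n)).2
    linarith

theorem measurable_mcShane {α : Type*} [MeasurableSpace α] (M L : ℝ) (d : ℕ → E3)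
    {c : ℕ → α → ℝ} (hc : ∀ n, Measurable (c n)) :
    Measurable fun p : α × E3 => mcShane M L d (fun n => c n p.1) p.2 := by
  unfold mcShane
  refine (measurable_clampTo M).comp (Measurable.iInf fun n => ?_)
  have h1 : Measurable fun p : α × E3 => clampTo M (c n p.1) :=
    (measurable_clampTo M).comp ((hc n).comp measurable_fst)
  have h2 : Measurable fun p : α × E3 => L * ‖p.2 - d n‖ := by fun_prop
  exact h1.add h2

theorem abs_apply_le_norm (x : E3) (i : Fin 3) : |x i| ≤ ‖x‖ := by
  simpa using PiLp.norm_apply_le x i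

theorem norm_le_sum_abs (x : E3) : ‖x‖ ≤ ∑ i, |x i| := by
  rw [EuclideanSpace.norm_eq]
  refine Real.sqrt_le_iff.2 ⟨by positivity, ?_⟩
  simp only [Fin.sum_univ_three, Real.norm_eq_abs]
  nlinarith [abs_nonneg (x 0), abs_nonneg (x 1), abs_nonneg (x 2),
    mul_nonneg (abs_nonneg (x 0)) (abs_nonneg (x 1)),
    mul_nonneg (abs_nonneg (x 1)) (abs_nonneg (x 2)),
    mul_nonneg (abs_nonneg (x 0)) (abs_nonneg (x 2))]

/-- A co-null subset of an open set contains a sequence that is dense in the open set. -/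
theorem exists_dense_seq_of_ae {Ω : Set E3} (hΩ : IsOpen Ω) (hne : Ω.Nonempty) {p : E3 → Prop}
    (hp : ∀ᵐ x ∂(volume.restrict Ω), p x) :
    ∃ d : ℕ → E3, (∀ n, d n ∈ Ω ∧ p (d n)) ∧ Ω ⊆ closure (range d) := by
  set A : Set E3 := {x | x ∈ Ω ∧ p x} with hA
  have hclA : Ω ⊆ closure A := by
    intro x hx
    rw [mem_closure_iff]
    intro o ho hxo
    have hpos : 0 < volume (o ∩ Ω) := (ho.inter hΩ).measure_pos _ ⟨x, hxo, hx⟩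
    by_contra hempty
    rw [ae_restrict_iff' hΩ.measurableSet] at hp
    have : volume (o ∩ Ω) = 0 := by
      refine measure_mono_null ?_ (ae_iff.1 hp)
      rintro y ⟨hyo, hyΩ⟩ hy
      exact hempty ⟨y, hyo, hyΩ, hy hyΩ⟩
    exact hpos.ne' this
  obtain ⟨c, hcA, hcc, hcl⟩ := TopologicalSpace.IsSeparable.exists_countable_dense_subset
    (TopologicalSpace.IsSeparable.of_separableSpace A)
  have hcne : c.Nonempty := by
    obtain ⟨x, hx⟩ := hne
    obtain ⟨y, hy⟩ : A.Nonempty := closure_nonempty_iff.1 ⟨x, hclA hx⟩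
    exact closure_nonempty_iff.1 ⟨y, hcl hy⟩
  obtain ⟨d, rfl⟩ := hcc.exists_eq_range hcne
  refine ⟨d, fun n => hcA (mem_range_self n), hclA.trans ?_⟩
  exact closure_minimal hcl isClosed_closure

/-- A velocity field that is bounded and measurable in the almost-everywhere sense and Lipschitz in
space agrees, at almost every time and at *all* points of `Ω`, with a field on the whole
space-time that is measurable, bounded everywhere and Lipschitz in space at every time. -/
theorem exists_caratheodory_extension {J : Set ℝ} {Ω : Set E3}
    (hΩ : IsOpen Ω) {v : ℝ × E3 → E3} (hv : MemLp v ∞ (volume.restrict (J ×ˢ Ω))) {L : ℝ}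
    (hL : 0 ≤ L)
    (hLip : ∀ t ∈ J, ∀ x ∈ Ω, ∀ y ∈ Ω, ‖v (t, x) - v (t, y)‖ ≤ L * ‖x - y‖) (hJ : MeasurableSet J) :
    ∃ (b : ℝ × E3 → E3) (M K : ℝ), 0 ≤ M ∧ 0 ≤ K ∧ Measurable b ∧ (∀ p, ‖b p‖ ≤ M) ∧
      (∀ t x y, ‖b (t, x) - b (t, y)‖ ≤ K * ‖x - y‖) ∧
      ∀ᵐ t ∂(volume.restrict J), ∀ x ∈ Ω, b (t, x) = v (t, x) := by
  rcases Ω.eq_empty_or_nonempty with rfl | hne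
  · exact ⟨fun _ => 0, 0, 0, le_rfl, le_rfl, measurable_const, by simp, by simp, by simp⟩
  obtain ⟨w, hw, hvw⟩ := hv.1
  set M := (eLpNormEssSup v (volume.restrict (J ×ˢ Ω))).toReal
  have hM : 0 ≤ M := ENNReal.toReal_nonneg
  have hbd : ∀ᵐ p ∂(volume.restrict (J ×ˢ Ω)), ‖v p‖ ≤ M := by
    have hfin : eLpNormEssSup v (volume.restrict (J ×ˢ Ω)) ≠ (∞ : ℝ≥0∞) := by
      have := hv.2
      rw [eLpNorm_exponent_top] at this
      exact this.ne
    filter_upwards [ae_le_eLpNormEssSup (f := v) (μ := volume.restrict (J ×ˢ Ω))] with p hp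
    have := ENNReal.toReal_mono hfin hp
    simpa using this
  have hboth : ∀ᵐ p ∂((volume.restrict Ω).prod (volume.restrict J)),
      v p.swap = w p.swap ∧ ‖v p.swap‖ ≤ M := by
    have h := hvw.and hbd
    rw [Measure.volume_eq_prod, ← Measure.prod_restrict, ← Measure.prod_swap] at h
    exact ae_of_ae_map measurable_swap.aemeasurable h
  obtain ⟨d, hd, hdense⟩ := exists_dense_seq_of_ae hΩ hne (Measure.ae_ae_of_ae_prod hboth)
  have hgood : ∀ᵐ t ∂(volume.restrict J), t ∈ J ∧ ∀ n, v (t, d n) = w (t, d n) ∧ ‖v (t, d n)‖ ≤ M :=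
    (ae_restrict_mem hJ).and (ae_all_iff.2 fun n => (hd n).2)
  let B : Fin 3 → ℝ × E3 → ℝ := fun i p => mcShane M L d (fun n => w (p.1, d n) i) p.2
  have hsum3 : ∀ (f : Fin 3 → ℝ) (c : ℝ), (∀ i, f i ≤ c) → ∑ i, f i ≤ 3 * c := by
    intro f c h
    calc ∑ i, f i ≤ ∑ _i : Fin 3, c := Finset.sum_le_sum fun i _ => h i
      _ = 3 * c := by simp
  refine ⟨fun p => WithLp.toLp 2 fun i => B i p, 3 * M, 3 * L, by positivity, by positivity,
    ?_, ?_, ?_, ?_⟩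
  · refine (PiLp.continuous_toLp 2 _).measurable.comp (measurable_pi_lambda _ fun i => ?_)
    refine measurable_mcShane M L d (c := fun n t => w (t, d n) i) fun n => ?_
    have h1 : Measurable fun t : ℝ => w (t, d n) :=
      hw.measurable.comp (measurable_id.prodMk measurable_const)
    exact ((EuclideanSpace.proj (𝕜 := ℝ) i).continuous.measurable).comp h1
  · intro p
    exact (norm_le_sum_abs _).trans (hsum3 _ _ fun i => abs_mcShane_le hM _ _ _ _)
  · intro t x y
    refine (norm_le_sum_abs _).trans ?_
    rw [mul_assoc]
    exact hsum3 _ _ fun i => abs_mcShane_sub_le hM hL _ _ _ _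
  · filter_upwards [hgood] with t ⟨htJ, ht⟩
    set bt : E3 → E3 := fun x => WithLp.toLp 2 fun i => B i (t, x) with hbt
    have hbc : Continuous bt := by
      refine (PiLp.continuous_toLp 2 _).comp (continuous_pi fun i => ?_)
      refine (LipschitzWith.of_dist_le_mul (K := ⟨L, hL⟩) fun x y => ?_).continuous
      rw [Real.dist_eq, dist_eq_norm]
      exact abs_mcShane_sub_le hM hL _ _ _ _
    have hvc : ContinuousOn (fun x => v (t, x)) Ω := by
      refine (LipschitzOnWith.of_dist_le_mul (K := ⟨L, hL⟩) fun x hx y hy => ?_).continuousOn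
      rw [dist_eq_norm, dist_eq_norm]
      exact hLip t htJ x hx y hy
    have heq : ∀ n, bt (d n) = v (t, d n) := by
      intro n
      ext i
      have := mcShane_eq (L := L) hM hL d (fun n => w (t, d n) i)
        (fun n => (abs_apply_le_norm _ i).trans ((ht n).1 ▸ (ht n).2))
        (fun n m => by
          rw [← (ht n).1, ← (ht m).1]
          exact (abs_apply_le_norm (v (t, d n) - v (t, d m)) i).trans
            (hLip t htJ _ (hd n).1 _ (hd m).1)) n
      simp only [hbt, B]
      rw [this, (ht n).1]
    intro x hx
    obtain ⟨u, hu, hux⟩ := mem_closure_iff_seq_limit.1 (hdense hx)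
    have huΩ : ∀ n, u n ∈ Ω := fun n => by
      obtain ⟨k, hk⟩ := hu n; rw [← hk]; exact (hd k).1
    have h1 : Tendsto (fun n => bt (u n)) atTop (𝓝 (bt x)) := (hbc.tendsto x).comp hux
    have h2 : Tendsto (fun n => v (t, u n)) atTop (𝓝 (v (t, x))) :=
      (hvc x hx).tendsto.comp (tendsto_nhdsWithin_iff.2 ⟨hux, Eventually.of_forall huΩ⟩)
    refine tendsto_nhds_unique h1 (h2.congr fun n => ?_)
    obtain ⟨k, hk⟩ := hu n
    rw [← hk, heq]

/-! ### The flow of a field that acts during a short time -/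

/-- A measurable bounded velocity field that is Lipschitz in space and vanishes outside a time
interval `[α, β]` so short that the Picard operator is a contraction with factor `1 / 2`. -/
structure IsShortField (b : ℝ × E3 → E3) (M K α β : ℝ) : Prop where
  measurable : Measurable b
  bound_nonneg : 0 ≤ M
  const_nonneg : 0 ≤ K
  norm_le : ∀ p, ‖b p‖ ≤ M
  lipschitz : ∀ t x y, ‖b (t, x) - b (t, y)‖ ≤ K * ‖x - y‖
  eq_zero : ∀ t, t ∉ Icc α β → ∀ x, b (t, x) = 0
  le : α ≤ β
  short : K * (β - α) ≤ 1 / 2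

/-- `y` is the integral curve of `b` through `x` at time `t`, defined for all times. -/
structure IsIntegralCurveThrough (b : ℝ × E3 → E3) (t : ℝ) (x : E3) (y : ℝ → E3) : Prop where
  continuous : Continuous y
  eq : ∀ s, y s = x + ∫ τ in t..s, b (τ, y τ)

namespace IsShortField

variable {b : ℝ × E3 → E3} {M K α β : ℝ}

theorem measurable_comp (h : IsShortField b M K α β) {y : ℝ → E3} (hy : Continuous y) :
    Measurable fun s => b (s, y s) :=
  h.measurable.comp (measurable_id.prodMk hy.measurable)

theorem integrable_comp (h : IsShortField b M K α β) {y : ℝ → E3} (hy : Continuous y) :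
    Integrable fun s => b (s, y s) := by
  have h1 : IntegrableOn (fun s => b (s, y s)) (Icc α β) :=
    Measure.integrableOn_of_bounded (M := M) (by simp)
      (h.measurable_comp hy).aestronglyMeasurable (ae_of_all _ fun s => h.norm_le _)
  exact h1.integrable_of_forall_notMem_eq_zero fun s hs => h.eq_zero s hs _

theorem norm_integral_le_of_eq_zero {f : ℝ → E3} {c : ℝ} (hαβ : α ≤ β) (hc : ∀ s, ‖f s‖ ≤ c)
    (hz : ∀ s, s ∉ Icc α β → f s = 0) (t s : ℝ) : ‖∫ τ in t..s, f τ‖ ≤ c * (β - α) := by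
  have hc0 : 0 ≤ c := (norm_nonneg _).trans (hc 0)
  rw [intervalIntegral.norm_intervalIntegral_eq]
  have h1 : ∫ τ in uIoc t s, f τ = ∫ τ in uIoc t s ∩ Icc α β, f τ := by
    refine (setIntegral_eq_of_subset_of_forall_sdiff_eq_zero measurableSet_uIoc inter_subset_left
      fun τ hτ => hz τ fun hτ' => hτ.2 ⟨hτ.1, hτ'⟩)
  rw [h1]
  have hle : volume (uIoc t s ∩ Icc α β) ≤ ENNReal.ofReal (β - α) :=
    (measure_mono inter_subset_right).trans (by simp)
  refine (norm_setIntegral_le_of_norm_le_const (hle.trans_lt ENNReal.ofReal_lt_top)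
    fun τ _ => hc τ).trans ?_
  refine mul_le_mul_of_nonneg_left ?_ hc0
  exact ENNReal.toReal_le_of_le_ofReal (by linarith) hle

theorem norm_integral_sub_le (h : IsShortField b M K α β) {y z : ℝ → E3} (hy : Continuous y)
    (hz : Continuous z) {C : ℝ} (hC : ∀ s, ‖y s - z s‖ ≤ C) (t s : ℝ) :
    ‖(∫ τ in t..s, b (τ, y τ)) - ∫ τ in t..s, b (τ, z τ)‖ ≤ C / 2 := by
  have hC0 : 0 ≤ C := (norm_nonneg _).trans (hC 0)
  rw [← intervalIntegral.integral_sub (h.integrable_comp hy).intervalIntegrable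
    (h.integrable_comp hz).intervalIntegrable]
  refine (norm_integral_le_of_eq_zero (c := K * C) h.le (fun τ => ?_) (fun τ hτ => ?_) t s).trans ?_
  · exact (h.lipschitz _ _ _).trans (mul_le_mul_of_nonneg_left (hC τ) h.const_nonneg)
  · rw [h.eq_zero τ hτ, h.eq_zero τ hτ, sub_zero]
  · nlinarith [h.short]

/-- Picard's theorem: the integral curve is the fixed point of a contraction of the space of
bounded continuous curves. -/
theorem exists_integralCurve (h : IsShortField b M K α β) (t : ℝ) (x : E3) :
    ∃ y, IsIntegralCurveThrough b t x y := by
  have hbd : ∀ y : BoundedContinuousFunction ℝ E3, ∀ s, ‖x + ∫ τ in t..s, b (τ, y τ)‖ ≤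
      ‖x‖ + M * (β - α) := fun y s =>
    (norm_add_le _ _).trans (add_le_add le_rfl (norm_integral_le_of_eq_zero h.le
      (fun τ => h.norm_le _) (fun τ hτ => h.eq_zero τ hτ _) t s))
  let T : BoundedContinuousFunction ℝ E3 → BoundedContinuousFunction ℝ E3 := fun y =>
    BoundedContinuousFunction.ofNormedAddCommGroup (fun s => x + ∫ τ in t..s, b (τ, y τ))
      (continuous_const.add (intervalIntegral.continuous_primitive
        (fun _ _ => (h.integrable_comp y.continuous).intervalIntegrable) t))
      (‖x‖ + M * (β - α)) (hbd y)
  have hT : ContractingWith (1 / 2 : ℝ≥0) T := by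
    refine ⟨by norm_num, LipschitzWith.of_dist_le_mul fun y z => ?_⟩
    rw [BoundedContinuousFunction.dist_le (by positivity)]
    intro s
    have := h.norm_integral_sub_le y.continuous z.continuous (C := dist y z)
      (fun s => by rw [← dist_eq_norm]; exact BoundedContinuousFunction.dist_coe_le_dist s) t s
    simp only [T, BoundedContinuousFunction.coe_ofNormedAddCommGroup, dist_add_left]
    rw [dist_eq_norm]
    refine this.trans (le_of_eq ?_)
    push_cast
    ring
  obtain ⟨y, hy⟩ : ∃ y, T y = y := ⟨_, hT.fixedPoint_isFixedPt⟩
  refine ⟨y, y.continuous, fun s => ?_⟩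
  conv_lhs => rw [← hy]
  rfl

theorem norm_curve_sub_le (h : IsShortField b M K α β) {t : ℝ} {x x' : E3} {y z : ℝ → E3}
    (hy : IsIntegralCurveThrough b t x y) (hz : IsIntegralCurveThrough b t x' z) (s : ℝ) :
    ‖y s - z s‖ ≤ 2 * ‖x - x'‖ := by
  have step : ∀ C, (∀ s, ‖y s - z s‖ ≤ C) → ∀ s, ‖y s - z s‖ ≤ ‖x - x'‖ + C / 2 := by
    intro C hC s
    rw [hy.eq s, hz.eq s, add_sub_add_comm]
    exact (norm_add_le _ _).trans (add_le_add le_rfl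
      (h.norm_integral_sub_le hy.continuous hz.continuous hC t s))
  have hbd : BddAbove (range fun s => ‖y s - z s‖) := by
    refine ⟨‖x - x'‖ + (M * (β - α) + M * (β - α)), ?_⟩
    rintro _ ⟨s, rfl⟩
    simp only
    rw [hy.eq s, hz.eq s, add_sub_add_comm]
    refine (norm_add_le _ _).trans (add_le_add le_rfl ((norm_sub_le _ _).trans ?_))
    exact add_le_add
      (norm_integral_le_of_eq_zero h.le (fun τ => h.norm_le _) (fun τ hτ => h.eq_zero τ hτ _) t s)
      (norm_integral_le_of_eq_zero h.le (fun τ => h.norm_le _) (fun τ hτ => h.eq_zero τ hτ _) t s)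
  have h1 : (⨆ s, ‖y s - z s‖) ≤ ‖x - x'‖ + (⨆ s, ‖y s - z s‖) / 2 :=
    ciSup_le (step _ fun s => le_ciSup hbd s)
  have h2 := le_ciSup hbd s
  linarith

theorem curve_unique (h : IsShortField b M K α β) {t : ℝ} {x : E3} {y z : ℝ → E3}
    (hy : IsIntegralCurveThrough b t x y) (hz : IsIntegralCurveThrough b t x z) (s : ℝ) :
    y s = z s := by
  have := h.norm_curve_sub_le hy hz s
  rw [sub_self, norm_zero, mul_zero] at this
  exact sub_eq_zero.1 (norm_le_zero_iff.1 this)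

end IsShortField

theorem IsIntegralCurveThrough.self {b : ℝ × E3 → E3} {t : ℝ} {x : E3} {y : ℝ → E3}
    (hy : IsIntegralCurveThrough b t x y) : y t = x := by
  simpa using hy.eq t

theorem IsIntegralCurveThrough.sub_eq {b : ℝ × E3 → E3} {M K α β : ℝ}
    (h : IsShortField b M K α β) {t : ℝ} {x : E3} {y : ℝ → E3}
    (hy : IsIntegralCurveThrough b t x y) (r s : ℝ) :
    y s - y r = ∫ τ in r..s, b (τ, y τ) := by
  have hi : ∀ a c : ℝ, IntervalIntegrable (fun τ => b (τ, y τ)) volume a c := fun a c =>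
    (h.integrable_comp hy.continuous).intervalIntegrable
  rw [hy.eq s, hy.eq r, add_sub_add_left_eq_sub,
    intervalIntegral.integral_interval_sub_left (hi _ _) (hi _ _)]

theorem IsIntegralCurveThrough.restart {b : ℝ × E3 → E3} {M K α β : ℝ}
    (h : IsShortField b M K α β) {t : ℝ} {x : E3} {y : ℝ → E3}
    (hy : IsIntegralCurveThrough b t x y) (r : ℝ) : IsIntegralCurveThrough b r (y r) y :=
  ⟨hy.continuous, fun s => by rw [← hy.sub_eq h r s]; abel⟩

theorem IsIntegralCurveThrough.norm_sub_le {b : ℝ × E3 → E3} {M K α β : ℝ}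
    (h : IsShortField b M K α β) {t : ℝ} {x : E3} {y : ℝ → E3}
    (hy : IsIntegralCurveThrough b t x y) (r s : ℝ) : ‖y s - y r‖ ≤ M * |s - r| := by
  rw [hy.sub_eq h r s]
  exact intervalIntegral.norm_integral_le_of_norm_le_const fun τ _ => h.norm_le _

/-- `X s t x` is the position at time `s` of the particle that is in `x` at time `t`. -/
def IsFlow (b : ℝ × E3 → E3) (X : ℝ → ℝ → E3 → E3) : Prop :=
  ∀ t x, IsIntegralCurveThrough b t x fun s => X s t x

theorem IsShortField.exists_flow {b : ℝ × E3 → E3} {M K α β : ℝ} (h : IsShortField b M K α β) :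
    ∃ X, IsFlow b X := by
  choose Y hY using h.exists_integralCurve
  exact ⟨fun s t x => Y t x s, hY⟩

namespace IsFlow

variable {b : ℝ × E3 → E3} {M K α β : ℝ} {X : ℝ → ℝ → E3 → E3}

theorem self (hX : IsFlow b X) (t : ℝ) (x : E3) : X t t x = x := (hX t x).self

theorem eq_of_curve (h : IsShortField b M K α β) (hX : IsFlow b X) {t : ℝ} {x : E3} {y : ℝ → E3}
    (hy : IsIntegralCurveThrough b t x y) (s r : ℝ) : X s r (y r) = y s :=
  h.curve_unique (hX r (y r)) (hy.restart h r) s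

theorem comp (h : IsShortField b M K α β) (hX : IsFlow b X) (s r t : ℝ) (x : E3) :
    X s r (X r t x) = X s t x := hX.eq_of_curve h (hX t x) s r

theorem norm_sub_le (h : IsShortField b M K α β) (hX : IsFlow b X) (s t : ℝ) (x : E3) :
    ‖X s t x - x‖ ≤ M * |s - t| := by
  have := (hX t x).norm_sub_le h t s
  simpa only [hX.self] using this

theorem lipschitzWith (h : IsShortField b M K α β) (hX : IsFlow b X) (s t : ℝ) :
    LipschitzWith 2 (X s t) :=
  LipschitzWith.of_dist_le_mul fun x y => by
    rw [dist_eq_norm, dist_eq_norm]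
    exact h.norm_curve_sub_le (hX t x) (hX t y) s

/-- The flow map is Lipschitz jointly in the time and the point of departure. -/
theorem lipschitzWith_uncurry (h : IsShortField b M K α β) (hX : IsFlow b X) (s : ℝ) :
    LipschitzWith (Real.toNNReal (2 + 2 * M)) fun p : ℝ × E3 => X s p.1 p.2 := by
  refine LipschitzWith.of_dist_le_mul ?_
  rintro ⟨t, x⟩ ⟨r, y⟩
  have hM := h.bound_nonneg
  rw [Real.coe_toNNReal _ (by linarith)]
  simp only
  have h0 : X s t x = X s r (X r t x) := (hX.comp h s r t x).symm
  have h1 : dist (X s r (X r t x)) (X s r y) ≤ 2 * dist (X r t x) y :=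
    (hX.lipschitzWith h s r).dist_le_mul _ _
  have h2 : dist (X r t x) y ≤ dist (X r t x) x + dist x y := dist_triangle _ _ _
  have h3 : dist (X r t x) x ≤ M * |r - t| := by
    rw [dist_eq_norm]; exact hX.norm_sub_le h r t x
  have h4 : |r - t| ≤ dist (t, x) (r, y) := by
    rw [← Real.dist_eq, dist_comm]; exact le_max_left _ _
  have h5 : dist x y ≤ dist (t, x) (r, y) := le_max_right _ _
  rw [h0]
  nlinarith [mul_le_mul_of_nonneg_left h4 hM]

end IsFlow

/-! ### Velocities and the transport equation -/

/-- At almost every time *all* integral curves have the derivative prescribed by the field. The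
exceptional null set does not depend on the curve: it suffices that the time is a Lebesgue point of
`b (·, x)` for the points `x` of a countable dense set. -/
theorem IsShortField.ae_hasDerivAt {b : ℝ × E3 → E3} {M K α β : ℝ} (h : IsShortField b M K α β) :
    ∀ᵐ t : ℝ, ∀ x y, IsIntegralCurveThrough b t x y → HasDerivAt y (b (t, x)) t := by
  set d := TopologicalSpace.denseSeq E3 with hd
  have hall : ∀ᵐ t : ℝ, ∀ n, ∀ c, HasDerivAt (fun s => ∫ τ in c..s, b (τ, d n)) (b (t, d n)) t :=
    ae_all_iff.2 fun n =>
      LocallyIntegrable.ae_hasDerivAt_integral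
        (h.integrable_comp (continuous_const (y := d n))).locallyIntegrable
  filter_upwards [hall] with t ht x y hy
  rw [hasDerivAt_iff_isLittleO, Asymptotics.isLittleO_iff]
  intro c hc
  have hM := h.bound_nonneg
  have hK := h.const_nonneg
  obtain ⟨n, hn⟩ : ∃ n, K * ‖x - d n‖ ≤ c / 8 := by
    have : ∃ n, dist x (d n) < c / (8 * (K + 1)) :=
      (TopologicalSpace.denseRange_denseSeq E3).exists_dist_lt x (by positivity)
    obtain ⟨n, hn⟩ := this
    refine ⟨n, ?_⟩
    rw [dist_eq_norm, lt_div_iff₀ (by positivity)] at hn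
    nlinarith [norm_nonneg (x - d n)]
  have h1 := ht n t
  rw [hasDerivAt_iff_isLittleO, Asymptotics.isLittleO_iff] at h1
  have h1' := h1 (show 0 < c / 4 by positivity)
  have h2 : ∀ᶠ s in 𝓝 t, K * (M * |s - t|) < c / 4 := by
    have : Tendsto (fun s => K * (M * |s - t|)) (𝓝 t) (𝓝 (K * (M * |t - t|))) := by
      apply Continuous.tendsto; fun_prop
    refine this.eventually_lt_const ?_
    simp only [sub_self, abs_zero, mul_zero]
    positivity
  filter_upwards [h1', h2] with s hs1 hs2
  rw [intervalIntegral.integral_same, sub_zero] at hs1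
  have hi := (h.integrable_comp hy.continuous).intervalIntegrable (a := t) (b := s)
  have hi' := (h.integrable_comp (continuous_const (y := d n))).intervalIntegrable (a := t) (b := s)
  have e1 : y s - y t - (s - t) • b (t, x) = (∫ τ in t..s, (b (τ, y τ) - b (τ, d n))) +
      ((∫ τ in t..s, b (τ, d n)) - (s - t) • b (t, d n)) +
      (s - t) • (b (t, d n) - b (t, x)) := by
    rw [hy.sub_eq h, intervalIntegral.integral_sub hi hi', smul_sub]
    abel
  have e2 : ‖∫ τ in t..s, (b (τ, y τ) - b (τ, d n))‖ ≤ (c / 4 + c / 8) * |s - t| := by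
    refine intervalIntegral.norm_integral_le_of_norm_le_const fun τ hτ => ?_
    refine (h.lipschitz _ _ _).trans ?_
    have hτ' : |τ - t| ≤ |s - t| := abs_sub_left_of_mem_uIcc (uIoc_subset_uIcc hτ)
    have h3 : ‖y τ - d n‖ ≤ M * |s - t| + ‖x - d n‖ := by
      have h4 := hy.norm_sub_le h t τ
      rw [hy.self] at h4
      calc ‖y τ - d n‖ = ‖(y τ - x) + (x - d n)‖ := by abel_nf
        _ ≤ _ := (norm_add_le _ _).trans (add_le_add (h4.trans
          (mul_le_mul_of_nonneg_left hτ' hM)) le_rfl)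
    nlinarith [mul_le_mul_of_nonneg_left h3 hK]
  have e3 : ‖(s - t) • (b (t, d n) - b (t, x))‖ ≤ (c / 8) * |s - t| := by
    rw [norm_smul, Real.norm_eq_abs, mul_comm]
    refine mul_le_mul_of_nonneg_right ?_ (abs_nonneg _)
    refine (h.lipschitz _ _ _).trans ?_
    rwa [norm_sub_rev]
  rw [e1]
  refine (norm_add₃_le).trans ?_
  rw [Real.norm_eq_abs] at *
  nlinarith [abs_nonneg (s - t)]

/-- A function of the position that the flow assigns at a fixed time `r` is constant along the
trajectories, hence solves the transport equation at almost every point. -/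
theorem IsFlow.ae_transport {b : ℝ × E3 → E3} {M K α β : ℝ} {X : ℝ → ℝ → E3 → E3}
    (h : IsShortField b M K α β) (hX : IsFlow b X) {f : E3 → ℝ} {C : ℝ≥0} (hf : LipschitzWith C f)
    (r : ℝ) : ∀ᵐ p : ℝ × E3, DifferentiableAt ℝ (fun p : ℝ × E3 => f (X r p.1 p.2)) p ∧
      fderiv ℝ (fun p : ℝ × E3 => f (X r p.1 p.2)) p (1, b p) = 0 := by
  have hu : LipschitzWith (C * Real.toNNReal (2 + 2 * M)) fun p : ℝ × E3 => f (X r p.1 p.2) :=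
    hf.comp (hX.lipschitzWith_uncurry h r)
  have hder : ∀ᵐ p : ℝ × E3, ∀ x y, IsIntegralCurveThrough b p.1 x y →
      HasDerivAt y (b (p.1, x)) p.1 :=
    Measure.quasiMeasurePreserving_fst.ae h.ae_hasDerivAt
  filter_upwards [hu.ae_differentiableAt, hder] with p hp1 hp2
  refine ⟨hp1, ?_⟩
  obtain ⟨t, x⟩ := p
  have h1 : HasDerivAt (fun s => (s, X s t x)) ((1 : ℝ), b (t, x)) t :=
    (hasDerivAt_id t).prodMk (hp2 x _ (hX t x))
  have hp1' : HasFDerivAt (fun p : ℝ × E3 => f (X r p.1 p.2))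
      (fderiv ℝ (fun p : ℝ × E3 => f (X r p.1 p.2)) (t, x)) (t, X t t x) := by
    rw [hX.self]; exact hp1.hasFDerivAt
  have h2 := hp1'.comp_hasDerivAt t h1
  have h3 : ((fun p : ℝ × E3 => f (X r p.1 p.2)) ∘ fun s => (s, X s t x)) =
      fun _ => f (X r t x) := by
    funext s
    simp only [Function.comp_apply, hX.comp h]
  rw [h3] at h2
  exact h2.unique (hasDerivAt_const t _)

/-! ### Weak derivatives tested with bounded functions -/

/-- `w'` is a bounded function that is the weak derivative of `w` on `ℝ × ℝ³` in direction `e`. -/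
structure IsBoundedWeakDeriv (e : ℝ × E3) (w w' : ℝ × E3 → ℝ) : Prop where
  aestronglyMeasurable : AEStronglyMeasurable w' volume
  bounded : ∃ C, ∀ p, |w' p| ≤ C
  integral_eq : ∀ φ : ℝ × E3 → ℝ, ContDiff ℝ ∞ φ → HasCompactSupport φ →
    ∫ p, w p * fderiv ℝ φ p e = - ∫ p, w' p * φ p

/-- A bounded measurable function with compact support in `U`. -/
structure IsBoundedTest (U : Set (ℝ × E3)) (w : ℝ × E3 → ℝ) : Prop where
  aestronglyMeasurable : AEStronglyMeasurable w volume
  bounded : ∃ C, ∀ p, |w p| ≤ C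
  compact : HasCompactSupport w
  support : tsupport w ⊆ U

theorem locallyIntegrable_of_bounded {w : ℝ × E3 → ℝ} (hw : AEStronglyMeasurable w volume) {C : ℝ}
    (hC : ∀ p, |w p| ≤ C) : LocallyIntegrable w :=
  (locallyIntegrable_const C).mono hw (ae_of_all _ fun p => (hC p).trans (le_abs_self C))

open ContinuousLinearMap in
theorem abs_convolution_normed_le (ρ : ContDiffBump (0 : ℝ × E3)) {w : ℝ × E3 → ℝ} {C : ℝ}
    (hC : ∀ p, |w p| ≤ C) (p : ℝ × E3) :
    |convolution (ρ.normed volume) w (lsmul ℝ ℝ) volume p| ≤ C := by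
  rw [convolution_eq_swap, ← Real.norm_eq_abs]
  have hi : Integrable (fun q => ρ.normed volume (p - q) * C) :=
    (ρ.integrable_normed.comp_sub_left p).mul_const C
  refine (norm_integral_le_of_norm_le hi (ae_of_all _ fun q => ?_)).trans (le_of_eq ?_)
  · rw [lsmul_apply, smul_eq_mul, norm_mul, Real.norm_of_nonneg (ρ.nonneg_normed _)]
    exact mul_le_mul_of_nonneg_left (hC q) (ρ.nonneg_normed _)
  · rw [integral_mul_const, integral_sub_left_eq_self (fun q => ρ.normed volume q) volume p,
      ρ.integral_normed, one_mul]

open ContinuousLinearMap in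
theorem IsBoundedWeakDeriv.fderiv_convolution {e : ℝ × E3} {w w' : ℝ × E3 → ℝ}
    (h : IsBoundedWeakDeriv e w w') (hw : LocallyIntegrable w)
    (ρ : ContDiffBump (0 : ℝ × E3)) (p : ℝ × E3) :
    fderiv ℝ (convolution (ρ.normed volume) w (lsmul ℝ ℝ) volume) p e =
      convolution (ρ.normed volume) w' (lsmul ℝ ℝ) volume p := by
  have hρ : ContDiff ℝ ∞ (ρ.normed volume) := ρ.contDiff_normed
  have hρ1 : ContDiff ℝ 1 (ρ.normed volume) := ρ.contDiff_normed
  have hρc : HasCompactSupport (ρ.normed volume) := ρ.hasCompactSupport_normed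
  rw [← convolution_flip,
    (hρc.hasFDerivAt_convolution_right (lsmul ℝ ℝ).flip hw hρ1 p).fderiv,
    convolution_precompR_apply _ hw (hρc.fderiv ℝ) (hρ1.continuous_fderiv one_ne_zero),
    convolution_def, convolution_eq_swap]
  have hφ : ContDiff ℝ ∞ fun q => ρ.normed volume (p - q) :=
    hρ.comp (contDiff_const.sub contDiff_id)
  have hφc : HasCompactSupport fun q => ρ.normed volume (p - q) :=
    hρc.comp_homeomorph (Homeomorph.subLeft p)
  have hd : ∀ q, fderiv ℝ (fun q => ρ.normed volume (p - q)) q e =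
      - fderiv ℝ (ρ.normed volume) (p - q) e := by
    intro q
    have h1 := (hρ1.differentiable one_ne_zero (p - q)).hasFDerivAt.comp q
      ((hasFDerivAt_id q).const_sub p)
    have h2 : HasFDerivAt (fun q => ρ.normed volume (p - q)) _ q := h1
    rw [h2.fderiv]
    simp
  have h1 := h.integral_eq _ hφ hφc
  simp only [hd, mul_neg, integral_neg, neg_inj] at h1
  simp only [flip_apply, lsmul_apply, smul_eq_mul]
  calc _ = ∫ q, w q * fderiv ℝ (ρ.normed volume) (p - q) e :=
        integral_congr_ae (ae_of_all _ fun q => mul_comm _ _)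
    _ = _ := h1
    _ = _ := integral_congr_ae (ae_of_all _ fun q => mul_comm _ _)

open ContinuousLinearMap in
/-- Mollification approximates a bounded test function by smooth ones, boundedly almost everywhere,
together with all its bounded weak derivatives. -/
theorem IsBoundedTest.exists_approx {U : Set (ℝ × E3)} (hU : IsOpen U) {w : ℝ × E3 → ℝ}
    (hw : IsBoundedTest U w) :
    ∃ φ : ℕ → ℝ × E3 → ℝ, (∀ n, IsTestFunction U (φ n)) ∧ (∃ C, ∀ n p, |φ n p| ≤ C) ∧
      (∀ᵐ p, Tendsto (fun n => φ n p) atTop (𝓝 (w p))) ∧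
      ∀ e w', IsBoundedWeakDeriv e w w' → (∃ C, ∀ n p, |fderiv ℝ (φ n) p e| ≤ C) ∧
        ∀ᵐ p, Tendsto (fun n => fderiv ℝ (φ n) p e) atTop (𝓝 (w' p)) := by
  obtain ⟨δ, hδ, hδU⟩ := hw.compact.isCompact.exists_cthickening_subset_open hU hw.support
  obtain ⟨C, hC⟩ := hw.bounded
  have hloc := locallyIntegrable_of_bounded hw.aestronglyMeasurable hC
  let ρ : ℕ → ContDiffBump (0 : ℝ × E3) := fun n =>
    ⟨δ / (n + 1) / 2, δ / (n + 1), by positivity, half_lt_self (by positivity)⟩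
  have hr : Tendsto (fun n => (ρ n).rOut) atTop (𝓝 0) := by
    have := (tendsto_one_div_add_atTop_nhds_zero_nat (𝕜 := ℝ)).const_mul δ
    simpa [ρ, div_eq_mul_inv] using this
  have hr2 : ∀ᶠ n in atTop, (ρ n).rOut ≤ 2 * (ρ n).rIn :=
    Eventually.of_forall fun n => by simp only [ρ]; linarith
  have hsupp : ∀ n, Function.support (convolution ((ρ n).normed volume) w (lsmul ℝ ℝ) volume) ⊆
      Metric.cthickening δ (tsupport w) := by
    intro n
    refine (support_convolution_subset _).trans ?_
    rintro _ ⟨a, ha, c, hc, rfl⟩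
    have h1 : δ / (n + 1) ≤ δ := div_le_self hδ.le (by linarith [n.cast_nonneg (α := ℝ)])
    have h2 : ∀ z ∈ Function.support ((ρ n).normed volume), ‖z‖ ≤ δ := by
      intro z hz
      rw [ContDiffBump.support_normed_eq, mem_ball_zero_iff] at hz
      exact hz.le.trans h1
    refine Metric.mem_cthickening_of_dist_le (a + c) c δ _ (subset_tsupport w hc) ?_
    simpa [dist_eq_norm] using h2 a ha
  have hK : IsCompact (Metric.cthickening δ (tsupport w)) := hw.compact.isCompact.cthickening
  refine ⟨fun n => convolution ((ρ n).normed volume) w (lsmul ℝ ℝ) volume, fun n => ⟨?_, ?_, ?_⟩,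
    ⟨C, fun n p => abs_convolution_normed_le _ hC p⟩,
    ContDiffBump.ae_convolution_tendsto_right_of_locallyIntegrable hr hr2 hloc, ?_⟩
  · exact (ρ n).hasCompactSupport_normed.contDiff_convolution_left _ (ρ n).contDiff_normed hloc
  · exact HasCompactSupport.of_support_subset_isCompact hK (hsupp n)
  · exact (closure_minimal (hsupp n) Metric.isClosed_cthickening).trans hδU
  · intro e w' hw'
    obtain ⟨C', hC'⟩ := hw'.bounded
    simp only [hw'.fderiv_convolution hloc]
    exact ⟨⟨C', fun n p => abs_convolution_normed_le _ hC' p⟩,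
      ContDiffBump.ae_convolution_tendsto_right_of_locallyIntegrable hr hr2
        (locallyIntegrable_of_bounded hw'.aestronglyMeasurable hC')⟩

/-- Dominated convergence for the pairing of an integrable function with a boundedly convergent
sequence of continuous functions. -/
theorem tendsto_integral_mul_of_bounded {U : Set (ℝ × E3)} {ψ w : ℝ × E3 → ℝ}
    (hψ : IntegrableOn ψ U) {φ : ℕ → ℝ × E3 → ℝ} (hφ : ∀ n, Continuous (φ n))
    {C : ℝ} (hC : ∀ n p, |φ n p| ≤ C) (hlim : ∀ᵐ p, Tendsto (fun n => φ n p) atTop (𝓝 (w p))) :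
    Tendsto (fun n => ∫ p in U, ψ p * φ n p) atTop (𝓝 (∫ p in U, ψ p * w p)) := by
  refine tendsto_integral_of_dominated_convergence (fun p => ‖ψ p‖ * C) (fun n => ?_)
    (hψ.norm.mul_const C) (fun n => ae_of_all _ fun p => ?_) ?_
  · exact hψ.aestronglyMeasurable.mul (hφ n).aestronglyMeasurable
  · rw [norm_mul]; exact mul_le_mul_of_nonneg_left (hC n p) (norm_nonneg _)
  · filter_upwards [ae_restrict_of_ae hlim] with p hp using hp.const_mul _

theorem HasWeakDeriv.integral_mul_eq {U : Set (ℝ × E3)} (hU : IsOpen U) {e : ℝ × E3}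
    {ψ g w w' : ℝ × E3 → ℝ} (hψ : IntegrableOn ψ U) (h : HasWeakDeriv U e ψ g)
    (hw : IsBoundedTest U w) (hw' : IsBoundedWeakDeriv e w w') :
    ∫ p in U, ψ p * w' p = - ∫ p in U, g p * w p := by
  obtain ⟨φ, hφ, ⟨C, hC⟩, hlim, hder⟩ := hw.exists_approx hU
  obtain ⟨⟨C', hC'⟩, hlim'⟩ := hder e w' hw'
  have h1 := tendsto_integral_mul_of_bounded hψ (φ := fun n p => fderiv ℝ (φ n) p e)
    (fun n => ((hφ n).smooth.continuous_fderiv (by simp)).clm_apply continuous_const) hC' hlim'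
  have h2 := (tendsto_integral_mul_of_bounded h.1 (fun n => (hφ n).smooth.continuous) hC hlim).neg
  refine tendsto_nhds_unique h1 (h2.congr fun n => ?_)
  exact (h.2 _ (hφ n)).symm

theorem clm_apply_eq_sum (A : ℝ × E3 →L[ℝ] ℝ) (y : E3) :
    A (0, y) = ∑ i, y i * A (0, EuclideanSpace.single i 1) := by
  have : ((0 : ℝ), y) = ∑ i, y i • ((0 : ℝ), EuclideanSpace.single i (1 : ℝ)) := by
    have hy : y = ∑ i, y i • EuclideanSpace.single i (1 : ℝ) := by
      ext j
      fin_cases j <;> simp [Fin.sum_univ_three]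
    refine Prod.ext ?_ ?_
    · simp [Prod.fst_sum]
    · rw [Prod.snd_sum]; exact hy
  conv_lhs => rw [this, map_sum]
  simp only [map_smul, smul_eq_mul]

theorem HasWeakSpaceDiv.integral_mul_eq {U : Set (ℝ × E3)} (hU : IsOpen U)
    {W : ℝ × E3 → E3} {d w : ℝ × E3 → ℝ} {w' : Fin 3 → ℝ × E3 → ℝ} (hW : IntegrableOn W U)
    (h : HasWeakSpaceDiv U W d) (hw : IsBoundedTest U w)
    (hw' : ∀ i, IsBoundedWeakDeriv (0, EuclideanSpace.single i 1) w (w' i)) :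
    ∫ p in U, ∑ i, W p i * w' i p = - ∫ p in U, d p * w p := by
  obtain ⟨φ, hφ, ⟨C, hC⟩, hlim, hder⟩ := hw.exists_approx hU
  have hWi : ∀ i, IntegrableOn (fun p => W p i) U := fun i =>
    (EuclideanSpace.proj (𝕜 := ℝ) i).integrable_comp hW
  have hcont : ∀ n i, Continuous fun p => fderiv ℝ (φ n) p (0, EuclideanSpace.single i 1) :=
    fun n i => ((hφ n).smooth.continuous_fderiv (by simp)).clm_apply continuous_const
  choose C' hC' using fun i => (hder _ _ (hw' i)).1
  have hint : ∀ i f, AEStronglyMeasurable f (volume.restrict U) → (∃ c, ∀ p, |f p| ≤ c) →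
      IntegrableOn (fun p => W p i * f p) U := by
    rintro i f hf ⟨c, hc⟩
    exact (hWi i).mul_bdd (c := c) hf (ae_of_all _ hc)
  rw [integral_finsetSum _ fun i _ =>
    hint i _ (hw' i).aestronglyMeasurable.restrict (hw' i).bounded]
  have h1 : Tendsto
      (fun n => ∑ i, ∫ p in U, W p i * fderiv ℝ (φ n) p (0, EuclideanSpace.single i 1)) atTop
      (𝓝 (∑ i, ∫ p in U, W p i * w' i p)) :=
    tendsto_finsetSum _ fun i _ => tendsto_integral_mul_of_bounded (hWi i)
      (fun n => hcont n i) (hC' i) (hder _ _ (hw' i)).2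
  have h2 := (tendsto_integral_mul_of_bounded h.1 (fun n => (hφ n).smooth.continuous) hC hlim).neg
  refine tendsto_nhds_unique h1 (h2.congr fun n => ?_)
  rw [← h.2 _ (hφ n), ← integral_finsetSum _ fun i _ =>
    hint i _ (hcont n i).aestronglyMeasurable ⟨_, hC' i n⟩]
  exact integral_congr_ae (ae_of_all _ fun p => clm_apply_eq_sum _ _)

theorem LipschitzWith.isBoundedWeakDeriv {w : ℝ × E3 → ℝ} {C : ℝ≥0} (hw : LipschitzWith C w)
    (e : ℝ × E3) : IsBoundedWeakDeriv e w fun p => fderiv ℝ w p e where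
  aestronglyMeasurable :=
    ((measurable_fderiv_apply_const ℝ w e)).aestronglyMeasurable
  bounded := ⟨C * ‖e‖, fun p => ((fderiv ℝ w p).le_opNorm e).trans
    (mul_le_mul_of_nonneg_right (norm_fderiv_le_of_lipschitz ℝ hw) (norm_nonneg _))⟩
  integral_eq := by
    intro φ hφ hφc
    obtain ⟨D, hD⟩ := (hφ.of_le (by simp) : ContDiff ℝ 1 φ).lipschitzWith_of_hasCompactSupport
      hφc one_ne_zero
    have h1 := hw.integral_lineDeriv_mul_eq (μ := volume) hD hφc e
    have h2 : ∫ p, fderiv ℝ w p e * φ p = ∫ p, lineDeriv ℝ w p e * φ p := by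
      refine integral_congr_ae ?_
      filter_upwards [hw.ae_differentiableAt] with p hp
      simp only [hp.lineDeriv_eq_fderiv]
    rw [h2, h1, ← integral_neg]
    refine integral_congr_ae (ae_of_all _ fun p => ?_)
    simp only [(hφ.differentiable (by simp) p).lineDeriv_eq_fderiv, map_neg]
    ring

theorem LipschitzWith.isBoundedTest {U : Set (ℝ × E3)} {w : ℝ × E3 → ℝ} {C : ℝ≥0}
    (hw : LipschitzWith C w) (hc : HasCompactSupport w) (hU : tsupport w ⊆ U) :
    IsBoundedTest U w := by
  obtain ⟨D, hD⟩ := hc.exists_bound_of_continuous hw.continuous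
  exact ⟨hw.continuous.aestronglyMeasurable, ⟨D, hD⟩, hc, hU⟩

/-! ### Recovering increments from weak derivatives in time -/

/-- The piecewise linear function that is `0` before `s` and `1` after `s + ε`. -/
noncomputable def ramp (s ε t : ℝ) : ℝ := max 0 (min 1 ((t - s) / ε))

theorem ramp_of_le {s ε t : ℝ} (hε : 0 < ε) (h : t ≤ s) : ramp s ε t = 0 := by
  have : (t - s) / ε ≤ 0 := div_nonpos_of_nonpos_of_nonneg (by linarith) hε.le
  exact max_eq_left ((min_le_right _ _).trans this)

theorem ramp_of_ge {s ε t : ℝ} (hε : 0 < ε) (h : s + ε ≤ t) : ramp s ε t = 1 := by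
  have : 1 ≤ (t - s) / ε := by rw [le_div_iff₀ hε]; linarith
  rw [ramp, min_eq_left this, max_eq_right zero_le_one]

theorem ramp_mem (s ε t : ℝ) : 0 ≤ ramp s ε t ∧ ramp s ε t ≤ 1 :=
  ⟨le_max_left _ _, max_le zero_le_one (min_le_left _ _)⟩

theorem lipschitzWith_ramp (s : ℝ) {ε : ℝ} (hε : 0 < ε) :
    LipschitzWith (Real.toNNReal ε⁻¹) (ramp s ε) := by
  refine LipschitzWith.of_dist_le_mul fun t r => ?_
  rw [Real.coe_toNNReal _ (by positivity), Real.dist_eq, Real.dist_eq]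
  unfold ramp
  calc _ ≤ |min 1 ((t - s) / ε) - min 1 ((r - s) / ε)| := by
        simpa [max_comm] using abs_max_sub_max_le_abs (min 1 ((t - s) / ε)) (min 1 ((r - s) / ε)) 0
    _ ≤ |(t - s) / ε - (r - s) / ε| := by
        simpa using abs_min_sub_min_le_max 1 ((t - s) / ε) 1 ((r - s) / ε)
    _ = _ := by
        rw [← sub_div, abs_div, abs_of_pos hε, sub_sub_sub_cancel_right, div_eq_inv_mul]

theorem hasDerivAt_ramp {s ε t : ℝ} (hε : 0 < ε) (h1 : t ≠ s) (h2 : t ≠ s + ε) :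
    HasDerivAt (ramp s ε) ((Ioc s (s + ε)).indicator (fun _ => ε⁻¹) t) t := by
  rcases lt_or_gt_of_ne h1 with h | h
  · rw [indicator_of_notMem (by simp [h.le])]
    refine (hasDerivAt_const t (0 : ℝ)).congr_of_eventuallyEq ?_
    filter_upwards [Iio_mem_nhds h] with r hr using ramp_of_le hε (le_of_lt hr)
  rcases lt_or_gt_of_ne h2 with h' | h'
  · rw [indicator_of_mem (show t ∈ Ioc s (s + ε) from ⟨h, h'.le⟩)]
    have hd : HasDerivAt (fun r => (r - s) / ε) ε⁻¹ t := by
      simpa using ((hasDerivAt_id t).sub_const s).div_const ε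
    refine hd.congr_of_eventuallyEq ?_
    filter_upwards [Ioo_mem_nhds h h'] with r hr
    have a1 : 0 ≤ (r - s) / ε := div_nonneg (by linarith [hr.1]) hε.le
    have a2 : (r - s) / ε ≤ 1 := by rw [div_le_iff₀ hε]; linarith [hr.2]
    rw [ramp, min_eq_right a2, max_eq_right a1]
  · rw [indicator_of_notMem (by simp [h'])]
    refine (hasDerivAt_const t (1 : ℝ)).congr_of_eventuallyEq ?_
    filter_upwards [Ioi_mem_nhds h'] with r hr using ramp_of_ge hε (le_of_lt hr)

theorem ae_deriv_ramp_sub (s r : ℝ) {ε : ℝ} (hε : 0 < ε) :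
    ∀ᵐ t : ℝ, deriv (fun t => ramp s ε t - ramp r ε t) t =
      (Ioc s (s + ε)).indicator (fun _ => ε⁻¹) t - (Ioc r (r + ε)).indicator (fun _ => ε⁻¹) t := by
  have hne : ∀ c : ℝ, ∀ᵐ t : ℝ, t ≠ c := fun c => by simp [ae_iff]
  filter_upwards [hne s, hne (s + ε), hne r, hne (r + ε)] with t h1 h2 h3 h4
  exact ((hasDerivAt_ramp hε h1 h2).sub (hasDerivAt_ramp hε h3 h4)).deriv

theorem tendsto_average_right {F : ℝ → ℝ} {s r : ℝ} (hsr : s < r) (hF : ContinuousOn F (Icc s r)) :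
    Tendsto (fun ε => ε⁻¹ * ∫ t in s..s + ε, F t) (𝓝[>] 0) (𝓝 (F s)) := by
  have hc : ContinuousWithinAt F (Ici s) s :=
    (hF s ⟨le_rfl, hsr.le⟩).mono_of_mem_nhdsWithin (Icc_mem_nhdsGE hsr)
  have hmeas : StronglyMeasurableAtFilter F (𝓝[>] s) volume :=
    ⟨Ioc s r, Ioc_mem_nhdsGT hsr,
      (hF.mono Ioc_subset_Icc_self).aestronglyMeasurable measurableSet_Ioc⟩
  have hd : HasDerivWithinAt (fun u => ∫ t in s..u, F t) (F s) (Ici s) s :=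
    intervalIntegral.integral_hasDerivWithinAt_right (by simp) hmeas
      (hc.mono Ioi_subset_Ici_self)
  have h1 := (hasDerivWithinAt_iff_tendsto_slope' (by simp)).1 (hd.mono Ioi_subset_Ici_self)
  have h2 : Tendsto (fun ε : ℝ => s + ε) (𝓝[>] 0) (𝓝[>] s) := by
    refine tendsto_nhdsWithin_iff.2 ⟨?_, ?_⟩
    · have : Tendsto (fun ε : ℝ => s + ε) (𝓝 0) (𝓝 (s + 0)) := by
        apply Continuous.tendsto; fun_prop
      rw [add_zero] at this
      exact this.mono_left nhdsWithin_le_nhds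
    · filter_upwards [self_mem_nhdsWithin] with ε hε
      simpa using hε
  refine (h1.comp h2).congr fun ε => ?_
  simp [slope_def_field, div_eq_inv_mul]

/-- If `F` is continuous and `K` is its weak derivative, then the increments of `F` are integrals
of `K`. The test functions `ramp s ε - ramp r ε` converge to the indicator function of
`(s, r]`. -/
theorem sub_eq_integral_of_weak_deriv {J : Set ℝ} {F K : ℝ → ℝ} {s r r' : ℝ}
    (hsr : s ≤ r) (hr : r < r') (hsub : Icc s r' ⊆ J) (hF : ContinuousOn F (Icc s r'))
    (hK : IntegrableOn K J)
    (h : ∀ (η : ℝ → ℝ) (C : ℝ≥0), LipschitzWith C η → (∀ t, t ∉ Icc s r' → η t = 0) →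
      ∫ t in J, deriv η t * F t = - ∫ t in J, η t * K t) :
    F r - F s = ∫ t in s..r, K t := by
  have hsmall : ∀ᶠ ε : ℝ in 𝓝[>] 0, 0 < ε ∧ r + ε ≤ r' := by
    filter_upwards [Ioc_mem_nhdsGT (show (0 : ℝ) < r' - r by linarith)] with ε hε
    exact ⟨hε.1, by linarith [hε.2]⟩
  have hw : ∀ᶠ ε : ℝ in 𝓝[>] 0, (ε⁻¹ * ∫ t in s..s + ε, F t) - (ε⁻¹ * ∫ t in r..r + ε, F t) =
      - ∫ t in J, (ramp s ε t - ramp r ε t) * K t := by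
    filter_upwards [hsmall] with ε ⟨hε, hεr⟩
    rw [← h _ _ ((lipschitzWith_ramp s hε).sub (lipschitzWith_ramp r hε)) ?_]
    · have hone : ∀ c, s ≤ c → c ≤ r → ∫ t in J, (Ioc c (c + ε)).indicator (fun _ => ε⁻¹) t * F t =
          ε⁻¹ * ∫ t in c..c + ε, F t := by
        intro c hc1 hc2
        have e1 : (fun t => (Ioc c (c + ε)).indicator (fun _ => ε⁻¹) t * F t) =
            (Ioc c (c + ε)).indicator fun t => ε⁻¹ * F t := by
          funext t; by_cases ht : t ∈ Ioc c (c + ε) <;> simp [ht]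
        rw [e1, setIntegral_indicator measurableSet_Ioc, inter_eq_self_of_subset_right,
          integral_const_mul, intervalIntegral.integral_of_le (by linarith)]
        exact fun t ht => hsub ⟨by linarith [ht.1], by linarith [ht.2]⟩
      have hint : ∀ c, s ≤ c → c ≤ r →
          IntegrableOn (fun t => (Ioc c (c + ε)).indicator (fun _ => ε⁻¹) t * F t) J := by
        intro c hc1 hc2
        have hFi : IntegrableOn F (Ioc c (c + ε)) := by
          refine (hF.integrableOn_Icc).mono_set fun t ht => ?_
          exact ⟨by linarith [ht.1], by linarith [ht.2]⟩
        have e1 : (fun t => (Ioc c (c + ε)).indicator (fun _ => ε⁻¹) t * F t) =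
            (Ioc c (c + ε)).indicator fun t => ε⁻¹ * F t := by
          funext t; by_cases ht : t ∈ Ioc c (c + ε) <;> simp [ht]
        rw [e1]
        have h3 : IntegrableOn (fun t => ε⁻¹ * F t) (Ioc c (c + ε)) := hFi.const_mul ε⁻¹
        exact (h3.integrable_indicator measurableSet_Ioc).integrableOn
      rw [← hone s le_rfl hsr, ← hone r hsr le_rfl,
        ← integral_sub (hint s le_rfl hsr) (hint r hsr le_rfl)]
      refine integral_congr_ae ?_
      filter_upwards [ae_restrict_of_ae (ae_deriv_ramp_sub s r hε)] with t ht
      rw [ht, sub_mul]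
    · intro t ht
      simp only [mem_Icc, not_and_or, not_le] at ht
      rcases ht with ht | ht
      · rw [ramp_of_le hε ht.le, ramp_of_le hε (by linarith), sub_zero]
      · rw [ramp_of_ge hε (by linarith), ramp_of_ge hε (by linarith), sub_self]
  have hlim1 := (tendsto_average_right (by linarith) hF).sub
    (tendsto_average_right hr (hF.mono (Icc_subset_Icc_left hsr)))
  have hramp : ∀ c t : ℝ, Tendsto (fun ε => ramp c ε t) (𝓝[>] 0)
      (𝓝 ((Ioi c).indicator (fun _ => 1) t)) := by
    intro c t
    by_cases hct : c < t
    · rw [indicator_of_mem (show t ∈ Ioi c from hct)]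
      refine tendsto_const_nhds.congr' ?_
      filter_upwards [Ioc_mem_nhdsGT (show (0 : ℝ) < t - c by linarith)] with ε hε
      exact (ramp_of_ge hε.1 (by linarith [hε.2])).symm
    · rw [indicator_of_notMem (by simpa using hct)]
      refine tendsto_const_nhds.congr' ?_
      filter_upwards [self_mem_nhdsWithin] with ε hε
      exact (ramp_of_le hε (not_lt.1 hct)).symm
  have hlim2 : Tendsto (fun ε => ∫ t in J, (ramp s ε t - ramp r ε t) * K t) (𝓝[>] 0)
      (𝓝 (∫ t in J, (Ioc s r).indicator K t)) := by
    refine tendsto_integral_filter_of_dominated_convergence (fun t => ‖K t‖) ?_ ?_ hK.norm ?_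
    · filter_upwards [self_mem_nhdsWithin] with ε hε
      exact ((lipschitzWith_ramp s hε).sub
        (lipschitzWith_ramp r hε)).continuous.aestronglyMeasurable.mul hK.aestronglyMeasurable
    · refine Eventually.of_forall fun ε => ae_of_all _ fun t => ?_
      rw [norm_mul]
      refine mul_le_of_le_one_left (norm_nonneg _) ?_
      rw [Real.norm_eq_abs, abs_le]
      constructor <;> linarith [(ramp_mem s ε t).1, (ramp_mem s ε t).2, (ramp_mem r ε t).1,
        (ramp_mem r ε t).2]
    · refine ae_of_all _ fun t => ?_
      have e1 : (Ioc s r).indicator K t = ((Ioi s).indicator (fun _ => 1) t -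
          (Ioi r).indicator (fun _ => 1) t) * K t := by
        by_cases h1 : s < t
        · by_cases h2 : t ≤ r
          · simp [h1, h2, not_lt.2 h2]
          · simp [h1, h2, not_le.1 h2]
        · have h2 : ¬ r < t := by linarith
          simp [h1, h2]
      rw [e1]
      exact ((hramp s t).sub (hramp r t)).mul_const _
  have h3 := tendsto_nhds_unique (hlim1.congr' hw) hlim2.neg
  rw [setIntegral_indicator measurableSet_Ioc, inter_eq_self_of_subset_right,
    ← intervalIntegral.integral_of_le hsr] at h3
  · linarith
  · exact fun t ht => hsub ⟨ht.1.le, ht.2.trans hr.le⟩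

/-! ### The transport identity near one time -/

theorem LipschitzWith.mul_of_bounded {α : Type*} [PseudoMetricSpace α] {f g : α → ℝ} {C D : ℝ≥0}
    (hf : LipschitzWith C f) (hg : LipschitzWith D g) {A B : ℝ≥0} (hA : ∀ x, |f x| ≤ A)
    (hB : ∀ x, |g x| ≤ B) : LipschitzWith (A * D + B * C) fun x => f x * g x := by
  refine LipschitzWith.of_dist_le_mul fun x y => ?_
  rw [Real.dist_eq]
  have e : f x * g x - f y * g y = f x * (g x - g y) + g y * (f x - f y) := by ring
  have h1 := hg.dist_le_mul x y
  have h2 := hf.dist_le_mul x y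
  rw [Real.dist_eq] at h1 h2
  rw [e]
  refine (abs_add_le _ _).trans ?_
  rw [abs_mul, abs_mul]
  push_cast
  have h3 := mul_le_mul (hA x) h1 (abs_nonneg _) A.2
  have h4 := mul_le_mul (hB y) h2 (abs_nonneg _) B.2
  nlinarith

theorem volume_restrict_prod (J : Set ℝ) (Ω : Set E3) :
    (volume.restrict (J ×ˢ Ω) : Measure (ℝ × E3)) =
      (volume.restrict J).prod (volume.restrict Ω) := by
  rw [Measure.volume_eq_prod, Measure.prod_restrict]

section

variable {J : Set ℝ} {Ω : Set E3} {b v : ℝ × E3 → E3} {M K α β : ℝ} {X : ℝ → ℝ → E3 → E3}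
  {ψ ψ' g d : ℝ × E3 → ℝ}

/-- The weak identities of `ψ`, tested with `η(t) u(t, x)` where `u` is constant along the
trajectories: the derivatives of `u` cancel by the transport equation. -/
theorem integral_deriv_mul_transported (hJ : IsOpen J) (hΩ : IsOpen Ω) (h : IsShortField b M K α β)
    (hX : IsFlow b X) (hJI : Icc α β ⊆ J)
    (hbv : ∀ᵐ t ∂(volume.restrict (Icc α β)), ∀ x ∈ Ω, b (t, x) = v (t, x))
    (hψ : IntegrableOn ψ (J ×ˢ Ω)) (hψv : IntegrableOn (fun p => ψ p • v p) (J ×ˢ Ω))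
    (hg : HasWeakTimeDeriv (J ×ˢ Ω) ψ g) (hd : HasWeakSpaceDiv (J ×ˢ Ω) (fun p => ψ p • v p) d)
    (t₁ : ℝ) {f : E3 → ℝ} {C : ℝ≥0} (hf : LipschitzWith C f) (hf1 : ∀ x, |f x| ≤ 1)
    {S : Set E3} (hS : IsCompact S) (hSΩ : S ⊆ Ω)
    (hfS : ∀ t ∈ Icc α β, ∀ x, x ∉ S → f (X t₁ t x) = 0)
    {η : ℝ → ℝ} {D : ℝ≥0} (hη : LipschitzWith D η) (hη0 : ∀ t, t ∉ Icc α β → η t = 0) :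
    ∫ p in J ×ˢ Ω, ψ p * (deriv η p.1 * f (X t₁ p.1 p.2)) =
      - ∫ p in J ×ˢ Ω, (g p + d p) * (η p.1 * f (X t₁ p.1 p.2)) := by
  have hU : IsOpen (J ×ˢ Ω) := hJ.prod hΩ
  set u : ℝ × E3 → ℝ := fun p => f (X t₁ p.1 p.2) with hu
  set w : ℝ × E3 → ℝ := fun p => η p.1 * u p with hw
  obtain ⟨A, hA⟩ : ∃ A : ℝ≥0, ∀ t, |η t| ≤ A := by
    have hηc : HasCompactSupport η := HasCompactSupport.intro isCompact_Icc fun t ht => hη0 t ht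
    obtain ⟨A, hA⟩ := hηc.exists_bound_of_continuous hη.continuous
    exact ⟨⟨A, (norm_nonneg _).trans (hA 0)⟩, hA⟩
  have hulip : LipschitzWith (C * Real.toNNReal (2 + 2 * M)) u :=
    hf.comp (hX.lipschitzWith_uncurry h t₁)
  have hwlip : LipschitzWith _ w :=
    (hη.comp LipschitzWith.prod_fst).mul_of_bounded hulip (A := A) (B := 1) (fun p => hA _)
      (fun p => by simpa using hf1 _)
  have hwsupp : Function.support w ⊆ Icc α β ×ˢ S := by
    intro p hp
    by_contra hcon
    rw [mem_prod, not_and_or] at hcon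
    apply hp
    by_cases ht : p.1 ∈ Icc α β
    · simp only [hw, hu]
      rw [hfS p.1 ht p.2 (hcon.resolve_left (not_not.2 ht)), mul_zero]
    · simp only [hw]
      rw [hη0 _ ht, zero_mul]
  have hcpt : IsCompact (Icc α β ×ˢ S) := isCompact_Icc.prod hS
  have hwc : HasCompactSupport w := HasCompactSupport.of_support_subset_isCompact hcpt hwsupp
  have hwU : tsupport w ⊆ J ×ˢ Ω :=
    (closure_minimal hwsupp hcpt.isClosed).trans (prod_mono hJI hSΩ)
  have htest : IsBoundedTest (J ×ˢ Ω) w := hwlip.isBoundedTest hwc hwU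
  have e1 := HasWeakDeriv.integral_mul_eq hU hψ hg htest (hwlip.isBoundedWeakDeriv _)
  have e2 := HasWeakSpaceDiv.integral_mul_eq hU hψv hd htest
    (w' := fun i p => fderiv ℝ w p (0, EuclideanSpace.single i 1))
    (fun i => hwlip.isBoundedWeakDeriv _)
  obtain ⟨B, hB⟩ := htest.bounded
  have hwm : AEStronglyMeasurable w (volume.restrict (J ×ˢ Ω)) :=
    htest.aestronglyMeasurable.restrict
  have hi1 : IntegrableOn (fun p => g p * w p) (J ×ˢ Ω) :=
    hg.1.mul_bdd (c := B) hwm (ae_of_all _ hB)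
  have hi2 : IntegrableOn (fun p => d p * w p) (J ×ˢ Ω) :=
    hd.1.mul_bdd (c := B) hwm (ae_of_all _ hB)
  have hbd := fun e : ℝ × E3 => (hwlip.isBoundedWeakDeriv e)
  have hi3 : IntegrableOn (fun p => ψ p * fderiv ℝ w p (1, 0)) (J ×ˢ Ω) := by
    obtain ⟨c, hc⟩ := (hbd (1, 0)).bounded
    exact hψ.mul_bdd (c := c) (hbd (1, 0)).aestronglyMeasurable.restrict (ae_of_all _ hc)
  have hi4 : IntegrableOn (fun p => ∑ i, (ψ p • v p) i *
      fderiv ℝ w p (0, EuclideanSpace.single i 1)) (J ×ˢ Ω) := by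
    refine integrable_finsetSum _ fun i _ => ?_
    obtain ⟨c, hc⟩ := (hbd (0, EuclideanSpace.single i 1)).bounded
    exact ((EuclideanSpace.proj (𝕜 := ℝ) i).integrable_comp hψv).mul_bdd (c := c)
      (hbd _).aestronglyMeasurable.restrict (ae_of_all _ hc)
  have hae : ∀ᵐ p : ℝ × E3 ∂(volume.restrict (J ×ˢ Ω)), ψ p * (deriv η p.1 * u p) =
      ψ p * fderiv ℝ w p (1, 0) +
        ∑ i, (ψ p • v p) i * fderiv ℝ w p (0, EuclideanSpace.single i 1) := by
    have hη' : ∀ᵐ p : ℝ × E3, DifferentiableAt ℝ η p.1 :=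
      Measure.quasiMeasurePreserving_fst.ae hη.ae_differentiableAt
    have hbv' : ∀ᵐ p : ℝ × E3, p.1 ∈ Icc α β → ∀ x ∈ Ω, b (p.1, x) = v (p.1, x) :=
      Measure.quasiMeasurePreserving_fst.ae ((ae_restrict_iff' measurableSet_Icc).1 hbv)
    filter_upwards [ae_restrict_of_ae (hX.ae_transport h hf t₁), ae_restrict_of_ae hη',
      ae_restrict_of_ae hbv', ae_restrict_mem hU.measurableSet] with p hp1 hp2 hp3 hpU
    have hη1 : HasFDerivAt (fun p : ℝ × E3 => η p.1) _ p :=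
      hp2.hasDerivAt.hasFDerivAt.comp p hasFDerivAt_fst
    have hw1 : HasFDerivAt w _ p := hη1.mul hp1.1.hasFDerivAt
    have hlin : ∀ y : E3, fderiv ℝ w p (1, y) = deriv η p.1 * u p +
        η p.1 * fderiv ℝ u p (1, y) := by
      intro y
      rw [hw1.fderiv]
      simp [hu]
      ring
    rw [← clm_apply_eq_sum, show ((0 : ℝ), ψ p • v p) = ψ p • ((0 : ℝ), v p) by simp, map_smul,
      smul_eq_mul, ← mul_add, ← map_add, Prod.mk_add_mk, add_zero, zero_add, hlin]
    by_cases ht : p.1 ∈ Icc α β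
    · have h3 : fderiv ℝ u p (1, v p) = 0 := by
        have := hp1.2
        rwa [show b p = v p from hp3 ht p.2 hpU.2] at this
      rw [h3, mul_zero, add_zero]
    · rw [hη0 _ ht, zero_mul, add_zero]
  rw [integral_congr_ae hae, integral_add hi3 hi4, e1, e2, ← neg_add, ← integral_add hi1 hi2]
  simp only [add_mul, hw, hu]

/-- The weighted integrals of a time-continuous function over space, with a weight transported by
the flow, depend continuously on time. -/
theorem continuousOn_integral_transported (h : IsShortField b M K α β)
    (hX : IsFlow b X) (hψ' : IsTimeContinuousRep J Ω ψ ψ')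
    (t₁ : ℝ) {f : E3 → ℝ} (hf : Continuous f) (hf1 : ∀ x, |f x| ≤ 1) :
    ContinuousOn (fun t => ∫ x in Ω, ψ' (t, x) * f (X t₁ t x)) J := by
  intro t ht
  have hXt : ∀ s, Continuous fun x => f (X t₁ s x) := fun s =>
    hf.comp (hX.lipschitzWith h t₁ s).continuous
  have hXx : ∀ x, Continuous fun s => f (X t₁ s x) := fun x =>
    hf.comp ((hX.lipschitzWith_uncurry h t₁).continuous.comp
      (continuous_id.prodMk continuous_const))
  have hint : ∀ (a : E3 → ℝ), IntegrableOn a Ω → ∀ s,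
      IntegrableOn (fun x => a x * f (X t₁ s x)) Ω :=
    fun a ha s => ha.mul_bdd (c := 1) (hXt s).aestronglyMeasurable (ae_of_all _ fun x => hf1 _)
  have h2 : Tendsto (fun s => ∫ x in Ω, ψ' (t, x) * f (X t₁ s x)) (𝓝[J] t)
      (𝓝 (∫ x in Ω, ψ' (t, x) * f (X t₁ t x))) := by
    refine tendsto_integral_filter_of_dominated_convergence (fun x => ‖ψ' (t, x)‖) ?_ ?_
      (hψ'.integrable t ht).norm ?_
    · exact Eventually.of_forall fun s => (hint _ (hψ'.integrable t ht) s).aestronglyMeasurable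
    · refine Eventually.of_forall fun s => ae_of_all _ fun x => ?_
      rw [norm_mul]
      exact mul_le_of_le_one_right (norm_nonneg _) (hf1 _)
    · exact ae_of_all _ fun x => (((hXx x).tendsto t).mono_left nhdsWithin_le_nhds).const_mul _
  have h1 : Tendsto (fun s => ∫ x in Ω, (ψ' (s, x) - ψ' (t, x)) * f (X t₁ s x)) (𝓝[J] t)
      (𝓝 0) := by
    refine squeeze_zero_norm' ?_ (hψ'.continuous t ht)
    filter_upwards [self_mem_nhdsWithin] with s hs
    refine norm_integral_le_of_norm_le ((hψ'.integrable s hs).sub (hψ'.integrable t ht)).abs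
      (ae_of_all _ fun x => ?_)
    rw [norm_mul]
    exact mul_le_of_le_one_right (norm_nonneg _) (hf1 _)
  have h3 := h1.add h2
  rw [zero_add] at h3
  refine h3.congr' ?_
  filter_upwards [self_mem_nhdsWithin] with s hs
  rw [← integral_add (hint (fun x => ψ' (s, x) - ψ' (t, x))
    ((hψ'.integrable s hs).sub (hψ'.integrable t ht)) s) (hint _ (hψ'.integrable t ht) s)]
  refine integral_congr_ae (ae_of_all _ fun x => ?_)
  simp only
  ring

theorem integral_transported_sub (hJ : IsOpen J) (hΩ : IsOpen Ω) (h : IsShortField b M K α β)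
    (hX : IsFlow b X) (hJI : Icc α β ⊆ J)
    (hbv : ∀ᵐ t ∂(volume.restrict (Icc α β)), ∀ x ∈ Ω, b (t, x) = v (t, x))
    (hψ : IntegrableOn ψ (J ×ˢ Ω)) (hψv : IntegrableOn (fun p => ψ p • v p) (J ×ˢ Ω))
    (hψ' : IsTimeContinuousRep J Ω ψ ψ')
    (hg : HasWeakTimeDeriv (J ×ˢ Ω) ψ g) (hd : HasWeakSpaceDiv (J ×ˢ Ω) (fun p => ψ p • v p) d)
    (t₁ : ℝ) {f : E3 → ℝ} {C : ℝ≥0} (hf : LipschitzWith C f) (hf1 : ∀ x, |f x| ≤ 1)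
    {S : Set E3} (hS : IsCompact S) (hSΩ : S ⊆ Ω)
    (hfS : ∀ t ∈ Icc α β, ∀ x, x ∉ S → f (X t₁ t x) = 0)
    {s r : ℝ} (hαs : α ≤ s) (hsr : s ≤ r) (hrβ : r < β) :
    (∫ x in Ω, ψ' (r, x) * f (X t₁ r x)) - ∫ x in Ω, ψ' (s, x) * f (X t₁ s x) =
      ∫ t in s..r, ∫ x in Ω, (g (t, x) + d (t, x)) * f (X t₁ t x) := by
  have hu : Continuous fun p : ℝ × E3 => f (X t₁ p.1 p.2) :=
    hf.continuous.comp (hX.lipschitzWith_uncurry h t₁).continuous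
  have hgd : IntegrableOn (fun p => (g p + d p) * f (X t₁ p.1 p.2)) (J ×ˢ Ω) :=
    (hg.1.add hd.1).mul_bdd (c := 1) hu.aestronglyMeasurable (ae_of_all _ fun p => hf1 _)
  have hψu : IntegrableOn (fun p => ψ' p * f (X t₁ p.1 p.2)) (J ×ˢ Ω) :=
    (hψ.congr hψ'.ae_eq.symm).mul_bdd (c := 1) hu.aestronglyMeasurable (ae_of_all _ fun p => hf1 _)
  refine sub_eq_integral_of_weak_deriv (J := J)
    (F := fun t => ∫ x in Ω, ψ' (t, x) * f (X t₁ t x)) hsr hrβ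
    ((Icc_subset_Icc_left hαs).trans hJI) ?_ ?_ ?_
  · exact (continuousOn_integral_transported h hX hψ' t₁ hf.continuous hf1).mono
      ((Icc_subset_Icc_left hαs).trans hJI)
  · rw [IntegrableOn, volume_restrict_prod] at hgd
    exact hgd.integral_prod_left
  · intro η D hη hη0
    have hη0' : ∀ t, t ∉ Icc α β → η t = 0 := fun t ht =>
      hη0 t fun ht' => ht (Icc_subset_Icc_left hαs ht')
    have key := integral_deriv_mul_transported hJ hΩ h hX hJI hbv hψ hψv hg hd t₁ hf hf1 hS hSΩ
      hfS hη hη0'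
    obtain ⟨A, hA⟩ : ∃ A : ℝ, ∀ t, |η t| ≤ A :=
      (HasCompactSupport.intro isCompact_Icc fun t ht => hη0 t ht).exists_bound_of_continuous
        hη.continuous
    have hi1 : IntegrableOn (fun p : ℝ × E3 => η p.1 * ((g p + d p) * f (X t₁ p.1 p.2)))
        (J ×ˢ Ω) :=
      hgd.bdd_mul (c := A) (hη.continuous.comp continuous_fst).aestronglyMeasurable
        (ae_of_all _ fun p => hA _)
    have hi2 : IntegrableOn (fun p : ℝ × E3 => deriv η p.1 * (ψ' p * f (X t₁ p.1 p.2)))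
        (J ×ˢ Ω) :=
      hψu.bdd_mul (c := D) ((measurable_deriv η).comp measurable_fst).aestronglyMeasurable
        (ae_of_all _ fun p => norm_deriv_le_of_lipschitz hη)
    have e1 : ∫ p in J ×ˢ Ω, ψ p * (deriv η p.1 * f (X t₁ p.1 p.2)) =
        ∫ p in J ×ˢ Ω, deriv η p.1 * (ψ' p * f (X t₁ p.1 p.2)) := by
      refine integral_congr_ae ?_
      filter_upwards [hψ'.ae_eq] with p hp
      rw [hp]; ring
    have e2 : ∫ p in J ×ˢ Ω, (g p + d p) * (η p.1 * f (X t₁ p.1 p.2)) =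
        ∫ p in J ×ˢ Ω, η p.1 * ((g p + d p) * f (X t₁ p.1 p.2)) :=
      integral_congr_ae (ae_of_all _ fun p => by ring)
    rw [IntegrableOn, volume_restrict_prod] at hi1 hi2
    rw [e1, e2, volume_restrict_prod, integral_prod _ hi1, integral_prod _ hi2] at key
    simpa only [integral_const_mul] using key

/-- A Lipschitz cutoff function that is `1` on `G` and `0` at distance `ε` from `G`. -/
noncomputable def cutoff (G : Set E3) (ε : ℝ) (x : E3) : ℝ := max 0 (1 - Metric.infDist x G / ε)

theorem cutoff_mem {G : Set E3} {ε : ℝ} (hε : 0 < ε) (x : E3) :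
    0 ≤ cutoff G ε x ∧ cutoff G ε x ≤ 1 := by
  refine ⟨le_max_left _ _, max_le zero_le_one ?_⟩
  have : 0 ≤ Metric.infDist x G / ε := div_nonneg Metric.infDist_nonneg hε.le
  linarith

theorem abs_cutoff_le {G : Set E3} {ε : ℝ} (hε : 0 < ε) (x : E3) : |cutoff G ε x| ≤ 1 := by
  rw [abs_of_nonneg (cutoff_mem hε x).1]; exact (cutoff_mem hε x).2

theorem cutoff_eq_zero {G : Set E3} {ε : ℝ} (hε : 0 < ε) {x : E3} (hx : ε ≤ Metric.infDist x G) :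
    cutoff G ε x = 0 := by
  have : 1 ≤ Metric.infDist x G / ε := by rwa [le_div_iff₀ hε, one_mul]
  exact max_eq_left (by linarith)

theorem cutoff_eq_one {G : Set E3} {ε : ℝ} {x : E3} (hx : x ∈ G) : cutoff G ε x = 1 := by
  simp [cutoff, Metric.infDist_zero_of_mem hx]

theorem lipschitzWith_cutoff (G : Set E3) {ε : ℝ} (hε : 0 < ε) :
    LipschitzWith (Real.toNNReal ε⁻¹) (cutoff G ε) := by
  refine LipschitzWith.of_dist_le_mul fun x y => ?_
  rw [Real.coe_toNNReal _ (by positivity), Real.dist_eq]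
  unfold cutoff
  calc _ ≤ |(1 - Metric.infDist x G / ε) - (1 - Metric.infDist y G / ε)| := by
        simpa [max_comm] using abs_max_sub_max_le_abs (1 - Metric.infDist x G / ε)
          (1 - Metric.infDist y G / ε) 0
    _ = ε⁻¹ * dist (Metric.infDist x G) (Metric.infDist y G) := by
        rw [sub_sub_sub_cancel_left, ← sub_div, abs_div, abs_of_pos hε, Real.dist_eq, abs_sub_comm]
        ring
    _ ≤ _ := mul_le_mul_of_nonneg_left
        (by simpa using (Metric.lipschitz_infDist_pt G).dist_le_mul x y) (by positivity)

theorem tendsto_cutoff {G : Set E3} (hG : IsClosed G) (hne : G.Nonempty) {ε : ℝ} (hε : 0 < ε)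
    (x : E3) : Tendsto (fun n : ℕ => cutoff G (ε / (n + 1)) x) atTop
      (𝓝 (G.indicator (fun _ => 1) x)) := by
  by_cases hx : x ∈ G
  · simp only [cutoff_eq_one hx, indicator_of_mem hx, tendsto_const_nhds_iff]
  · rw [indicator_of_notMem hx]
    have hpos : 0 < Metric.infDist x G := (hG.notMem_iff_infDist_pos hne).1 hx
    have hlim : Tendsto (fun n : ℕ => ε / ((n : ℝ) + 1)) atTop (𝓝 0) := by
      have := (tendsto_one_div_add_atTop_nhds_zero_nat (𝕜 := ℝ)).const_mul ε
      simpa [div_eq_mul_inv] using this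
    refine tendsto_const_nhds.congr' ?_
    filter_upwards [hlim.eventually_lt_const hpos] with n hn
    exact (cutoff_eq_zero (by positivity) hn.le).symm

theorem preimage_subset_cthickening (h : IsShortField b M K α β) (hX : IsFlow b X) {G : Set E3}
    {ρ : ℝ} (hρM : M * (β - α) ≤ ρ) {t₁ t : ℝ} (ht₁ : t₁ ∈ Icc α β) (ht : t ∈ Icc α β) :
    X t₁ t ⁻¹' G ⊆ Metric.cthickening ρ G := by
  intro x hx
  refine Metric.mem_cthickening_of_dist_le x (X t₁ t x) ρ G hx ?_
  rw [dist_comm, dist_eq_norm]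
  refine (hX.norm_sub_le h t₁ t x).trans (le_trans ?_ hρM)
  refine mul_le_mul_of_nonneg_left ?_ h.bound_nonneg
  rw [abs_le]
  constructor <;> linarith [ht.1, ht.2, ht₁.1, ht₁.2]

/-- The density that the transport identity integrates in time is integrable. -/
theorem integrableOn_integral_comoving (h : IsShortField b M K α β)
    (hX : IsFlow b X) {k : ℝ × E3 → ℝ} (hk : IntegrableOn k (J ×ˢ Ω)) {G : Set E3}
    (hG : IsCompact G) {ρ : ℝ} (hρΩ : Metric.cthickening ρ G ⊆ Ω) (hρM : M * (β - α) ≤ ρ)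
    (hJI : Icc α β ⊆ J) {t₁ : ℝ} (ht₁ : t₁ ∈ Icc α β) :
    IntegrableOn (fun t => ∫ x in X t₁ t ⁻¹' G, k (t, x)) (Icc α β) := by
  have hmeas : MeasurableSet {p : ℝ × E3 | X t₁ p.1 p.2 ∈ G} :=
    (hG.isClosed.preimage (hX.lipschitzWith_uncurry h t₁).continuous).measurableSet
  have h1 : IntegrableOn ({p : ℝ × E3 | X t₁ p.1 p.2 ∈ G}.indicator k) (Icc α β ×ˢ Ω) :=
    (hk.mono_set (prod_mono hJI Subset.rfl)).indicator hmeas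
  rw [IntegrableOn, volume_restrict_prod] at h1
  have h2 : IntegrableOn _ (Icc α β) := h1.integral_prod_left
  refine h2.congr_fun (fun t ht => ?_) measurableSet_Icc
  have hsub := (preimage_subset_cthickening h hX hρM ht₁ ht).trans hρΩ
  have hm : MeasurableSet (X t₁ t ⁻¹' G) :=
    (hG.isClosed.preimage (hX.lipschitzWith h t₁ t).continuous).measurableSet
  have e : (fun x => {p : ℝ × E3 | X t₁ p.1 p.2 ∈ G}.indicator k (t, x)) =
      (X t₁ t ⁻¹' G).indicator fun x => k (t, x) := rfl
  simp only [e]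
  rw [setIntegral_indicator hm, inter_eq_self_of_subset_right hsub]

/-- The transport identity in integrated form near one time, for the weak derivatives of a
time-continuous function. The indicator function of the moving set is the limit of transported
Lipschitz cutoff functions. -/
theorem integral_comoving_sub (hJ : IsOpen J) (hΩ : IsOpen Ω) (h : IsShortField b M K α β)
    (hX : IsFlow b X) (hJI : Icc α β ⊆ J)
    (hbv : ∀ᵐ t ∂(volume.restrict (Icc α β)), ∀ x ∈ Ω, b (t, x) = v (t, x))
    (hψ : IntegrableOn ψ (J ×ˢ Ω)) (hψv : IntegrableOn (fun p => ψ p • v p) (J ×ˢ Ω))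
    (hψ' : IsTimeContinuousRep J Ω ψ ψ')
    (hg : HasWeakTimeDeriv (J ×ˢ Ω) ψ g) (hd : HasWeakSpaceDiv (J ×ˢ Ω) (fun p => ψ p • v p) d)
    {G : Set E3} (hG : IsCompact G) {ρ : ℝ} (hρ : 0 < ρ) (hρΩ : Metric.cthickening (2 * ρ) G ⊆ Ω)
    (hρM : M * (β - α) ≤ ρ) {t₁ : ℝ} (ht₁ : t₁ ∈ Icc α β)
    {s r : ℝ} (hαs : α ≤ s) (hsr : s ≤ r) (hrβ : r < β) :
    (∫ x in X t₁ r ⁻¹' G, ψ' (r, x)) - ∫ x in X t₁ s ⁻¹' G, ψ' (s, x) =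
      ∫ t in s..r, ∫ x in X t₁ t ⁻¹' G, (g (t, x) + d (t, x)) := by
  rcases G.eq_empty_or_nonempty with rfl | hne
  · simp
  have hρΩ' : Metric.cthickening ρ G ⊆ Ω :=
    (Metric.cthickening_mono (by linarith) G).trans hρΩ
  have hmeas : ∀ t, MeasurableSet (X t₁ t ⁻¹' G) := fun t =>
    (hG.isClosed.preimage (hX.lipschitzWith h t₁ t).continuous).measurableSet
  have hsub : ∀ t ∈ Icc α β, X t₁ t ⁻¹' G ⊆ Ω := fun t ht =>
    (preimage_subset_cthickening h hX hρM ht₁ ht).trans hρΩ'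
  have hε : ∀ n : ℕ, 0 < ρ / ((n : ℝ) + 1) := fun n => by positivity
  let f : ℕ → E3 → ℝ := fun n => cutoff G (ρ / (n + 1))
  have hfS : ∀ n, ∀ t ∈ Icc α β, ∀ x, x ∉ Metric.cthickening (2 * ρ) G → f n (X t₁ t x) = 0 := by
    intro n t ht x hx
    refine cutoff_eq_zero (hε n) ?_
    by_contra! hcon
    apply hx
    obtain ⟨y, hy, hxy⟩ := (Metric.infDist_lt_iff hne).1 hcon
    refine Metric.mem_cthickening_of_dist_le x y _ G hy ?_
    have h1 : dist x (X t₁ t x) ≤ ρ := by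
      rw [dist_comm, dist_eq_norm]
      refine (hX.norm_sub_le h t₁ t x).trans (le_trans ?_ hρM)
      refine mul_le_mul_of_nonneg_left ?_ h.bound_nonneg
      rw [abs_le]
      constructor <;> linarith [ht.1, ht.2, ht₁.1, ht₁.2]
    have h2 : ρ / ((n : ℝ) + 1) ≤ ρ := div_le_self hρ.le (by linarith [n.cast_nonneg (α := ℝ)])
    linarith [dist_triangle x (X t₁ t x) y]
  have hid := fun n => integral_transported_sub hJ hΩ h hX hJI hbv hψ hψv hψ' hg hd t₁
    (lipschitzWith_cutoff G (hε n)) (abs_cutoff_le (hε n)) hG.cthickening hρΩ (hfS n) hαs hsr hrβ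
  -- passage to the limit in the spatial integrals
  have hlim : ∀ t ∈ Icc α β, ∀ k : E3 → ℝ, IntegrableOn k Ω →
      Tendsto (fun n => ∫ x in Ω, k x * f n (X t₁ t x)) atTop (𝓝 (∫ x in X t₁ t ⁻¹' G, k x)) := by
    intro t ht k hk
    rw [show ∫ x in X t₁ t ⁻¹' G, k x = ∫ x in Ω, (X t₁ t ⁻¹' G).indicator k x by
      rw [setIntegral_indicator (hmeas t), inter_eq_self_of_subset_right (hsub t ht)]]
    refine tendsto_integral_of_dominated_convergence (fun x => ‖k x‖) (fun n => ?_) hk.norm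
      (fun n => ae_of_all _ fun x => ?_) (ae_of_all _ fun x => ?_)
    · exact hk.aestronglyMeasurable.mul ((lipschitzWith_cutoff G (hε n)).continuous.comp
        (hX.lipschitzWith h t₁ t).continuous).aestronglyMeasurable
    · rw [norm_mul]
      exact mul_le_of_le_one_right (norm_nonneg _) (abs_cutoff_le (hε n) _)
    · have e : (X t₁ t ⁻¹' G).indicator k x = k x * G.indicator (fun _ => 1) (X t₁ t x) := by
        by_cases hx : X t₁ t x ∈ G <;> simp [hx]
      rw [e]
      exact (tendsto_cutoff hG.isClosed hne hρ _).const_mul _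
  have hsI : Icc s r ⊆ Icc α β := Icc_subset_Icc hαs hrβ.le
  have hs : s ∈ Icc α β := hsI ⟨le_rfl, hsr⟩
  have hr : r ∈ Icc α β := hsI ⟨hsr, le_rfl⟩
  have hL := (hlim r hr _ (hψ'.integrable r (hJI hr))).sub
    (hlim s hs _ (hψ'.integrable s (hJI hs)))
  refine tendsto_nhds_unique (hL.congr hid) ?_
  -- passage to the limit in the time integral
  have hgd : Integrable (fun p => g p + d p) ((volume.restrict J).prod (volume.restrict Ω)) := by
    rw [← volume_restrict_prod]; exact hg.1.add hd.1
  have haeJ : ∀ᵐ t ∂(volume.restrict (uIoc s r)), t ∈ Icc α β ∧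
      IntegrableOn (fun x => g (t, x) + d (t, x)) Ω := by
    have h1 : uIoc s r ⊆ Icc α β := by
      rw [uIoc_of_le hsr]; exact Ioc_subset_Icc_self.trans hsI
    exact (ae_restrict_of_forall_mem measurableSet_uIoc fun t ht => h1 ht).and
      (ae_restrict_of_ae_restrict_of_subset (h1.trans hJI) hgd.prod_right_ae)
  refine intervalIntegral.tendsto_integral_filter_of_dominated_convergence
    (fun t => ∫ x in Ω, ‖g (t, x) + d (t, x)‖) (Eventually.of_forall fun n => ?_)
    (Eventually.of_forall fun n => ?_) ?_ ?_
  · have hu : Continuous fun p : ℝ × E3 => f n (X t₁ p.1 p.2) :=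
      (lipschitzWith_cutoff G (hε n)).continuous.comp (hX.lipschitzWith_uncurry h t₁).continuous
    have h1 : Integrable (fun p => (g p + d p) * f n (X t₁ p.1 p.2))
        ((volume.restrict J).prod (volume.restrict Ω)) :=
      hgd.mul_bdd (c := 1) hu.aestronglyMeasurable (ae_of_all _ fun p => abs_cutoff_le (hε n) _)
    refine (h1.integral_prod_left.aestronglyMeasurable).mono_measure
      (Measure.restrict_mono_set _ ?_)
    rw [uIoc_of_le hsr]; exact (Ioc_subset_Icc_self.trans hsI).trans hJI
  · rw [← ae_restrict_iff' measurableSet_uIoc]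
    filter_upwards [haeJ] with t ht
    refine norm_integral_le_of_norm_le ht.2.norm (ae_of_all _ fun x => ?_)
    rw [norm_mul]
    exact mul_le_of_le_one_right (norm_nonneg _) (abs_cutoff_le (hε n) _)
  · have h1 : IntegrableOn (fun t => ∫ x in Ω, ‖g (t, x) + d (t, x)‖) J :=
      hgd.norm.integral_prod_left
    rw [intervalIntegrable_iff_integrableOn_Ioc_of_le hsr]
    exact h1.mono_set ((Ioc_subset_Icc_self.trans hsI).trans hJI)
  · rw [← ae_restrict_iff' measurableSet_uIoc]
    filter_upwards [haeJ] with t ht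
    exact hlim t ht.1 _ ht.2

end

/-! ### The weak divergence of a Sobolev function times the velocity -/

section

variable {b : ℝ × E3 → E3} {M K : ℝ}

/-- The spatial derivative of a component of `b`, as the upper limit of difference quotients. This
form makes it measurable in space-time although `b` is only measurable in time. -/
noncomputable def componentDeriv (b : ℝ × E3 → E3) (i : Fin 3) (p : ℝ × E3) : ℝ :=
  limsup (fun n : ℕ => ((n : ℝ) + 1) *
    (b (p.1, p.2 + ((n : ℝ) + 1)⁻¹ • EuclideanSpace.single i 1) i - b p i)) atTop

theorem measurable_componentDeriv (hb : Measurable b) (i : Fin 3) :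
    Measurable (componentDeriv b i) := by
  have hi : Measurable fun p => b p i :=
    (EuclideanSpace.proj (𝕜 := ℝ) i).continuous.measurable.comp hb
  refine Measurable.limsup fun n => (measurable_const.mul ?_)
  refine Measurable.sub (hi.comp ?_) hi
  exact measurable_fst.prodMk (measurable_snd.add_const _)

theorem lipschitzWith_component (hK : 0 ≤ K)
    (hLip : ∀ t x y, ‖b (t, x) - b (t, y)‖ ≤ K * ‖x - y‖) (t : ℝ) (i : Fin 3) :
    LipschitzWith K.toNNReal fun x => b (t, x) i :=
  LipschitzWith.of_dist_le_mul fun x y => by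
    rw [Real.dist_eq, dist_eq_norm, Real.coe_toNNReal _ hK]
    exact (abs_apply_le_norm (b (t, x) - b (t, y)) i).trans (hLip t x y)

theorem abs_componentDeriv_le (hLip : ∀ t x y, ‖b (t, x) - b (t, y)‖ ≤ K * ‖x - y‖) (i : Fin 3)
    (p : ℝ × E3) : |componentDeriv b i p| ≤ K := by
  have hq : ∀ n : ℕ, |((n : ℝ) + 1) *
      (b (p.1, p.2 + ((n : ℝ) + 1)⁻¹ • EuclideanSpace.single i 1) i - b p i)| ≤ K := by
    intro n
    have hn : (0 : ℝ) < (n : ℝ) + 1 := by positivity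
    have h1 := (abs_apply_le_norm (b (p.1, p.2 + ((n : ℝ) + 1)⁻¹ • EuclideanSpace.single i 1) -
      b (p.1, p.2)) i).trans (hLip _ _ _)
    rw [add_sub_cancel_left, norm_smul, norm_inv, Real.norm_of_nonneg hn.le] at h1
    simp only [PiLp.norm_single, norm_one, mul_one] at h1
    rw [abs_mul, abs_of_pos hn]
    calc _ ≤ ((n : ℝ) + 1) * (K * ((n : ℝ) + 1)⁻¹) := mul_le_mul_of_nonneg_left h1 hn.le
      _ = K := by field_simp
  rw [abs_le]
  constructor
  · refine le_limsup_of_frequently_le (Frequently.of_forall fun n => (abs_le.1 (hq n)).1) ?_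
    exact isBoundedUnder_of ⟨K, fun n => (abs_le.1 (hq n)).2⟩
  · refine limsup_le_of_le ?_ (Eventually.of_forall fun n => (abs_le.1 (hq n)).2)
    exact IsBoundedUnder.isCoboundedUnder_le (isBoundedUnder_of ⟨-K, fun n => (abs_le.1 (hq n)).1⟩)

/-- By Rademacher's theorem the difference quotients converge, at every time, almost everywhere. -/
theorem ae_lineDeriv_eq_componentDeriv (hK : 0 ≤ K)
    (hLip : ∀ t x y, ‖b (t, x) - b (t, y)‖ ≤ K * ‖x - y‖) (t : ℝ) (i : Fin 3) :
    ∀ᵐ x : E3, lineDeriv ℝ (fun x => b (t, x) i) x (EuclideanSpace.single i 1) =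
      componentDeriv b i (t, x) := by
  filter_upwards [(lipschitzWith_component hK hLip t i).ae_differentiableAt] with x hx
  have h1 := (hx.lineDifferentiableAt (v := EuclideanSpace.single i 1)).hasLineDerivAt
  have h2 := h1.tendsto_slope_zero
  have h3 : Tendsto (fun n : ℕ => ((n : ℝ) + 1)⁻¹) atTop (𝓝[≠] 0) := by
    refine tendsto_nhdsWithin_iff.2 ⟨?_, Eventually.of_forall fun n => ?_⟩
    · simpa using tendsto_one_div_add_atTop_nhds_zero_nat (𝕜 := ℝ)
    · simp only [mem_compl_iff, mem_singleton_iff]; positivity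
  have h4 := (h2.comp h3).limsup_eq
  rw [← h4]
  simp [componentDeriv, Function.comp_def]

/-- A component of the velocity times a smooth function is an admissible test function. -/
theorem isBoundedWeakDeriv_component_mul (hb : Measurable b) (hM : ∀ p, ‖b p‖ ≤ M) (hK : 0 ≤ K)
    (hLip : ∀ t x y, ‖b (t, x) - b (t, y)‖ ≤ K * ‖x - y‖) (i : Fin 3) {φ : ℝ × E3 → ℝ}
    (hφ : ContDiff ℝ ∞ φ) (hφc : HasCompactSupport φ) :
    IsBoundedWeakDeriv (0, EuclideanSpace.single i 1) (fun p => b p i * φ p) fun p =>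
      componentDeriv b i p * φ p + b p i * fderiv ℝ φ p (0, EuclideanSpace.single i 1) := by
  set e : ℝ × E3 := (0, EuclideanSpace.single i 1) with he
  have hbi : Measurable fun p => b p i :=
    (EuclideanSpace.proj (𝕜 := ℝ) i).continuous.measurable.comp hb
  have hbM : ∀ p, |b p i| ≤ M := fun p => (abs_apply_le_norm _ i).trans (hM p)
  have hm := measurable_componentDeriv hb i
  have hmK := abs_componentDeriv_le hLip i
  have hderc : ∀ φ : ℝ × E3 → ℝ, ContDiff ℝ ∞ φ → Continuous fun p => fderiv ℝ φ p e :=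
    fun φ hφ => (hφ.continuous_fderiv (by simp)).clm_apply continuous_const
  have hdersupp : ∀ φ : ℝ × E3 → ℝ, HasCompactSupport φ →
      HasCompactSupport fun p => fderiv ℝ φ p e := fun φ h => h.fderiv_apply ℝ e
  refine ⟨?_, ?_, fun χ hχ hχc => ?_⟩
  · exact ((hm.mul hφ.continuous.measurable).add
      (hbi.mul (hderc φ hφ).measurable)).aestronglyMeasurable
  · obtain ⟨A, hA⟩ := hφc.exists_bound_of_continuous hφ.continuous
    obtain ⟨B, hB⟩ := (hdersupp φ hφc).exists_bound_of_continuous (hderc φ hφ)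
    refine ⟨K * A + M * B, fun p => (abs_add_le _ _).trans ?_⟩
    rw [abs_mul, abs_mul]
    exact add_le_add (mul_le_mul (hmK p) (hA p) (abs_nonneg _) hK)
      (mul_le_mul (hbM p) (hB p) (abs_nonneg _) ((norm_nonneg _).trans (hM p)))
  · have hI : ∀ (f : ℝ × E3 → ℝ) (C : ℝ), Measurable f → (∀ p, |f p| ≤ C) → ∀ k : ℝ × E3 → ℝ,
        Continuous k → HasCompactSupport k → Integrable fun p => f p * k p := by
      intro f C hf hC k hk hkc
      exact (hk.integrable_of_hasCompactSupport hkc).bdd_mul (c := C) hf.aestronglyMeasurable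
        (ae_of_all _ hC)
    have hi1 := hI _ _ hbi hbM (fun p => φ p * fderiv ℝ χ p e)
      (hφ.continuous.mul (hderc χ hχ)) (hφc.mul_right)
    have hi2 := hI _ _ hm hmK (fun p => φ p * χ p) (hφ.continuous.mul hχ.continuous) hφc.mul_right
    have hi3 := hI _ _ hbi hbM (fun p => fderiv ℝ φ p e * χ p)
      ((hderc φ hφ).mul hχ.continuous) hχc.mul_left
    have key : ∫ p, b p i * (φ p * fderiv ℝ χ p e) + b p i * (fderiv ℝ φ p e * χ p) +
        componentDeriv b i p * (φ p * χ p) = 0 := by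
      have hi := (hi1.add hi3).add hi2
      rw [Measure.volume_eq_prod] at hi ⊢
      refine (integral_prod _ hi).trans ?_
      refine integral_eq_zero_of_ae (ae_of_all _ fun t => ?_)
      set k : E3 → ℝ := fun x => φ (t, x) * χ (t, x) with hk
      have hkd : ContDiff ℝ 1 k := by
        have h1 : ContDiff ℝ ∞ fun x : E3 => ((t, x) : ℝ × E3) := contDiff_const.prodMk contDiff_id
        exact ((hφ.comp h1).mul (hχ.comp h1)).of_le (by simp)
      have hkc : HasCompactSupport k := by
        refine HasCompactSupport.intro (hφc.isCompact.image continuous_snd) fun x hx => ?_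
        have : φ (t, x) = 0 := by
          by_contra hne
          exact hx ⟨(t, x), subset_tsupport _ hne, rfl⟩
        simp [hk, this]
      obtain ⟨D, hD⟩ := hkd.lipschitzWith_of_hasCompactSupport hkc one_ne_zero
      have h1 := (lipschitzWith_component hK hLip t i).integral_lineDeriv_mul_eq (μ := volume)
        hD hkc (EuclideanSpace.single i 1)
      have h2 : ∀ x, lineDeriv ℝ k x (-EuclideanSpace.single i 1) =
          -(φ (t, x) * fderiv ℝ χ (t, x) e + fderiv ℝ φ (t, x) e * χ (t, x)) := by
        intro x
        have hs : ∀ φ : ℝ × E3 → ℝ, ContDiff ℝ ∞ φ → HasFDerivAt (fun x => φ (t, x))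
            ((fderiv ℝ φ (t, x)).comp (ContinuousLinearMap.inr ℝ ℝ E3)) x := fun φ hφ =>
          (hφ.differentiable (by simp) (t, x)).hasFDerivAt.comp x (hasFDerivAt_prodMk_right t x)
        have hk' : HasFDerivAt k _ x := (hs φ hφ).mul (hs χ hχ)
        rw [(hkd.differentiable one_ne_zero x).lineDeriv_eq_fderiv, map_neg, hk'.fderiv]
        simp [he]
        ring
      have hmi : Integrable fun x => componentDeriv b i (t, x) * k x :=
        (hkd.continuous.integrable_of_hasCompactSupport hkc).bdd_mul (c := K)
          (hm.comp (measurable_const.prodMk measurable_id)).aestronglyMeasurable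
          (ae_of_all _ fun x => hmK _)
      have hcb : Continuous fun x : E3 => b (t, x) i :=
        (lipschitzWith_component hK hLip t i).continuous
      have hbk : Integrable fun x => lineDeriv ℝ k x (-EuclideanSpace.single i 1) * b (t, x) i := by
        simp only [(hkd.differentiable one_ne_zero _).lineDeriv_eq_fderiv]
        exact (((hkd.continuous_fderiv one_ne_zero).clm_apply continuous_const).mul
          hcb).integrable_of_hasCompactSupport (hkc.fderiv_apply ℝ _).mul_right
      have h3 : ∫ x, componentDeriv b i (t, x) * k x =
          ∫ x, lineDeriv ℝ (fun x => b (t, x) i) x (EuclideanSpace.single i 1) * k x := by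
        refine integral_congr_ae ?_
        filter_upwards [ae_lineDeriv_eq_componentDeriv hK hLip t i] with x hx
        rw [hx]
      calc _ = ∫ x, (componentDeriv b i (t, x) * k x -
            lineDeriv ℝ k x (-EuclideanSpace.single i 1) * b (t, x) i) := by
            refine integral_congr_ae (ae_of_all _ fun x => ?_)
            simp only [Pi.add_apply]
            rw [h2]
            simp only [hk]
            ring
        _ = 0 := by rw [integral_sub hmi hbk, h3, h1, sub_self]
    rw [← integral_neg]
    rw [← sub_eq_zero, ← integral_sub ?_ ?_]
    · rw [← key]
      refine integral_congr_ae (ae_of_all _ fun p => ?_)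
      simp only
      ring
    · refine hi1.congr (ae_of_all _ fun p => ?_)
      simp only
      ring
    · refine (hi2.add hi3).neg.congr (ae_of_all _ fun p => ?_)
      simp only [Pi.neg_apply, Pi.add_apply]
      ring

theorem exists_hasWeakSpaceDiv {U : Set (ℝ × E3)} (hU : IsOpen U) (hb : Measurable b)
    (hM : ∀ p, ‖b p‖ ≤ M) (hK : 0 ≤ K)
    (hLip : ∀ t x y, ‖b (t, x) - b (t, y)‖ ≤ K * ‖x - y‖) {ψ : ℝ × E3 → ℝ} (hψ : MemW11 U ψ) :
    ∃ d, HasWeakSpaceDiv U (fun p => ψ p • b p) d := by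
  choose g hg using hψ.space
  have hbi : ∀ i, Measurable fun p => b p i := fun i =>
    (EuclideanSpace.proj (𝕜 := ℝ) i).continuous.measurable.comp hb
  have hbM : ∀ i p, |b p i| ≤ M := fun i p => (abs_apply_le_norm _ i).trans (hM p)
  have hi1 : ∀ i, IntegrableOn (fun p => g i p * b p i) U := fun i =>
    (hg i).1.mul_bdd (c := M) (hbi i).aestronglyMeasurable (ae_of_all _ (hbM i))
  have hi2 : ∀ i, IntegrableOn (fun p => ψ p * componentDeriv b i p) U := fun i =>
    hψ.integrable.mul_bdd (c := K) (measurable_componentDeriv hb i).aestronglyMeasurable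
      (ae_of_all _ (abs_componentDeriv_le hLip i))
  refine ⟨fun p => ∑ i, (g i p * b p i + ψ p * componentDeriv b i p),
    integrable_finsetSum _ fun i _ => (hi1 i).add (hi2 i), fun φ hφ => ?_⟩
  obtain ⟨A, hA⟩ := hφ.compact.exists_bound_of_continuous hφ.smooth.continuous
  have hφm : AEStronglyMeasurable φ (volume.restrict U) :=
    hφ.smooth.continuous.aestronglyMeasurable
  have hdc : ∀ i, Continuous fun p => fderiv ℝ φ p (0, EuclideanSpace.single i 1) := fun i =>
    (hφ.smooth.continuous_fderiv (by simp)).clm_apply continuous_const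
  have hi3 : ∀ i, IntegrableOn (fun p => ψ p * componentDeriv b i p * φ p) U := fun i =>
    (hi2 i).mul_bdd (c := A) hφm (ae_of_all _ hA)
  have hi4 : ∀ i, IntegrableOn (fun p => g i p * b p i * φ p) U := fun i =>
    (hi1 i).mul_bdd (c := A) hφm (ae_of_all _ hA)
  have hi5 : ∀ i, IntegrableOn
      (fun p => ψ p * b p i * fderiv ℝ φ p (0, EuclideanSpace.single i 1)) U := by
    intro i
    obtain ⟨B, hB⟩ :=
      (hφ.compact.fderiv_apply ℝ (0, EuclideanSpace.single i 1)).exists_bound_of_continuous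
      (hdc i)
    have h1 : IntegrableOn (fun p => ψ p * b p i) U :=
      hψ.integrable.mul_bdd (c := M) (hbi i).aestronglyMeasurable (ae_of_all _ (hbM i))
    exact h1.mul_bdd (c := B) (hdc i).aestronglyMeasurable (ae_of_all _ hB)
  have key : ∀ i, ∫ p in U, ψ p * b p i * fderiv ℝ φ p (0, EuclideanSpace.single i 1) =
      - ∫ p in U, (g i p * b p i + ψ p * componentDeriv b i p) * φ p := by
    intro i
    have htest : IsBoundedTest U fun p => b p i * φ p := by
      refine ⟨((hbi i).mul hφ.smooth.continuous.measurable).aestronglyMeasurable,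
        ⟨M * A, fun p => ?_⟩, hφ.compact.mul_left, ?_⟩
      · rw [abs_mul]
        exact mul_le_mul (hbM i p) (hA p) (abs_nonneg _) ((norm_nonneg _).trans (hM p))
      · exact (closure_mono (Function.support_mul_subset_right _ _)).trans hφ.support
    have h1 := HasWeakDeriv.integral_mul_eq hU hψ.integrable (hg i) htest
      (isBoundedWeakDeriv_component_mul hb hM hK hLip i hφ.smooth hφ.compact)
    have h2 : ∫ p in U, ψ p * (componentDeriv b i p * φ p +
        b p i * fderiv ℝ φ p (0, EuclideanSpace.single i 1)) =
        (∫ p in U, ψ p * componentDeriv b i p * φ p) +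
          ∫ p in U, ψ p * b p i * fderiv ℝ φ p (0, EuclideanSpace.single i 1) := by
      rw [← integral_add (hi3 i) (hi5 i)]
      exact integral_congr_ae (ae_of_all _ fun p => by ring)
    have h3 : ∫ p in U, (g i p * b p i + ψ p * componentDeriv b i p) * φ p =
        (∫ p in U, g i p * b p i * φ p) + ∫ p in U, ψ p * componentDeriv b i p * φ p := by
      rw [← integral_add (hi4 i) (hi3 i)]
      exact integral_congr_ae (ae_of_all _ fun p => by ring)
    have h4 : ∫ p in U, g i p * (b p i * φ p) = ∫ p in U, g i p * b p i * φ p :=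
      integral_congr_ae (ae_of_all _ fun p => by ring)
    rw [h2, h4] at h1
    rw [h3]
    linarith
  have e1 : ∀ p, fderiv ℝ φ p (0, ψ p • b p) =
      ∑ i, ψ p * b p i * fderiv ℝ φ p (0, EuclideanSpace.single i 1) := fun p => by
    rw [clm_apply_eq_sum]
    simp
  simp only [e1, Finset.sum_mul]
  rw [integral_finsetSum _ fun i _ => hi5 i, integral_finsetSum _ fun i _ => ?_,
    ← Finset.sum_neg_distrib]
  · exact Finset.sum_congr rfl fun i _ => key i
  · refine ((hi4 i).add (hi3 i)).congr (ae_of_all _ fun p => ?_)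
    simp only [Pi.add_apply]
    ring

theorem HasWeakSpaceDiv.congr_ae {U : Set (ℝ × E3)} {W W' : ℝ × E3 → E3} {d : ℝ × E3 → ℝ}
    (h : HasWeakSpaceDiv U W d) (hW : W =ᵐ[volume.restrict U] W') : HasWeakSpaceDiv U W' d := by
  refine ⟨h.1, fun φ hφ => ?_⟩
  rw [← h.2 φ hφ]
  refine integral_congr_ae ?_
  filter_upwards [hW] with p hp
  rw [hp]

end

/-! ### The time-continuous representative -/

theorem IsCompact.exists_Icc_superset {C J : Set ℝ} (hC : IsCompact C) (hne : C.Nonempty)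
    (hJ : J.OrdConnected) (hCJ : C ⊆ J) : ∃ a c, C ⊆ Icc a c ∧ Icc a c ⊆ J :=
  ⟨sInf C, sSup C, subset_Icc_csInf_csSup hC.bddBelow hC.bddAbove,
    hJ.out (hCJ (hC.sInf_mem hne)) (hCJ (hC.sSup_mem hne))⟩

/-- The integral over the past of a function of time and space. -/
noncomputable def pastIntegral (φ : ℝ × E3 → ℝ) (p : ℝ × E3) : ℝ := ∫ s in Iic p.1, φ (s, p.2)

/-- A primitive in time of `φ`, made compactly supported by subtracting the total integral
multiplied by a transition function `Θ` from `0` to `1`. -/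
noncomputable def balancedPrimitive (Θ : ℝ → ℝ) (φ : ℝ × E3 → ℝ) (p : ℝ × E3) : ℝ :=
  pastIntegral φ p - Θ p.1 * ∫ s, φ (s, p.2)

section

variable {φ : ℝ × E3 → ℝ} {a c : ℝ} {S : Set E3}

theorem integrable_time_slice (hφ : Continuous φ) (hac : ∀ p, φ p ≠ 0 → p.1 ∈ Icc a c) (x : E3) :
    Integrable fun s => φ (s, x) := by
  have h1 : IntegrableOn (fun s => φ (s, x)) (Icc a c) :=
    (hφ.comp (by fun_prop : Continuous fun s : ℝ => (s, x))).integrableOn_Icc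
  exact h1.integrable_of_forall_notMem_eq_zero fun s hs => by
    by_contra hne; exact hs (hac (s, x) hne)

theorem abs_setIntegral_sub_le {D : ℝ≥0} (hφ : LipschitzWith D φ)
    (hac : ∀ p, φ p ≠ 0 → p.1 ∈ Icc a c) (T : Set ℝ) (x y : E3) :
    |(∫ s in T, φ (s, x)) - ∫ s in T, φ (s, y)| ≤ D * |c - a| * dist x y := by
  have hix := integrable_time_slice hφ.continuous hac x
  have hiy := integrable_time_slice hφ.continuous hac y
  have hz : ∀ s, s ∉ Icc a c → φ (s, x) - φ (s, y) = 0 := by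
    intro s hs
    have h0 : ∀ z, φ (s, z) = 0 := fun z => by
      by_contra hne; exact hs (hac (s, z) hne)
    rw [h0, h0, sub_zero]
  rw [← integral_sub hix.integrableOn hiy.integrableOn]
  calc _ ≤ ∫ s in T, ‖φ (s, x) - φ (s, y)‖ := norm_integral_le_integral_norm _
    _ ≤ ∫ s, ‖φ (s, x) - φ (s, y)‖ :=
        setIntegral_le_integral (hix.sub hiy).norm (ae_of_all _ fun s => norm_nonneg _)
    _ = ∫ s in Icc a c, ‖φ (s, x) - φ (s, y)‖ :=
        (setIntegral_eq_integral_of_forall_compl_eq_zero fun s hs => by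
          rw [hz s hs, norm_zero]).symm
    _ ≤ ‖∫ s in Icc a c, ‖φ (s, x) - φ (s, y)‖‖ := le_abs_self _
    _ ≤ (D * dist x y) * volume.real (Icc a c) := by
        refine norm_setIntegral_le_of_norm_le_const (by simp) fun s _ => ?_
        rw [norm_norm, ← dist_eq_norm]
        simpa using hφ.dist_le_mul (s, x) (s, y)
    _ ≤ _ := by
        rw [Real.volume_real_Icc, mul_right_comm]
        refine mul_le_mul_of_nonneg_right (mul_le_mul_of_nonneg_left ?_ D.2) dist_nonneg
        exact max_le (le_abs_self _) (abs_nonneg _)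

theorem pastIntegral_sub (hφ : Continuous φ) (hac : ∀ p, φ p ≠ 0 → p.1 ∈ Icc a c) (t r : ℝ)
    (x : E3) : pastIntegral φ (t, x) - pastIntegral φ (r, x) = ∫ s in r..t, φ (s, x) :=
  intervalIntegral.integral_Iic_sub_Iic (integrable_time_slice hφ hac x).integrableOn
    (integrable_time_slice hφ hac x).integrableOn

theorem hasDerivAt_pastIntegral (hφ : Continuous φ) (hac : ∀ p, φ p ≠ 0 → p.1 ∈ Icc a c) (t : ℝ)
    (x : E3) : HasDerivAt (fun s => pastIntegral φ (s, x)) (φ (t, x)) t := by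
  have hc : Continuous fun s : ℝ => φ (s, x) := hφ.comp (by fun_prop)
  have h1 : (fun s => pastIntegral φ (s, x)) =
      fun s => pastIntegral φ (0, x) + ∫ r in (0 : ℝ)..s, φ (r, x) := by
    funext s
    rw [← pastIntegral_sub hφ hac]
    ring
  rw [h1]
  exact (hc.integral_hasStrictDerivAt 0 t).hasDerivAt.const_add _

theorem lipschitzWith_pastIntegral {D : ℝ≥0} (hφ : LipschitzWith D φ) {B : ℝ≥0}
    (hB : ∀ p, |φ p| ≤ B) (hac : ∀ p, φ p ≠ 0 → p.1 ∈ Icc a c) :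
    LipschitzWith (B + D * Real.toNNReal |c - a|) (pastIntegral φ) := by
  refine LipschitzWith.of_dist_le_mul ?_
  rintro ⟨t, x⟩ ⟨r, y⟩
  have h1 : dist (pastIntegral φ (t, x)) (pastIntegral φ (r, x)) ≤ B * |t - r| := by
    rw [Real.dist_eq, pastIntegral_sub hφ.continuous hac]
    exact intervalIntegral.norm_integral_le_of_norm_le_const (f := fun s => φ (s, x))
      fun s _ => hB (s, x)
  have h2 : dist (pastIntegral φ (r, x)) (pastIntegral φ (r, y)) ≤ D * |c - a| * dist x y := by
    rw [Real.dist_eq]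
    exact abs_setIntegral_sub_le hφ hac _ x y
  have h3 : |t - r| ≤ dist (t, x) (r, y) := le_max_left _ _
  have h4 : dist x y ≤ dist (t, x) (r, y) := le_max_right _ _
  refine (dist_triangle _ _ _).trans ((add_le_add h1 h2).trans ?_)
  push_cast
  rw [Real.coe_toNNReal _ (abs_nonneg _), add_mul]
  exact add_le_add (mul_le_mul_of_nonneg_left h3 B.2)
    (mul_le_mul_of_nonneg_left h4 (by positivity))

theorem abs_integral_time_slice_le {B : ℝ≥0} (hB : ∀ p, |φ p| ≤ B)
    (hac : ∀ p, φ p ≠ 0 → p.1 ∈ Icc a c) (x : E3) :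
    |∫ s, φ (s, x)| ≤ B * |c - a| := by
  rw [← setIntegral_eq_integral_of_forall_compl_eq_zero (s := Icc a c) fun s hs => by
    by_contra hne; exact hs (hac (s, x) hne)]
  refine (norm_setIntegral_le_of_norm_le_const (f := fun s => φ (s, x)) (C := B) (by simp)
    fun s _ => hB (s, x)).trans ?_
  rw [Real.volume_real_Icc]
  exact mul_le_mul_of_nonneg_left (max_le (le_abs_self _) (abs_nonneg _)) B.2

theorem exists_lipschitzWith_balancedPrimitive {D E : ℝ≥0} {Θ : ℝ → ℝ} (hφ : LipschitzWith D φ)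
    (hφc : HasCompactSupport φ) (hac : ∀ p, φ p ≠ 0 → p.1 ∈ Icc a c)
    (hΘ : LipschitzWith E Θ) (hΘ1 : ∀ t, |Θ t| ≤ 1) :
    ∃ C, LipschitzWith C (balancedPrimitive Θ φ) := by
  obtain ⟨B, hB⟩ : ∃ B : ℝ≥0, ∀ p, |φ p| ≤ B := by
    obtain ⟨B, hB⟩ := hφc.exists_bound_of_continuous hφ.continuous
    exact ⟨⟨B, (norm_nonneg _).trans (hB 0)⟩, hB⟩
  have h1 : LipschitzWith (D * Real.toNNReal |c - a|) fun p : ℝ × E3 => ∫ s, φ (s, p.2) := by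
    refine LipschitzWith.of_dist_le_mul fun p q => ?_
    have := abs_setIntegral_sub_le hφ hac univ p.2 q.2
    rw [setIntegral_univ, setIntegral_univ] at this
    rw [Real.dist_eq]
    refine this.trans ?_
    push_cast
    rw [Real.coe_toNNReal _ (abs_nonneg _)]
    exact mul_le_mul_of_nonneg_left (le_max_right _ _) (by positivity)
  have h2 := (hΘ.comp LipschitzWith.prod_fst).mul_of_bounded h1 (A := 1)
    (B := B * Real.toNNReal |c - a|) (fun p => by simpa using hΘ1 p.1) (fun p => by
      push_cast
      rw [Real.coe_toNNReal _ (abs_nonneg _)]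
      exact abs_integral_time_slice_le hB hac p.2)
  exact ⟨_, (lipschitzWith_pastIntegral hφ hB hac).sub h2⟩

theorem support_balancedPrimitive_subset {Θ : ℝ → ℝ}
    (hacS : ∀ p, φ p ≠ 0 → p ∈ Icc a c ×ˢ S) (hΘ0 : ∀ t < a, Θ t = 0) (hΘ1 : ∀ t > c, Θ t = 1) :
    Function.support (balancedPrimitive Θ φ) ⊆ Icc a c ×ˢ S := by
  rintro ⟨t, x⟩ hp
  by_contra hcon
  apply hp
  have h0 : ∀ s, (s, x) ∉ Icc a c ×ˢ S → φ (s, x) = 0 := fun s hs => by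
    by_contra hne; exact hs (hacS _ hne)
  simp only [balancedPrimitive, pastIntegral]
  by_cases hx : x ∈ S
  · have ht : t ∉ Icc a c := fun ht => hcon ⟨ht, hx⟩
    rw [mem_Icc, not_and_or, not_le, not_le] at ht
    rcases ht with ht | ht
    · rw [hΘ0 t ht, zero_mul, sub_zero]
      exact setIntegral_eq_zero_of_forall_eq_zero fun s hs => h0 s fun h => by
        have := h.1.1; simp only [mem_Iic] at hs; linarith
    · rw [hΘ1 t ht, one_mul, setIntegral_eq_integral_of_forall_compl_eq_zero, sub_self]
      intro s hs
      refine h0 s fun h => ?_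
      have := h.1.2
      simp only [mem_Iic, not_le] at hs
      linarith
  · have h1 : ∀ s, φ (s, x) = 0 := fun s => h0 s fun h => hx h.2
    simp [h1]

end

/-- The representative that is continuous in time. With `Θ' = θ`, both terms come from testing the
weak time derivative with balanced primitives of test functions. -/
noncomputable def timeContinuousRep (θ Θ : ℝ → ℝ) (ψ g : ℝ × E3 → ℝ) (p : ℝ × E3) : ℝ :=
  ∫ t, (ψ (t, p.2) * θ t + g (t, p.2) * (Θ t - (Ici p.1).indicator (fun _ => 1) t))

section

variable {ψ g : ℝ × E3 → ℝ} {θ Θ : ℝ → ℝ} {A : ℝ}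

theorem abs_sub_indicator_le (hΘ1 : ∀ t, 0 ≤ Θ t ∧ Θ t ≤ 1) (s t : ℝ) :
    |Θ t - (Ici s).indicator (fun _ => (1 : ℝ)) t| ≤ 1 := by
  by_cases h : t ∈ Ici s
  · rw [indicator_of_mem h, abs_le]; constructor <;> linarith [(hΘ1 t).1, (hΘ1 t).2]
  · rw [indicator_of_notMem h, abs_le]; constructor <;> linarith [(hΘ1 t).1, (hΘ1 t).2]

theorem norm_repKernel_le (hθA : ∀ t, |θ t| ≤ A) (hΘ1 : ∀ t, 0 ≤ Θ t ∧ Θ t ≤ 1) (s : ℝ)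
    (p : ℝ × E3) : ‖ψ p * θ p.1 + g p * (Θ p.1 - (Ici s).indicator (fun _ => 1) p.1)‖ ≤
      A * ‖ψ p‖ + ‖g p‖ := by
  refine (norm_add_le _ _).trans ?_
  rw [norm_mul, norm_mul, mul_comm A]
  exact add_le_add (mul_le_mul_of_nonneg_left (hθA _) (norm_nonneg _))
    (mul_le_of_le_one_right (norm_nonneg _) (abs_sub_indicator_le hΘ1 s p.1))

theorem measurable_repKernel (hψm : Measurable ψ) (hgm : Measurable g) (hθ : Continuous θ)
    (hΘ : Continuous Θ) : Measurable fun q : ℝ × (ℝ × E3) =>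
      ψ q.2 * θ q.2.1 + g q.2 * (Θ q.2.1 - (Ici q.1).indicator (fun _ => 1) q.2.1) := by
  have h1 : Measurable fun q : ℝ × (ℝ × E3) => (Ici q.1).indicator (fun _ => (1 : ℝ)) q.2.1 := by
    have : (fun q : ℝ × (ℝ × E3) => (Ici q.1).indicator (fun _ => (1 : ℝ)) q.2.1) =
        {q : ℝ × (ℝ × E3) | q.1 ≤ q.2.1}.indicator fun _ => 1 := by
      funext q; simp [indicator]
    rw [this]
    exact measurable_const.indicator (measurableSet_le measurable_fst measurable_snd.fst)
  exact ((hψm.comp measurable_snd).mul (hθ.measurable.comp measurable_snd.fst)).add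
    ((hgm.comp measurable_snd).mul ((hΘ.measurable.comp measurable_snd.fst).sub h1))

theorem integrable_repKernel (hψ : Integrable ψ) (hg : Integrable g) (hψm : Measurable ψ)
    (hgm : Measurable g) (hθ : Continuous θ) (hΘ : Continuous Θ) (hθA : ∀ t, |θ t| ≤ A)
    (hΘ1 : ∀ t, 0 ≤ Θ t ∧ Θ t ≤ 1) (s : ℝ) : Integrable fun p : ℝ × E3 =>
      ψ p * θ p.1 + g p * (Θ p.1 - (Ici s).indicator (fun _ => 1) p.1) :=
  ((hψ.norm.const_mul A).add hg.norm).mono'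
    (((measurable_repKernel hψm hgm hθ hΘ).comp
      (measurable_const.prodMk measurable_id)).aestronglyMeasurable)
    (ae_of_all _ fun p => norm_repKernel_le hθA hΘ1 s p)

theorem measurable_timeContinuousRep (hψm : Measurable ψ) (hgm : Measurable g) (hθ : Continuous θ)
    (hΘ : Continuous Θ) : Measurable (timeContinuousRep θ Θ ψ g) := by
  have h1 := (measurable_repKernel hψm hgm hθ hΘ).comp
    (show Measurable fun q : (ℝ × E3) × ℝ => (q.1.1, (q.2, q.1.2)) by fun_prop)
  exact h1.stronglyMeasurable.integral_prod_right'.measurable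

theorem ae_abs_timeContinuousRep_le (hψ : Integrable ψ) (hg : Integrable g)
    (hθA : ∀ t, |θ t| ≤ A) (hΘ1 : ∀ t, 0 ≤ Θ t ∧ Θ t ≤ 1) :
    ∀ᵐ x : E3, ∀ s, |timeContinuousRep θ Θ ψ g (s, x)| ≤ ∫ t, (A * ‖ψ (t, x)‖ + ‖g (t, x)‖) := by
  have hH : Integrable fun p => A * ‖ψ p‖ + ‖g p‖ := (hψ.norm.const_mul A).add hg.norm
  rw [Measure.volume_eq_prod] at hH
  filter_upwards [hH.prod_left_ae] with x hx s
  exact norm_integral_le_of_norm_le hx (ae_of_all _ fun t => norm_repKernel_le hθA hΘ1 s (t, x))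

theorem integrable_indicator_mul_snd {a c : ℝ} {H : E3 → ℝ} (hH : Integrable H) :
    Integrable fun p : ℝ × E3 => (Icc a c).indicator (fun _ => (1 : ℝ)) p.1 * H p.2 := by
  rw [Measure.volume_eq_prod]
  refine Integrable.mul_prod ?_ hH
  exact (integrableOn_const (by simp)).integrable_indicator measurableSet_Icc

theorem integrable_mul_timeContinuousRep (hψ : Integrable ψ) (hg : Integrable g)
    (hψm : Measurable ψ) (hgm : Measurable g) (hθ : Continuous θ) (hΘ : Continuous Θ)
    (hθA : ∀ t, |θ t| ≤ A) (hΘ1 : ∀ t, 0 ≤ Θ t ∧ Θ t ≤ 1) {φ : ℝ × E3 → ℝ} (hφ : Measurable φ)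
    {B a c : ℝ} (hB : ∀ p, |φ p| ≤ B) (hac : ∀ p, φ p ≠ 0 → p.1 ∈ Icc a c) :
    Integrable fun p => φ p * timeContinuousRep θ Θ ψ g p := by
  have hH : Integrable fun p => A * ‖ψ p‖ + ‖g p‖ := (hψ.norm.const_mul A).add hg.norm
  rw [Measure.volume_eq_prod] at hH
  refine ((integrable_indicator_mul_snd (a := a) (c := c) hH.integral_prod_right).const_mul B).mono'
    (hφ.mul (measurable_timeContinuousRep hψm hgm hθ hΘ)).aestronglyMeasurable ?_
  have h2 : ∀ᵐ p : ℝ × E3, ∀ s, |timeContinuousRep θ Θ ψ g (s, p.2)| ≤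
      ∫ t, (A * ‖ψ (t, p.2)‖ + ‖g (t, p.2)‖) :=
    Measure.quasiMeasurePreserving_snd.ae (ae_abs_timeContinuousRep_le hψ hg hθA hΘ1)
  filter_upwards [h2] with p hp
  have h3 := hp p.1
  have hB0 : 0 ≤ B := (abs_nonneg _).trans (hB p)
  by_cases hne : φ p = 0
  · rw [hne, zero_mul, norm_zero]
    refine mul_nonneg hB0 (mul_nonneg (indicator_nonneg (fun _ _ => zero_le_one) _) ?_)
    exact (abs_nonneg _).trans h3
  · rw [indicator_of_mem (hac p hne), one_mul, norm_mul]
    exact mul_le_mul (hB p) h3 (norm_nonneg _) hB0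

/-- Fubini's theorem moves the kernel of the representative to the test function. -/
theorem integral_mul_timeContinuousRep (hψ : Integrable ψ) (hg : Integrable g)
    (hψm : Measurable ψ) (hgm : Measurable g) (hθ : Continuous θ) (hΘ : Continuous Θ)
    (hθA : ∀ t, |θ t| ≤ A) (hΘ1 : ∀ t, 0 ≤ Θ t ∧ Θ t ≤ 1) {φ : ℝ × E3 → ℝ} (hφ : Continuous φ)
    {B a c : ℝ} (hB : ∀ p, |φ p| ≤ B) (hac : ∀ p, φ p ≠ 0 → p.1 ∈ Icc a c) :
    ∫ p, φ p * timeContinuousRep θ Θ ψ g p =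
      ∫ p : ℝ × E3, (ψ p * (θ p.1 * ∫ s, φ (s, p.2)) - g p * balancedPrimitive Θ φ p) := by
  have hH : Integrable fun p => A * ‖ψ p‖ + ‖g p‖ := (hψ.norm.const_mul A).add hg.norm
  have hB0 : 0 ≤ B := (abs_nonneg _).trans (hB 0)
  have hφ2 : Measurable fun q : ℝ × (ℝ × E3) => φ (q.1, q.2.2) :=
    hφ.measurable.comp (by fun_prop)
  -- the joint integrand in `(s, (t, x))`
  have hQ : Integrable (fun q : ℝ × (ℝ × E3) => φ (q.1, q.2.2) *
      (ψ q.2 * θ q.2.1 + g q.2 * (Θ q.2.1 - (Ici q.1).indicator (fun _ => 1) q.2.1)))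
      ((volume : Measure ℝ).prod (volume : Measure (ℝ × E3))) := by
    have hd : Integrable (fun q : ℝ × (ℝ × E3) => (Icc a c).indicator (fun _ => B) q.1 *
        (A * ‖ψ q.2‖ + ‖g q.2‖)) ((volume : Measure ℝ).prod (volume : Measure (ℝ × E3))) := by
      refine Integrable.mul_prod ?_ hH
      exact (integrableOn_const (by simp)).integrable_indicator measurableSet_Icc
    refine hd.mono' (hφ2.mul (measurable_repKernel hψm hgm hθ hΘ)).aestronglyMeasurable
      (ae_of_all _ fun q => ?_)
    rw [norm_mul]
    refine mul_le_mul ?_ (norm_repKernel_le hθA hΘ1 q.1 q.2) (norm_nonneg _)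
      (indicator_nonneg (fun _ _ => hB0) _)
    by_cases hne : φ (q.1, q.2.2) = 0
    · rw [hne, norm_zero]; exact indicator_nonneg (fun _ _ => hB0) _
    · rw [indicator_of_mem (hac _ hne)]; exact hB _
  have hleft : ∫ q, φ (q.1, q.2.2) *
      (ψ q.2 * θ q.2.1 + g q.2 * (Θ q.2.1 - (Ici q.1).indicator (fun _ => 1) q.2.1))
      ∂((volume : Measure ℝ).prod (volume : Measure (ℝ × E3))) =
      ∫ p, φ p * timeContinuousRep θ Θ ψ g p := by
    have h1 := integrable_mul_timeContinuousRep hψ hg hψm hgm hθ hΘ hθA hΘ1 hφ.measurable hB hac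
    rw [integral_prod _ hQ]
    rw [Measure.volume_eq_prod] at h1 ⊢
    rw [integral_prod _ h1]
    refine integral_congr_ae ?_
    filter_upwards [hQ.prod_right_ae] with s hs
    rw [Measure.volume_eq_prod] at hs
    rw [integral_prod_symm _ hs]
    refine integral_congr_ae (ae_of_all _ fun x => ?_)
    simp only [timeContinuousRep, integral_const_mul]
  rw [← hleft, integral_prod_symm _ hQ]
  refine integral_congr_ae (ae_of_all _ fun p => ?_)
  have hi := integrable_time_slice hφ hac p.2
  have e1 : ∀ s, φ (s, p.2) * (ψ p * θ p.1 + g p * (Θ p.1 - (Ici s).indicator (fun _ => 1) p.1)) =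
      (ψ p * θ p.1 + g p * Θ p.1) * φ (s, p.2) -
        g p * (Iic p.1).indicator (fun s => φ (s, p.2)) s := by
    intro s
    by_cases h : s ≤ p.1 <;> simp [h] <;> ring
  simp only [e1]
  rw [integral_sub (hi.const_mul _) ((hi.indicator measurableSet_Iic).const_mul _),
    integral_const_mul, integral_const_mul, integral_indicator measurableSet_Iic]
  simp only [balancedPrimitive, pastIntegral]
  ring

end

section

variable {ψ g : ℝ × E3 → ℝ} {θ Θ : ℝ → ℝ} {A : ℝ}

theorem locallyIntegrable_timeContinuousRep (hψ : Integrable ψ) (hg : Integrable g)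
    (hψm : Measurable ψ) (hgm : Measurable g) (hθ : Continuous θ) (hΘ : Continuous Θ)
    (hθA : ∀ t, |θ t| ≤ A) (hΘ1 : ∀ t, 0 ≤ Θ t ∧ Θ t ≤ 1) :
    LocallyIntegrable (timeContinuousRep θ Θ ψ g) := by
  intro p
  have h1 := integrable_mul_timeContinuousRep hψ hg hψm hgm hθ hΘ hθA hΘ1
    (φ := fun q : ℝ × E3 => (Icc (p.1 - 1) (p.1 + 1)).indicator (fun _ => (1 : ℝ)) q.1) (B := 1)
    (a := p.1 - 1) (c := p.1 + 1)
    ((measurable_const.indicator measurableSet_Icc).comp measurable_fst)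
    (fun q => by by_cases h : q.1 ∈ Icc (p.1 - 1) (p.1 + 1) <;> simp [h])
    (fun q hq => by by_contra h; exact hq (indicator_of_notMem h _))
  refine ⟨Icc (p.1 - 1) (p.1 + 1) ×ˢ univ, ?_, ?_⟩
  · have hm : Icc (p.1 - 1) (p.1 + 1) ∈ 𝓝 p.1 := Icc_mem_nhds (by linarith) (by linarith)
    have := prod_mem_nhds hm (univ_mem (f := 𝓝 p.2))
    simpa using this
  · refine h1.integrableOn.congr_fun (fun q hq => ?_) (measurableSet_Icc.prod MeasurableSet.univ)
    simp only
    rw [indicator_of_mem hq.1, one_mul]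

/-- The representative depends continuously on time in `L¹`, because its increments are integrals
of `g` over short time intervals. -/
theorem tendsto_integral_abs_timeContinuousRep_sub (hψ : Integrable ψ) (hg : Integrable g)
    (hψm : Measurable ψ) (hgm : Measurable g) (hθ : Continuous θ) (hΘ : Continuous Θ)
    (hθA : ∀ t, |θ t| ≤ A) (hΘ1 : ∀ t, 0 ≤ Θ t ∧ Θ t ≤ 1) (t : ℝ) :
    Tendsto (fun s => ∫ x, |timeContinuousRep θ Θ ψ g (s, x) - timeContinuousRep θ Θ ψ g (t, x)|)
      (𝓝 t) (𝓝 0) := by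
  set k : ℝ → ℝ × E3 → ℝ := fun s p =>
    ψ p * θ p.1 + g p * (Θ p.1 - (Ici s).indicator (fun _ => 1) p.1) with hk
  have hki : ∀ s, Integrable (k s) := integrable_repKernel hψ hg hψm hgm hθ hΘ hθA hΘ1
  have hkd : ∀ s, Integrable (fun p => k s p - k t p) := fun s => (hki s).sub (hki t)
  have hlim : Tendsto (fun s => ∫ p, ‖k s p - k t p‖) (𝓝 t) (𝓝 (∫ _ : ℝ × E3, 0)) := by
    refine tendsto_integral_filter_of_dominated_convergence (fun p => ‖g p‖)
      (Eventually.of_forall fun s => (hkd s).norm.aestronglyMeasurable)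
      (Eventually.of_forall fun s => ae_of_all _ fun p => ?_) hg.norm ?_
    · have e : k s p - k t p = g p * ((Ici t).indicator (fun _ => 1) p.1 -
          (Ici s).indicator (fun _ => 1) p.1) := by simp only [hk]; ring
      rw [norm_norm, e, norm_mul]
      refine mul_le_of_le_one_right (norm_nonneg _) ?_
      by_cases h1 : p.1 ∈ Ici t <;> by_cases h2 : p.1 ∈ Ici s <;> simp [h1, h2]
    · have hne : ∀ᵐ r : ℝ, r ≠ t := by simp [ae_iff]
      have hne' : ∀ᵐ p : ℝ × E3, p.1 ≠ t := Measure.quasiMeasurePreserving_fst.ae hne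
      filter_upwards [hne'] with p hp
      refine tendsto_const_nhds.congr' ?_
      rcases lt_or_gt_of_ne hp with h | h
      · filter_upwards [Ioi_mem_nhds h] with s hs
        have hs' : p.1 < s := hs
        simp [hk, h, hs']
      · filter_upwards [Iio_mem_nhds h] with s hs
        have hs' : s < p.1 := hs
        simp [hk, h.le, hs'.le]
  rw [integral_zero] at hlim
  refine squeeze_zero (fun s => integral_nonneg fun x => abs_nonneg _) (fun s => ?_) hlim
  have h1 := hki s
  have h2 := hki t
  have h3 := hkd s
  rw [Measure.volume_eq_prod] at h1 h2 h3 ⊢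
  rw [integral_prod_symm _ h3.norm]
  refine integral_mono_of_nonneg (ae_of_all _ fun x => abs_nonneg _) h3.norm.integral_prod_right ?_
  filter_upwards [h1.prod_left_ae, h2.prod_left_ae] with x hx1 hx2
  have e : timeContinuousRep θ Θ ψ g (s, x) - timeContinuousRep θ Θ ψ g (t, x) =
      ∫ r, (k s (r, x) - k t (r, x)) := (integral_sub hx1 hx2).symm
  calc |timeContinuousRep θ Θ ψ g (s, x) - timeContinuousRep θ Θ ψ g (t, x)|
      = ‖∫ r, (k s (r, x) - k t (r, x))‖ := by rw [e, Real.norm_eq_abs]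
    _ ≤ _ := norm_integral_le_integral_norm _

end

theorem setIntegral_mul_eq_integral_indicator_mk {U : Set (ℝ × E3)} (hU : MeasurableSet U)
    {f : ℝ × E3 → ℝ} (hf : AEStronglyMeasurable f (volume.restrict U)) (k : ℝ × E3 → ℝ) :
    ∫ p in U, f p * k p = ∫ p, U.indicator (hf.mk f) p * k p := by
  have e : (fun p => U.indicator (hf.mk f) p * k p) = U.indicator fun p => hf.mk f p * k p := by
    funext p; by_cases hp : p ∈ U <;> simp [hp]
  rw [e, integral_indicator hU]
  refine integral_congr_ae ?_
  filter_upwards [hf.ae_eq_mk] with p hp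
  rw [hp]

/-- A smooth transition from `0` to `1` inside an open interval of time. -/
theorem exists_transition {J : Set ℝ} (hJ : IsOpen J) (hne : J.Nonempty) :
    ∃ (Θ : ℝ → ℝ) (a₀ c₀ E : ℝ), a₀ ≤ c₀ ∧ Icc a₀ c₀ ⊆ J ∧ ContDiff ℝ 1 Θ ∧
      (∀ t, 0 ≤ Θ t ∧ Θ t ≤ 1) ∧ (∀ t ≤ a₀, Θ t = 0) ∧ (∀ t, c₀ ≤ t → Θ t = 1) ∧
      ∀ t, |deriv Θ t| ≤ E := by
  obtain ⟨t₀, ht₀⟩ := hne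
  obtain ⟨δ, hδ, hδJ⟩ := Metric.isOpen_iff.1 hJ t₀ ht₀
  set Θ : ℝ → ℝ := fun t => Real.smoothTransition ((t - t₀) / (δ / 2)) with hΘ
  have hsm : ContDiff ℝ 1 Θ := by
    refine Real.smoothTransition.contDiff.comp ?_
    exact (contDiff_id.sub contDiff_const).div_const _
  have h0 : ∀ t ≤ t₀, Θ t = 0 := fun t ht =>
    Real.smoothTransition.zero_of_nonpos
      (div_nonpos_of_nonpos_of_nonneg (by linarith) (by positivity))
  have h1 : ∀ t, t₀ + δ / 2 ≤ t → Θ t = 1 := fun t ht =>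
    Real.smoothTransition.one_of_one_le (by rw [le_div_iff₀ (by positivity)]; linarith)
  have hc : HasCompactSupport (deriv Θ) := by
    refine HasCompactSupport.intro (isCompact_Icc (a := t₀) (b := t₀ + δ / 2)) fun t ht => ?_
    rw [mem_Icc, not_and_or, not_le, not_le] at ht
    rcases ht with ht | ht
    · have : Θ =ᶠ[𝓝 t] fun _ => 0 := by
        filter_upwards [Iio_mem_nhds ht] with s hs using h0 s (le_of_lt hs)
      rw [this.deriv_eq, deriv_const]
    · have : Θ =ᶠ[𝓝 t] fun _ => 1 := by
        filter_upwards [Ioi_mem_nhds ht] with s hs using h1 s (le_of_lt hs)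
      rw [this.deriv_eq, deriv_const]
  obtain ⟨E, hE⟩ := hc.exists_bound_of_continuous (hsm.continuous_deriv le_rfl)
  refine ⟨Θ, t₀, t₀ + δ / 2, E, by linarith, ?_, hsm,
    fun t => ⟨Real.smoothTransition.nonneg _, Real.smoothTransition.le_one _⟩, h0, h1, hE⟩
  refine Subset.trans (fun t ht => ?_) hδJ
  rw [Metric.mem_ball, Real.dist_eq, abs_lt]
  constructor <;> linarith [ht.1, ht.2]

theorem exists_isTimeContinuousRep {J : Set ℝ} (hJ : IsOpen J) (hJi : J.OrdConnected) {Ω : Set E3}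
    (hΩ : IsOpen Ω) {ψ g : ℝ × E3 → ℝ} (hψ : IntegrableOn ψ (J ×ˢ Ω))
    (hg : HasWeakTimeDeriv (J ×ˢ Ω) ψ g) : ∃ ψ', IsTimeContinuousRep J Ω ψ ψ' := by
  rcases J.eq_empty_or_nonempty with rfl | hne
  · exact ⟨ψ, ae_eq_refl _, by simp, by simp⟩
  have hU : IsOpen (J ×ˢ Ω) := hJ.prod hΩ
  obtain ⟨Θ, a₀, c₀, E, hac₀, hacJ, hΘ, hΘ1, hΘa, hΘc, hE⟩ := exists_transition hJ hne
  have hθ : Continuous (deriv Θ) := hΘ.continuous_deriv le_rfl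
  have hΘabs : ∀ t, |Θ t| ≤ 1 := fun t => by
    rw [abs_of_nonneg (hΘ1 t).1]; exact (hΘ1 t).2
  have hE0 : 0 ≤ E := (abs_nonneg _).trans (hE 0)
  have hΘlip : LipschitzWith ⟨E, hE0⟩ Θ :=
    lipschitzWith_of_nnnorm_deriv_le (hΘ.differentiable one_ne_zero) fun t => hE t
  -- measurable versions, extended by zero
  set ψ₁ := (J ×ˢ Ω).indicator (hψ.aestronglyMeasurable.mk ψ) with hψ₁
  set g₁ := (J ×ˢ Ω).indicator (hg.1.aestronglyMeasurable.mk g) with hg₁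
  have hψm : Measurable ψ₁ :=
    hψ.aestronglyMeasurable.stronglyMeasurable_mk.measurable.indicator hU.measurableSet
  have hgm : Measurable g₁ :=
    hg.1.aestronglyMeasurable.stronglyMeasurable_mk.measurable.indicator hU.measurableSet
  have hψi : Integrable ψ₁ :=
    IntegrableOn.integrable_indicator (hψ.congr hψ.aestronglyMeasurable.ae_eq_mk) hU.measurableSet
  have hgi : Integrable g₁ :=
    IntegrableOn.integrable_indicator (hg.1.congr hg.1.aestronglyMeasurable.ae_eq_mk)
      hU.measurableSet
  have hψU : ψ₁ =ᵐ[volume.restrict (J ×ˢ Ω)] ψ := by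
    filter_upwards [hψ.aestronglyMeasurable.ae_eq_mk, ae_restrict_mem hU.measurableSet] with p h1 h2
    rw [hψ₁, indicator_of_mem h2, h1]
  have hrepi : LocallyIntegrable (timeContinuousRep (deriv Θ) Θ ψ₁ g₁) :=
    locallyIntegrable_timeContinuousRep hψi hgi hψm hgm hθ hΘ.continuous hE hΘ1
  have hzero : ∀ᵐ p, p ∈ J ×ˢ Ω → ψ₁ p - timeContinuousRep (deriv Θ) Θ ψ₁ g₁ p = 0 := by
    refine IsOpen.ae_eq_zero_of_integral_contDiff_smul_eq_zero hU
      ((hψi.locallyIntegrable.sub hrepi).locallyIntegrableOn _) fun φ hφ hφc hφU => ?_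
    obtain ⟨a, c, hCac, hacJ'⟩ := ((hφc.isCompact.image continuous_fst).union
      (isCompact_Icc (a := a₀) (b := c₀))).exists_Icc_superset
      ⟨a₀, Or.inr ⟨le_rfl, hac₀⟩⟩ hJi (by
        refine union_subset ?_ hacJ
        rintro _ ⟨p, hp, rfl⟩
        exact (hφU hp).1)
    set S : Set E3 := Prod.snd '' tsupport φ with hS
    have hScpt : IsCompact S := hφc.isCompact.image continuous_snd
    have hSΩ : S ⊆ Ω := by
      rintro _ ⟨p, hp, rfl⟩
      exact (hφU hp).2
    have hacS : ∀ p, φ p ≠ 0 → p ∈ Icc a c ×ˢ S := fun p hp =>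
      ⟨hCac (Or.inl ⟨p, subset_tsupport _ hp, rfl⟩), ⟨p, subset_tsupport _ hp, rfl⟩⟩
    have hac : ∀ p, φ p ≠ 0 → p.1 ∈ Icc a c := fun p hp => (hacS p hp).1
    obtain ⟨D, hD⟩ := (hφ.of_le (by simp) : ContDiff ℝ 1 φ).lipschitzWith_of_hasCompactSupport
      hφc one_ne_zero
    obtain ⟨B, hB⟩ := hφc.exists_bound_of_continuous hφ.continuous
    obtain ⟨C, hC⟩ := exists_lipschitzWith_balancedPrimitive hD hφc hac hΘlip hΘabs
    have ha : a ≤ a₀ := (hCac (Or.inr ⟨le_rfl, hac₀⟩)).1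
    have hc : c₀ ≤ c := (hCac (Or.inr ⟨hac₀, le_rfl⟩)).2
    have hsupp := support_balancedPrimitive_subset (Θ := Θ) hacS
      (fun t ht => hΘa t (by linarith)) (fun t ht => hΘc t (by linarith))
    have hcpt : IsCompact (Icc a c ×ˢ S) := isCompact_Icc.prod hScpt
    have htest : IsBoundedTest (J ×ˢ Ω) (balancedPrimitive Θ φ) := hC.isBoundedTest
      (HasCompactSupport.of_support_subset_isCompact hcpt hsupp)
      ((closure_minimal hsupp hcpt.isClosed).trans (prod_mono hacJ' hSΩ))
    have hder := hC.isBoundedWeakDeriv (1, 0)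
    have hweak := HasWeakDeriv.integral_mul_eq hU hψ hg htest hder
    rw [setIntegral_mul_eq_integral_indicator_mk hU.measurableSet hψ.aestronglyMeasurable,
      setIntegral_mul_eq_integral_indicator_mk hU.measurableSet hg.1.aestronglyMeasurable] at hweak
    have hderiv : ∀ᵐ p : ℝ × E3, fderiv ℝ (balancedPrimitive Θ φ) p (1, 0) =
        φ p - deriv Θ p.1 * ∫ s, φ (s, p.2) := by
      filter_upwards [hC.ae_differentiableAt] with p hp
      have h1 : HasDerivAt (fun s => balancedPrimitive Θ φ (s, p.2))
          (fderiv ℝ (balancedPrimitive Θ φ) p (1, 0)) p.1 := by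
        have h2 : HasDerivAt (fun s : ℝ => (s, p.2)) ((1 : ℝ), (0 : E3)) p.1 :=
          (hasDerivAt_id p.1).prodMk (hasDerivAt_const _ _)
        exact HasFDerivAt.comp_hasDerivAt (x := p.1) (f := fun s : ℝ => (s, p.2))
          (l := balancedPrimitive Θ φ) hp.hasFDerivAt h2
      have h3 : HasDerivAt (fun s => balancedPrimitive Θ φ (s, p.2))
          (φ p - deriv Θ p.1 * ∫ s, φ (s, p.2)) p.1 :=
        (hasDerivAt_pastIntegral hφ.continuous hac p.1 p.2).sub
          ((hΘ.differentiable one_ne_zero p.1).hasDerivAt.mul_const (∫ s, φ (s, p.2)))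
      exact h1.unique h3
    have hrep := integral_mul_timeContinuousRep hψi hgi hψm hgm hθ hΘ.continuous hE hΘ1
      hφ.continuous hB hac
    obtain ⟨C', hC'⟩ := hder.bounded
    obtain ⟨B', hB'⟩ := htest.bounded
    have hi1 : Integrable fun p => ψ₁ p * fderiv ℝ (balancedPrimitive Θ φ) p (1, 0) :=
      hψi.mul_bdd (c := C') hder.aestronglyMeasurable (ae_of_all _ hC')
    have hi2 : Integrable fun p => g₁ p * balancedPrimitive Θ φ p :=
      hgi.mul_bdd (c := B') htest.aestronglyMeasurable (ae_of_all _ hB')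
    have hi3 : Integrable fun p => φ p * ψ₁ p :=
      hψi.bdd_mul (c := B) hφ.continuous.aestronglyMeasurable (ae_of_all _ hB)
    have hi4 := integrable_mul_timeContinuousRep hψi hgi hψm hgm hθ hΘ.continuous hE hΘ1
      hφ.continuous.measurable hB hac
    have e1 : ∫ p : ℝ × E3, (ψ₁ p * (deriv Θ p.1 * ∫ s, φ (s, p.2)) -
        g₁ p * balancedPrimitive Θ φ p) = ∫ p, (φ p * ψ₁ p -
          ψ₁ p * fderiv ℝ (balancedPrimitive Θ φ) p (1, 0) - g₁ p * balancedPrimitive Θ φ p) := by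
      refine integral_congr_ae ?_
      filter_upwards [hderiv] with p hp
      rw [hp]
      ring
    have hi31 : Integrable fun p => φ p * ψ₁ p -
        ψ₁ p * fderiv ℝ (balancedPrimitive Θ φ) p (1, 0) := hi3.sub hi1
    rw [e1, integral_sub hi31 hi2, integral_sub hi3 hi1] at hrep
    simp only [smul_eq_mul, mul_sub]
    rw [integral_sub hi3 hi4, hrep]
    linarith
  refine ⟨timeContinuousRep (deriv Θ) Θ ψ₁ g₁, ?_, fun t _ => ?_, fun t _ => ?_⟩
  · filter_upwards [hψU, (ae_restrict_iff' hU.measurableSet).2 hzero] with p h1 h2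
    rw [← h1]
    linarith
  · have h1 := integrable_repKernel hψi hgi hψm hgm hθ hΘ.continuous hE hΘ1 t
    rw [Measure.volume_eq_prod] at h1
    exact h1.integral_prod_right.integrableOn
  · have hlim := (tendsto_integral_abs_timeContinuousRep_sub hψi hgi hψm hgm hθ hΘ.continuous hE
      hΘ1 t).mono_left (nhdsWithin_le_nhds (s := J))
    refine squeeze_zero (fun s => integral_nonneg fun x => abs_nonneg _) (fun s => ?_) hlim
    have hi : ∀ s, Integrable fun x => timeContinuousRep (deriv Θ) Θ ψ₁ g₁ (s, x) := fun s => by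
      have h1 := integrable_repKernel hψi hgi hψm hgm hθ hΘ.continuous hE hΘ1 s
      rw [Measure.volume_eq_prod] at h1
      exact h1.integral_prod_right
    exact setIntegral_le_integral ((hi s).sub (hi t)).abs (ae_of_all _ fun x => abs_nonneg _)

/-! ### Solutions, the flow map and the co-moving volumes -/

/-- Near each time the field can be cut off in time so that its flow is defined everywhere. -/
theorem exists_local_flow {J₀ : Set ℝ} {Ω : Set E3} {b v : ℝ × E3 → E3} {M K : ℝ} (hM0 : 0 ≤ M)
    (hK : 0 ≤ K) (hb : Measurable b) (hM : ∀ p, ‖b p‖ ≤ M)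
    (hLip : ∀ t x y, ‖b (t, x) - b (t, y)‖ ≤ K * ‖x - y‖)
    (hbv : ∀ᵐ t ∂(volume.restrict J₀), ∀ x ∈ Ω, b (t, x) = v (t, x)) (hJ₀ : IsOpen J₀)
    {t₁ : ℝ} (ht₁ : t₁ ∈ J₀) {ρ : ℝ} (hρ : 0 < ρ) :
    ∃ (α β : ℝ) (b' : ℝ × E3 → E3) (X : ℝ → ℝ → E3 → E3), α < t₁ ∧ t₁ < β ∧ Icc α β ⊆ J₀ ∧
      M * (β - α) ≤ ρ ∧ IsShortField b' M K α β ∧ IsFlow b' X ∧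
      ∀ᵐ t ∂(volume.restrict (Icc α β)), ∀ x ∈ Ω, b' (t, x) = v (t, x) := by
  obtain ⟨η, hη, hηJ⟩ := Metric.isOpen_iff.1 hJ₀ t₁ ht₁
  obtain ⟨δ, hδ, hδη, hδK, hδM⟩ : ∃ δ > 0, δ < η ∧ K * (2 * δ) ≤ 1 / 2 ∧ M * (2 * δ) ≤ ρ := by
    refine ⟨min (η / 2) (min (1 / (4 * (K + 1))) (ρ / (2 * (M + 1)))), by positivity,
      (min_le_left _ _).trans_lt (by linarith), ?_, ?_⟩
    · have h1 : min (η / 2) (min (1 / (4 * (K + 1))) (ρ / (2 * (M + 1)))) ≤ 1 / (4 * (K + 1)) :=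
        (min_le_right _ _).trans (min_le_left _ _)
      calc K * (2 * _) ≤ (K + 1) * (2 * (1 / (4 * (K + 1)))) := by gcongr; linarith
        _ = 1 / 2 := by field_simp; norm_num
    · have h1 : min (η / 2) (min (1 / (4 * (K + 1))) (ρ / (2 * (M + 1)))) ≤ ρ / (2 * (M + 1)) :=
        (min_le_right _ _).trans (min_le_right _ _)
      calc M * (2 * _) ≤ (M + 1) * (2 * (ρ / (2 * (M + 1)))) := by gcongr; linarith
        _ = ρ := by field_simp
  have hsub : Icc (t₁ - δ) (t₁ + δ) ⊆ J₀ := fun t ht => hηJ (by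
    rw [Metric.mem_ball, Real.dist_eq, abs_lt]
    constructor <;> linarith [ht.1, ht.2])
  set b' : ℝ × E3 → E3 := (Prod.fst ⁻¹' Icc (t₁ - δ) (t₁ + δ)).indicator b with hb'
  have hin : ∀ t ∈ Icc (t₁ - δ) (t₁ + δ), ∀ x, b' (t, x) = b (t, x) := fun t ht x =>
    indicator_of_mem (show (t, x) ∈ Prod.fst ⁻¹' Icc (t₁ - δ) (t₁ + δ) from ht) b
  have hout : ∀ t ∉ Icc (t₁ - δ) (t₁ + δ), ∀ x, b' (t, x) = 0 := fun t ht x =>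
    indicator_of_notMem (show (t, x) ∉ Prod.fst ⁻¹' Icc (t₁ - δ) (t₁ + δ) from ht) b
  have h : IsShortField b' M K (t₁ - δ) (t₁ + δ) := by
    refine ⟨hb.indicator (measurable_fst measurableSet_Icc), hM0, hK, fun p => ?_, fun t x y => ?_,
      hout, by linarith, by rw [show t₁ + δ - (t₁ - δ) = 2 * δ by ring]; exact hδK⟩
    · exact (norm_indicator_le_norm_self _ _).trans (hM p)
    · by_cases ht : t ∈ Icc (t₁ - δ) (t₁ + δ)
      · rw [hin t ht, hin t ht]; exact hLip t x y
      · rw [hout t ht, hout t ht, sub_zero, norm_zero]; positivity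
  obtain ⟨X, hX⟩ := h.exists_flow
  refine ⟨t₁ - δ, t₁ + δ, b', X, by linarith, by linarith, hsub,
    by rw [show t₁ + δ - (t₁ - δ) = 2 * δ by ring]; exact hδM, h, hX, ?_⟩
  filter_upwards [ae_restrict_of_ae_restrict_of_subset hsub hbv, ae_restrict_mem measurableSet_Icc]
    with t h1 h2 x hx
  rw [hin t h2, h1 x hx]

section

variable {J₀ : Set ℝ} {Ω : Set E3} {b v : ℝ × E3 → E3} {M K α β t₀ : ℝ} {X : ℝ → ℝ → E3 → E3}

/-- A solution with values in `Ω` follows the flow of a field that agrees with `v` in `Ω`. -/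
theorem IsSolution.eq_flow (h : IsShortField b M K α β) (hX : IsFlow b X) (hJ : Icc α β ⊆ J₀)
    (hbv : ∀ᵐ t ∂(volume.restrict (Icc α β)), ∀ x ∈ Ω, b (t, x) = v (t, x)) {x₀ : E3}
    {x : ℝ → E3} (hx : IsSolution v Ω J₀ t₀ x₀ x) {s r : ℝ} (hs : s ∈ Icc α β)
    (hr : r ∈ Icc α β) : x s = X s r (x r) := by
  have hi : ∀ p ∈ Icc α β, ∀ q ∈ Icc α β,
      IntervalIntegrable (fun τ => v (τ, x τ)) volume p q := fun p hp q hq =>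
    (hx.integrable p (hJ hp)).symm.trans (hx.integrable q (hJ hq))
  have hinc : ∀ p ∈ Icc α β, ∀ q ∈ Icc α β, x q = x p + ∫ τ in p..q, v (τ, x τ) := by
    intro p hp q hq
    rw [hx.eq p (hJ hp), hx.eq q (hJ hq), add_assoc,
      intervalIntegral.integral_add_adjacent_intervals (hx.integrable p (hJ hp)) (hi p hp q hq)]
  -- the solution, continued by constants outside of `[α, β]`
  set z : ℝ → E3 := (Icc α β).indicator fun τ => v (τ, x τ) with hz
  have hzi : Integrable z := by
    refine IntegrableOn.integrable_indicator ?_ measurableSet_Icc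
    rw [integrableOn_Icc_iff_integrableOn_Ioc,
      ← intervalIntegrable_iff_integrableOn_Ioc_of_le h.le]
    exact hi α ⟨le_rfl, h.le⟩ β ⟨h.le, le_rfl⟩
  set y : ℝ → E3 := fun q => x r + ∫ τ in r..q, z τ with hy
  have hyc : Continuous y := continuous_const.add
    (intervalIntegral.continuous_primitive (fun _ _ => hzi.intervalIntegrable) r)
  have hyx : ∀ q ∈ Icc α β, y q = x q := by
    intro q hq
    simp only [hy]
    rw [hinc r hr q hq]
    congr 1
    refine intervalIntegral.integral_congr fun τ hτ => ?_
    exact indicator_of_mem ((ordConnected_Icc.uIcc_subset hr hq) hτ) _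
  have hcurve : IsIntegralCurveThrough b r (x r) y := by
    refine ⟨hyc, fun q => ?_⟩
    simp only [hy]
    congr 1
    refine intervalIntegral.integral_congr_ae ?_
    filter_upwards [(ae_restrict_iff' measurableSet_Icc).1 hbv] with τ hτ _
    by_cases hmem : τ ∈ Icc α β
    · rw [show x r + ∫ τ in r..τ, z τ = x τ from hyx τ hmem, hτ hmem _ (hx.mem τ (hJ hmem))]
      exact indicator_of_mem hmem _
    · rw [h.eq_zero τ hmem]
      exact indicator_of_notMem hmem _
  have h1 := hX.eq_of_curve h hcurve s r
  rw [hyx r hr, hyx s hs] at h1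
  exact h1.symm

theorem isSolution_flowMap {x₀ : E3} (hx : ∃ x, IsSolution v Ω J₀ t₀ x₀ x) :
    IsSolution v Ω J₀ t₀ x₀ fun t => flowMap v Ω J₀ t₀ t x₀ := by
  have e : (fun t => flowMap v Ω J₀ t₀ t x₀) = hx.choose := by
    funext t
    rw [flowMap, dif_pos hx]
  rw [e]
  exact hx.choose_spec

theorem comovingVolume_eq_preimage (h : IsShortField b M K α β) (hX : IsFlow b X)
    (hJ : Icc α β ⊆ J₀) (hbv : ∀ᵐ t ∂(volume.restrict (Icc α β)), ∀ x ∈ Ω, b (t, x) = v (t, x))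
    {G₀ : Set E3} (hsol : ∀ x₀ ∈ G₀, ∃ x, IsSolution v Ω J₀ t₀ x₀ x) {s r : ℝ}
    (hs : s ∈ Icc α β) (hr : r ∈ Icc α β) :
    comovingVolume v Ω J₀ t₀ G₀ s = X r s ⁻¹' comovingVolume v Ω J₀ t₀ G₀ r := by
  ext x
  constructor
  · rintro ⟨x₀, hx₀, rfl⟩
    refine ⟨x₀, hx₀, ?_⟩
    exact (isSolution_flowMap (hsol x₀ hx₀)).eq_flow h hX hJ hbv hr hs
  · rintro ⟨x₀, hx₀, hx⟩
    refine ⟨x₀, hx₀, ?_⟩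
    rw [(isSolution_flowMap (hsol x₀ hx₀)).eq_flow h hX hJ hbv hs hr, hx, hX.comp h, hX.self]

end

section

variable {J₀ : Set ℝ} {Ω : Set E3} {b v : ℝ × E3 → E3} {M K t₀ : ℝ}

/-- Coincidence of two solutions at a time is an open and closed condition on the time. -/
theorem IsSolution.unique (hM0 : 0 ≤ M) (hK : 0 ≤ K) (hb : Measurable b) (hM : ∀ p, ‖b p‖ ≤ M)
    (hLip : ∀ t x y, ‖b (t, x) - b (t, y)‖ ≤ K * ‖x - y‖)
    (hbv : ∀ᵐ t ∂(volume.restrict J₀), ∀ x ∈ Ω, b (t, x) = v (t, x)) (hJ₀ : IsOpen J₀)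
    (hJc : IsPreconnected J₀) (ht₀ : t₀ ∈ J₀) {x₀ : E3} {x y : ℝ → E3}
    (hx : IsSolution v Ω J₀ t₀ x₀ x) (hy : IsSolution v Ω J₀ t₀ x₀ y) {t : ℝ} (ht : t ∈ J₀) :
    x t = y t := by
  have key := hJc.induction₂ (fun s r => x s = y s ↔ x r = y r) (fun t₁ ht₁ => ?_)
    (fun _ _ _ _ _ _ h1 h2 => h1.trans h2) (fun _ _ _ _ h1 => h1.symm) ht₀ ht
  · exact key.1 (hx.initial.trans hy.initial.symm)
  · obtain ⟨α, β, b', X, hα, hβ, hsub, -, h, hX, hbv'⟩ :=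
      exists_local_flow hM0 hK hb hM hLip hbv hJ₀ ht₁ one_pos
    have ht₁' : t₁ ∈ Icc α β := ⟨hα.le, hβ.le⟩
    filter_upwards [nhdsWithin_le_nhds (Icc_mem_nhds hα hβ)] with s hs
    constructor
    · intro heq
      rw [hx.eq_flow h hX hsub hbv' hs ht₁', hy.eq_flow h hX hsub hbv' hs ht₁', heq]
    · intro heq
      rw [hx.eq_flow h hX hsub hbv' ht₁' hs, hy.eq_flow h hX hsub hbv' ht₁' hs, heq]

/-- Continuity of the flow map in the initial point is an open and closed condition on the time. -/
theorem continuousOn_flowMap (hM0 : 0 ≤ M) (hK : 0 ≤ K) (hb : Measurable b) (hM : ∀ p, ‖b p‖ ≤ M)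
    (hLip : ∀ t x y, ‖b (t, x) - b (t, y)‖ ≤ K * ‖x - y‖)
    (hbv : ∀ᵐ t ∂(volume.restrict J₀), ∀ x ∈ Ω, b (t, x) = v (t, x)) (hJ₀ : IsOpen J₀)
    (hJc : IsPreconnected J₀) (ht₀ : t₀ ∈ J₀) {G₀ : Set E3}
    (hsol : ∀ x₀ ∈ G₀, ∃ x, IsSolution v Ω J₀ t₀ x₀ x) {t : ℝ} (ht : t ∈ J₀) :
    ContinuousOn (flowMap v Ω J₀ t₀ t) G₀ := by
  have key := hJc.induction₂ (fun s r => ContinuousOn (flowMap v Ω J₀ t₀ s) G₀ ↔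
      ContinuousOn (flowMap v Ω J₀ t₀ r) G₀) (fun t₁ ht₁ => ?_)
    (fun _ _ _ _ _ _ h1 h2 => h1.trans h2) (fun _ _ _ _ h1 => h1.symm) ht₀ ht
  · refine key.1 (continuousOn_id.congr fun x₀ hx₀ => ?_)
    exact (isSolution_flowMap (hsol x₀ hx₀)).initial
  · obtain ⟨α, β, b', X, hα, hβ, hsub, -, h, hX, hbv'⟩ :=
      exists_local_flow hM0 hK hb hM hLip hbv hJ₀ ht₁ one_pos
    have ht₁' : t₁ ∈ Icc α β := ⟨hα.le, hβ.le⟩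
    have hstep : ∀ s ∈ Icc α β, ∀ r ∈ Icc α β, ContinuousOn (flowMap v Ω J₀ t₀ r) G₀ →
        ContinuousOn (flowMap v Ω J₀ t₀ s) G₀ := fun s hs r hr hc =>
      ((hX.lipschitzWith h s r).continuous.comp_continuousOn hc).congr fun x₀ hx₀ =>
        (isSolution_flowMap (hsol x₀ hx₀)).eq_flow h hX hsub hbv' hs hr
    filter_upwards [nhdsWithin_le_nhds (Icc_mem_nhds hα hβ)] with s hs
    exact ⟨hstep s hs t₁ ht₁', hstep t₁ ht₁' s hs⟩

end

/-! ### The transport identity at almost every time -/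

/-- Lebesgue's differentiation theorem for a function whose increments are integrals of `K`. -/
theorem ae_hasDerivAt_of_sub_eq_integral {F K : ℝ → ℝ} {α β : ℝ} (hK : IntegrableOn K (Icc α β))
    (h : ∀ s r, α ≤ s → s ≤ r → r < β → F r - F s = ∫ t in s..r, K t) :
    ∀ᵐ t, t ∈ Ioo α β → HasDerivAt F (K t) t := by
  have hKi : Integrable ((Icc α β).indicator K) := hK.integrable_indicator measurableSet_Icc
  filter_upwards [LocallyIntegrable.ae_hasDerivAt_integral hKi.locallyIntegrable] with t ht htI
  have h1 := (ht t).const_add (F t)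
  rw [indicator_of_mem (Ioo_subset_Icc_self htI)] at h1
  refine h1.congr_of_eventuallyEq ?_
  filter_upwards [Ioo_mem_nhds htI.1 htI.2] with s hs
  have e : ∫ r in t..s, (Icc α β).indicator K r = ∫ r in t..s, K r :=
    intervalIntegral.integral_congr fun r hr => indicator_of_mem
      (ordConnected_Icc.uIcc_subset (Ioo_subset_Icc_self htI) (Ioo_subset_Icc_self hs) hr) _
  rw [e]
  rcases le_total t s with hts | hst
  · have := h t s htI.1.le hts hs.2
    linarith
  · have := h s t hs.1.le hst htI.2
    rw [intervalIntegral.integral_symm]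
    linarith

/-- The transport identity for Sobolev functions. The exceptional set of times is null because it
is null near each time. -/
theorem ae_hasDerivAt_integral_comovingVolume {J J₀ : Set ℝ} {Ω : Set E3} {b v : ℝ × E3 → E3}
    {M K t₀ : ℝ} (hJ : IsOpen J) (hΩ : IsOpen Ω) (hM0 : 0 ≤ M) (hK : 0 ≤ K) (hb : Measurable b)
    (hM : ∀ p, ‖b p‖ ≤ M) (hLip : ∀ t x y, ‖b (t, x) - b (t, y)‖ ≤ K * ‖x - y‖)
    (hbv : ∀ᵐ t ∂(volume.restrict J), ∀ x ∈ Ω, b (t, x) = v (t, x)) (hJ₀ : IsOpen J₀)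
    (hJ₀J : J₀ ⊆ J) {G₀ : Set E3}
    (hsol : ∀ x₀ ∈ G₀, ∃ x, IsSolution v Ω J₀ t₀ x₀ x)
    (hG : ∀ t ∈ J₀, IsCompact (comovingVolume v Ω J₀ t₀ G₀ t) ∧ comovingVolume v Ω J₀ t₀ G₀ t ⊆ Ω)
    {ψ ψ' g d : ℝ × E3 → ℝ} (hψ : IntegrableOn ψ (J ×ˢ Ω))
    (hψv : IntegrableOn (fun p => ψ p • v p) (J ×ˢ Ω))
    (hψ' : IsTimeContinuousRep J Ω ψ ψ') (hg : HasWeakTimeDeriv (J ×ˢ Ω) ψ g)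
    (hd : HasWeakSpaceDiv (J ×ˢ Ω) (fun p => ψ p • v p) d) :
    ∀ᵐ t ∂(volume.restrict J₀),
      IntegrableOn (fun x => ψ' (t, x)) (comovingVolume v Ω J₀ t₀ G₀ t) ∧
      IntegrableOn (fun x => g (t, x) + d (t, x)) (comovingVolume v Ω J₀ t₀ G₀ t) ∧
      HasDerivAt (fun s => ∫ x in comovingVolume v Ω J₀ t₀ G₀ s, ψ' (s, x))
        (∫ x in comovingVolume v Ω J₀ t₀ G₀ t, (g (t, x) + d (t, x))) t := by
  set G := comovingVolume v Ω J₀ t₀ G₀ with hGdef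
  have hgd : Integrable (fun p => g p + d p) ((volume.restrict J).prod (volume.restrict Ω)) := by
    rw [← volume_restrict_prod]; exact hg.1.add hd.1
  have hder : ∀ᵐ t ∂(volume.restrict J₀), HasDerivAt (fun s => ∫ x in G s, ψ' (s, x))
      (∫ x in G t, (g (t, x) + d (t, x))) t := by
    rw [ae_restrict_iff' hJ₀.measurableSet, ae_iff]
    refine measure_null_of_locally_null _ fun t₁ ht₁ => ?_
    have ht₁J : t₁ ∈ J₀ := by
      by_contra hcon; exact ht₁ fun h => absurd h hcon
    obtain ⟨hGc, hGΩ⟩ := hG t₁ ht₁J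
    obtain ⟨ρ', hρ', hρ'Ω⟩ := hGc.exists_cthickening_subset_open hΩ hGΩ
    have hρ : 0 < ρ' / 2 := half_pos hρ'
    obtain ⟨α, β, b', X, hα, hβ, hsub, hMρ, h, hX, hbv'⟩ := exists_local_flow hM0 hK hb hM hLip
      (ae_restrict_of_ae_restrict_of_subset hJ₀J hbv) hJ₀ ht₁J hρ
    have hthick : Metric.cthickening (2 * (ρ' / 2)) (G t₁) ⊆ Ω := by
      rwa [show 2 * (ρ' / 2) = ρ' by ring]
    have hthick' : Metric.cthickening (ρ' / 2) (G t₁) ⊆ Ω :=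
      (Metric.cthickening_mono (by linarith) _).trans hthick
    have ht₁' : t₁ ∈ Icc α β := ⟨hα.le, hβ.le⟩
    have hGX : ∀ s ∈ Icc α β, X t₁ s ⁻¹' G t₁ = G s := fun s hs =>
      (comovingVolume_eq_preimage h hX hsub hbv' hsol hs ht₁').symm
    have hKi := integrableOn_integral_comoving h hX (hg.1.add hd.1) hGc hthick' hMρ
      (hsub.trans hJ₀J) ht₁'
    have hinc : ∀ s r, α ≤ s → s ≤ r → r < β →
        (∫ x in G r, ψ' (r, x)) - ∫ x in G s, ψ' (s, x) =
          ∫ t in s..r, ∫ x in X t₁ t ⁻¹' G t₁, (g (t, x) + d (t, x)) := by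
      intro s r hs hsr hr
      rw [← hGX r ⟨hs.trans hsr, hr.le⟩, ← hGX s ⟨hs, hsr.trans hr.le⟩]
      exact integral_comoving_sub hJ hΩ h hX (hsub.trans hJ₀J) hbv' hψ hψv hψ' hg hd hGc hρ hthick
        hMρ ht₁' hs hsr hr
    have hae := ae_hasDerivAt_of_sub_eq_integral hKi hinc
    rw [ae_iff] at hae
    refine ⟨_, inter_mem_nhdsWithin _ (Ioo_mem_nhds hα hβ), measure_mono_null ?_ hae⟩
    rintro t ⟨ht, htI⟩ hcon
    refine ht fun _ => ?_
    have h1 := hcon htI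
    simp only [Pi.add_apply] at h1
    rwa [hGX t (Ioo_subset_Icc_self htI)] at h1
  filter_upwards [hder, ae_restrict_of_ae_restrict_of_subset hJ₀J hgd.prod_right_ae,
    ae_restrict_mem hJ₀.measurableSet] with t h1 h2 h3
  exact ⟨(hψ'.integrable t (hJ₀J h3)).mono_set (hG t h3).2,
    IntegrableOn.mono_set h2 (hG t h3).2, h1⟩

/-! ### Classical derivatives -/

/-- Integration by parts against a test function, for a function that is differentiable in one
direction only. -/
theorem setIntegral_mul_fderiv_eq_neg {U : Set (ℝ × E3)} {e : ℝ × E3}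
    {f f' φ : ℝ × E3 → ℝ} (hf : ContinuousOn f U) (hf' : ContinuousOn f' U)
    (hd : ∀ p ∈ U, HasLineDerivAt ℝ f (f' p) p e) (hφ : IsTestFunction U φ) :
    ∫ p in U, f p * fderiv ℝ φ p e = - ∫ p in U, f' p * φ p := by
  have hφ0 : ∀ p, p ∉ tsupport φ → φ p = 0 := fun p hp => image_eq_zero_of_notMem_tsupport hp
  have hφ1 : ∀ p, p ∉ tsupport φ → fderiv ℝ φ p e = 0 := fun p hp => by
    rw [fderiv_of_notMem_tsupport ℝ hp]; rfl
  have hc1 : Continuous fun p => fderiv ℝ φ p e :=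
    (hφ.smooth.continuous_fderiv (by simp)).clm_apply continuous_const
  have hint : ∀ k l : ℝ × E3 → ℝ, ContinuousOn k U → Continuous l →
      (∀ p, p ∉ tsupport φ → l p = 0) → Integrable fun p => k p * l p := by
    intro k l hk hl hl0
    have h1 : IntegrableOn (fun p => k p * l p) (tsupport φ) :=
      ((hk.mono hφ.support).mul hl.continuousOn).integrableOn_compact hφ.compact.isCompact
    exact h1.integrable_of_forall_notMem_eq_zero fun p hp => by rw [hl0 p hp, mul_zero]
  have hi1 := hint f _ hf hc1 hφ1
  have hi2 := hint f' _ hf' hφ.smooth.continuous hφ0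
  have hi3 := hint f _ hf hφ.smooth.continuous hφ0
  have hline : ∀ p,
      HasLineDerivAt ℝ (fun p => f p * φ p) (f' p * φ p + f p * fderiv ℝ φ p e) p e := by
    intro p
    by_cases hp : p ∈ tsupport φ
    · have h1 := hd p (hφ.support hp)
      have h2 : HasLineDerivAt ℝ φ (fderiv ℝ φ p e) p e :=
        (hφ.smooth.differentiable (by simp) p).hasFDerivAt.hasLineDerivAt e
      have h3 := HasDerivAt.mul h1 h2
      simp only [zero_smul, add_zero] at h3
      exact h3
    · have hev : (fun p => f p * φ p) =ᶠ[𝓝 p] fun _ => 0 := by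
        filter_upwards [(isClosed_tsupport φ).isOpen_compl.mem_nhds hp] with q hq
        rw [hφ0 q hq, mul_zero]
      rw [hφ0 p hp, hφ1 p hp, mul_zero, mul_zero, add_zero]
      have h1 : HasFDerivAt (fun p => f p * φ p) (0 : ℝ × E3 →L[ℝ] ℝ) p :=
        (hasFDerivAt_const (0 : ℝ) p).congr_of_eventuallyEq hev
      exact h1.hasLineDerivAt e
  have key := integral_bilinear_hasLineDerivAt_right_eq_neg_left_of_integrable
    (μ := (volume : Measure (ℝ × E3))) (B := ContinuousLinearMap.mul ℝ ℝ)
    (f := fun p => f p * φ p) (f' := fun p => f' p * φ p + f p * fderiv ℝ φ p e)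
    (g := fun _ => (1 : ℝ)) (g' := fun _ => 0) (v := e)
    (by simp only [ContinuousLinearMap.mul_apply', mul_one]; exact hi2.add hi1) (by simp)
    (by simpa using hi3) (fun p _ => hline p)
    (fun p _ => by simpa using (hasFDerivAt_const (1 : ℝ) p).hasLineDerivAt e)
  simp only [ContinuousLinearMap.mul_apply', mul_zero, integral_zero, mul_one] at key
  rw [integral_add hi2 hi1] at key
  rw [setIntegral_eq_integral_of_forall_compl_eq_zero fun p hp => by
      rw [hφ1 p fun h => hp (hφ.support h), mul_zero],
    setIntegral_eq_integral_of_forall_compl_eq_zero fun p hp => by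
      rw [hφ0 p fun h => hp (hφ.support h), mul_zero]]
  linarith

/-- The classical regularity assumptions on the velocity field. -/
structure IsClassicalField (U : Set (ℝ × E3)) (v : ℝ × E3 → E3) : Prop where
  continuousOn : ContinuousOn v U
  differentiableAt : ∀ p ∈ U, DifferentiableAt ℝ (fun y => v (p.1, y)) p.2
  continuousOn_fderiv : ContinuousOn (fun p : ℝ × E3 => fderiv ℝ (fun y => v (p.1, y)) p.2) U

section

variable {U : Set (ℝ × E3)} {v : ℝ × E3 → E3} {ψ : ℝ × E3 → ℝ}

theorem hasFDerivAt_smul_slice (hU : IsOpen U) (hv : IsClassicalField U v)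
    (hψ : ContDiffOn ℝ 1 ψ U) {p : ℝ × E3} (hp : p ∈ U) :
    HasFDerivAt (fun y => ψ (p.1, y) • v (p.1, y))
      (ψ p • fderiv ℝ (fun y => v (p.1, y)) p.2 +
        ((fderiv ℝ ψ p).comp (ContinuousLinearMap.inr ℝ ℝ E3)).smulRight (v p)) p.2 := by
  have h1 : HasFDerivAt (fun y => ψ (p.1, y))
      ((fderiv ℝ ψ p).comp (ContinuousLinearMap.inr ℝ ℝ E3)) p.2 :=
    HasFDerivAt.comp (f := fun y => (p.1, y)) (g := ψ) p.2
      ((hψ.differentiableOn one_ne_zero).differentiableAt (hU.mem_nhds hp)).hasFDerivAt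
      (hasFDerivAt_prodMk_right p.1 p.2)
  exact h1.smul (hv.differentiableAt p hp).hasFDerivAt

theorem timeDeriv_eq (hU : IsOpen U) (hψ : ContDiffOn ℝ 1 ψ U) {p : ℝ × E3} (hp : p ∈ U) :
    timeDeriv ψ p = fderiv ℝ ψ p (1, 0) := by
  have h2 : HasDerivAt (fun s : ℝ => (s, p.2)) ((1 : ℝ), (0 : E3)) p.1 :=
    (hasDerivAt_id p.1).prodMk (hasDerivAt_const _ _)
  exact (HasFDerivAt.comp_hasDerivAt (x := p.1) (f := fun s : ℝ => (s, p.2)) (l := ψ)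
    ((hψ.differentiableOn one_ne_zero).differentiableAt (hU.mem_nhds hp)).hasFDerivAt h2).deriv

theorem continuousOn_timeDeriv (hU : IsOpen U) (hψ : ContDiffOn ℝ 1 ψ U) :
    ContinuousOn (timeDeriv ψ) U :=
  ((hψ.continuousOn_fderiv_of_isOpen hU le_rfl).clm_apply continuousOn_const).congr
    fun _ hp => timeDeriv_eq hU hψ hp

/-- The derivatives whose sum is the divergence of `ψ v`. -/
noncomputable def diagonalDeriv (w : ℝ × E3 → E3) (i : Fin 3) (p : ℝ × E3) : ℝ :=
  (fderiv ℝ (fun y => w (p.1, y)) p.2 (EuclideanSpace.single i 1)) i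

theorem continuousOn_diagonalDeriv (hU : IsOpen U) (hv : IsClassicalField U v)
    (hψ : ContDiffOn ℝ 1 ψ U) (i : Fin 3) :
    ContinuousOn (diagonalDeriv (fun p => ψ p • v p) i) U := by
  have h1 : ContinuousOn (fun p => ψ p • fderiv ℝ (fun y => v (p.1, y)) p.2
      (EuclideanSpace.single i 1) + fderiv ℝ ψ p (0, EuclideanSpace.single i 1) • v p) U :=
    (hψ.continuousOn.smul (hv.continuousOn_fderiv.clm_apply continuousOn_const)).add
      (((hψ.continuousOn_fderiv_of_isOpen hU le_rfl).clm_apply continuousOn_const).smul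
        hv.continuousOn)
  refine ((EuclideanSpace.proj (𝕜 := ℝ) i).continuous.comp_continuousOn h1).congr fun p hp => ?_
  simp only [diagonalDeriv]
  rw [(hasFDerivAt_smul_slice hU hv hψ hp).fderiv]
  simp

theorem continuousOn_spaceDiv (hU : IsOpen U) (hv : IsClassicalField U v)
    (hψ : ContDiffOn ℝ 1 ψ U) : ContinuousOn (spaceDiv fun p => ψ p • v p) U :=
  continuousOn_finsetSum _ fun i _ => continuousOn_diagonalDeriv hU hv hψ i

theorem hasLineDerivAt_diagonalDeriv (hU : IsOpen U) (hv : IsClassicalField U v)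
    (hψ : ContDiffOn ℝ 1 ψ U) (i : Fin 3) {p : ℝ × E3} (hp : p ∈ U) :
    HasLineDerivAt ℝ (fun p => (ψ p • v p) i) (diagonalDeriv (fun p => ψ p • v p) i p) p
      (0, EuclideanSpace.single i 1) := by
  have h1 := (hasFDerivAt_smul_slice hU hv hψ hp).differentiableAt.hasFDerivAt
  have h2 := ((EuclideanSpace.proj (𝕜 := ℝ) i).hasFDerivAt.comp p.2 h1).hasLineDerivAt
    (EuclideanSpace.single i 1)
  have h3 : HasDerivAt _ _ (0 : ℝ) := h2
  refine HasDerivAt.congr_of_eventuallyEq (f₁ := fun t : ℝ =>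
    (ψ (p + t • ((0 : ℝ), EuclideanSpace.single i 1)) •
      v (p + t • ((0 : ℝ), EuclideanSpace.single i 1))) i) h3 (Eventually.of_forall fun t => ?_)
  have e : p + t • ((0 : ℝ), EuclideanSpace.single i (1 : ℝ)) =
      (p.1, p.2 + t • EuclideanSpace.single i 1) := by
    ext <;> simp
  simp only [e, Function.comp_apply]
  rfl

theorem hasWeakTimeDeriv_timeDeriv (hU : IsOpen U) (hψ : ContDiffOn ℝ 1 ψ U)
    (hi : IntegrableOn (timeDeriv ψ) U) : HasWeakTimeDeriv U ψ (timeDeriv ψ) := by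
  refine ⟨hi, fun φ hφ => setIntegral_mul_fderiv_eq_neg hψ.continuousOn
    (continuousOn_timeDeriv hU hψ) (fun p hp => ?_) hφ⟩
  rw [timeDeriv_eq hU hψ hp]
  exact ((hψ.differentiableOn one_ne_zero).differentiableAt
    (hU.mem_nhds hp)).hasFDerivAt.hasLineDerivAt _

theorem hasWeakSpaceDiv_spaceDiv (hU : IsOpen U) (hv : IsClassicalField U v)
    (hψ : ContDiffOn ℝ 1 ψ U) (hψv : IntegrableOn (fun p => ψ p • v p) U)
    (hi : ∀ i, IntegrableOn (diagonalDeriv (fun p => ψ p • v p) i) U) :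
    HasWeakSpaceDiv U (fun p => ψ p • v p) (spaceDiv fun p => ψ p • v p) := by
  refine ⟨integrable_finsetSum _ fun i _ => hi i, fun φ hφ => ?_⟩
  obtain ⟨A, hA⟩ := hφ.compact.exists_bound_of_continuous hφ.smooth.continuous
  have hc := hψ.continuousOn.smul hv.continuousOn
  have h1 : ∀ i, ∫ p in U, (ψ p • v p) i * fderiv ℝ φ p (0, EuclideanSpace.single i 1) =
      - ∫ p in U, diagonalDeriv (fun p => ψ p • v p) i p * φ p := fun i =>
    setIntegral_mul_fderiv_eq_neg
      ((EuclideanSpace.proj (𝕜 := ℝ) i).continuous.comp_continuousOn hc)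
      (continuousOn_diagonalDeriv hU hv hψ i)
      (fun p hp => hasLineDerivAt_diagonalDeriv hU hv hψ i hp) hφ
  have hi1 : ∀ i, IntegrableOn
      (fun p => (ψ p • v p) i * fderiv ℝ φ p (0, EuclideanSpace.single i 1)) U := by
    intro i
    have hdc : Continuous fun p => fderiv ℝ φ p (0, EuclideanSpace.single i 1) :=
      (hφ.smooth.continuous_fderiv (by simp)).clm_apply continuous_const
    obtain ⟨B, hB⟩ := (hφ.compact.fderiv_apply ℝ
      (0, EuclideanSpace.single i 1)).exists_bound_of_continuous hdc
    exact ((EuclideanSpace.proj (𝕜 := ℝ) i).integrable_comp hψv).mul_bdd (c := B)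
      hdc.aestronglyMeasurable (ae_of_all _ hB)
  have hi2 : ∀ i, IntegrableOn (fun p => diagonalDeriv (fun p => ψ p • v p) i p * φ p) U :=
    fun i => (hi i).mul_bdd (c := A) hφ.smooth.continuous.aestronglyMeasurable (ae_of_all _ hA)
  simp only [clm_apply_eq_sum _ (ψ _ • v _)]
  rw [integral_finsetSum _ fun i _ => hi1 i]
  have e2 : ∫ p in U, spaceDiv (fun p => ψ p • v p) p * φ p =
      ∑ i, ∫ p in U, diagonalDeriv (fun p => ψ p • v p) i p * φ p := by
    rw [← integral_finsetSum _ fun i _ => hi2 i]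
    refine integral_congr_ae (ae_of_all _ fun p => ?_)
    simp only [← Finset.sum_mul]
    rfl
  rw [e2, ← Finset.sum_neg_distrib]
  exact Finset.sum_congr rfl fun i _ => h1 i

end

/-! ### The transport identity at every time -/

/-- Lebesgue measure is a multiple of the three-dimensional Hausdorff measure. -/
theorem volume_image_le_of_lipschitzWith_two {f : E3 → E3} (hf : LipschitzWith 2 f) (s : Set E3) :
    volume (f '' s) ≤ 8 * volume s := by
  obtain ⟨c, hc⟩ : ∃ c : ℝ≥0, (volume : Measure E3) =
      c • Measure.hausdorffMeasure (Module.finrank ℝ E3 : ℝ) :=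
    ⟨_, Measure.isAddLeftInvariant_eq_smul _ _⟩
  rw [hc]
  simp only [Measure.smul_apply, ENNReal.smul_def, smul_eq_mul]
  refine (mul_le_mul_right ((hf.lipschitzOnWith (s := s)).hausdorffMeasure_image_le
    (Nat.cast_nonneg _)) (c : ℝ≥0∞)).trans (le_of_eq ?_)
  have h3 : Module.finrank ℝ E3 = 3 := by simp
  rw [h3]
  simp only [ENNReal.coe_ofNat, ENNReal.rpow_natCast]
  rw [← mul_assoc, ← mul_assoc, mul_comm (c : ℝ≥0∞)]
  norm_num

/-- If the maps `Y τ` tend to the identity, then the part of `(Y τ)⁻¹(G)` outside of the compact set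
`G` has small volume. -/
theorem tendsto_volume_preimage_sdiff {Y : ℝ → E3 → E3} (hY : ∀ τ, Continuous (Y τ)) {M t₁ : ℝ}
    (hYM : ∀ τ x, ‖Y τ x - x‖ ≤ M * |τ - t₁|) {G : Set E3} (hG : IsCompact G) :
    Tendsto (fun τ => volume (Y τ ⁻¹' G \ G)) (𝓝 t₁) (𝓝 0) := by
  have hsmall : Tendsto (fun τ => M * |τ - t₁|) (𝓝 t₁) (𝓝 0) := by
    have : Tendsto (fun τ => M * |τ - t₁|) (𝓝 t₁) (𝓝 (M * |t₁ - t₁|)) := by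
      apply Continuous.tendsto; fun_prop
    simpa using this
  rw [← measure_empty (μ := (volume : Measure E3))]
  refine tendsto_measure_of_tendsto_indicator (𝓝 t₁)
    (fun τ => ((hG.isClosed.preimage (hY τ)).measurableSet).diff hG.measurableSet)
    (B := Metric.cthickening 1 G) Metric.isClosed_cthickening.measurableSet
    hG.cthickening.measure_lt_top.ne ?_ fun x => ?_
  · filter_upwards [hsmall.eventually_lt_const one_pos] with τ hτ x hx
    refine Metric.mem_cthickening_of_dist_le x (Y τ x) 1 G hx.1 ?_
    rw [dist_comm, dist_eq_norm]
    exact (hYM τ x).trans hτ.le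
  · by_cases hx : x ∈ G
    · exact Eventually.of_forall fun τ => by simp [hx]
    · have hlim : Tendsto (fun τ => Y τ x) (𝓝 t₁) (𝓝 x) := by
        rw [tendsto_iff_norm_sub_tendsto_zero]
        exact squeeze_zero (fun τ => norm_nonneg _) (fun τ => hYM τ x) hsmall
      filter_upwards [hlim (hG.isClosed.isOpen_compl.mem_nhds hx)] with τ hτ
      exact iff_of_false (fun h => hτ h.1) (notMem_empty x)

section

variable {b : ℝ × E3 → E3} {M K α β : ℝ} {X : ℝ → ℝ → E3 → E3}

/-- The volume of the symmetric difference of a compact set and its image under the flow tends to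
zero with the time difference. Points that leave the set are images of points that enter it when
the flow is reversed, which controls their volume by a Lipschitz constant. -/
theorem tendsto_volume_comoving_sdiff (h : IsShortField b M K α β) (hX : IsFlow b X) {G : Set E3}
    (hG : IsCompact G) (t₁ : ℝ) :
    Tendsto (fun τ => volume (X t₁ τ ⁻¹' G \ G)) (𝓝 t₁) (𝓝 0) ∧
      Tendsto (fun τ => volume (G \ X t₁ τ ⁻¹' G)) (𝓝 t₁) (𝓝 0) := by
  refine ⟨tendsto_volume_preimage_sdiff (fun τ => (hX.lipschitzWith h t₁ τ).continuous)
    (M := M) (fun τ x => by rw [abs_sub_comm]; exact hX.norm_sub_le h t₁ τ x) hG, ?_⟩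
  have h1 := tendsto_volume_preimage_sdiff (fun τ => (hX.lipschitzWith h τ t₁).continuous)
    (M := M) (fun τ x => hX.norm_sub_le h τ t₁ x) hG
  have h2 := ENNReal.Tendsto.const_mul (a := 8) h1 (Or.inr (by simp))
  rw [mul_zero] at h2
  refine tendsto_of_tendsto_of_tendsto_of_le_of_le tendsto_const_nhds h2 (fun _ => zero_le)
    fun τ => ?_
  refine le_trans (measure_mono ?_)
    (volume_image_le_of_lipschitzWith_two (hX.lipschitzWith h τ t₁) _)
  rintro x ⟨hx1, hx2⟩
  refine ⟨X t₁ τ x, ⟨?_, hx2⟩, ?_⟩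
  · rw [mem_preimage, hX.comp h, hX.self]; exact hx1
  · rw [hX.comp h, hX.self]

theorem abs_setIntegral_sub_setIntegral_le {A B : Set E3} (hA : MeasurableSet A)
    (hB : MeasurableSet B) {k : E3 → ℝ} (hkA : IntegrableOn k A) (hkB : IntegrableOn k B) {C : ℝ}
    (hCA : ∀ x ∈ A, |k x| ≤ C) (hCB : ∀ x ∈ B, |k x| ≤ C) (hvA : volume A < (∞ : ℝ≥0∞))
    (hvB : volume B < (∞ : ℝ≥0∞)) : |(∫ x in A, k x) - ∫ x in B, k x| ≤
      C * volume.real (A \ B) + C * volume.real (B \ A) := by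
  rw [← integral_inter_add_sdiff hB hkA, ← integral_inter_add_sdiff hA hkB, inter_comm B A,
    add_sub_add_left_eq_sub]
  refine (abs_sub _ _).trans (add_le_add ?_ ?_)
  · exact norm_setIntegral_le_of_norm_le_const (f := k) (C := C)
      ((measure_mono sdiff_subset).trans_lt hvA)
      fun x hx => hCA x hx.1
  · exact norm_setIntegral_le_of_norm_le_const (f := k) (C := C)
      ((measure_mono sdiff_subset).trans_lt hvB)
      fun x hx => hCB x hx.1

/-- Integrals of a continuous function over the moving set are continuous in time. -/
theorem tendsto_integral_comoving (h : IsShortField b M K α β) (hX : IsFlow b X) {G : Set E3}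
    (hG : IsCompact G) {a c t₁ : ℝ} (ha : a < t₁) (hc : t₁ < c) {ρ : ℝ} (hρ : 0 < ρ)
    {k : ℝ × E3 → ℝ} (hk : ContinuousOn k (Icc a c ×ˢ Metric.cthickening ρ G)) :
    Tendsto (fun τ => ∫ x in X t₁ τ ⁻¹' G, k (τ, x)) (𝓝 t₁) (𝓝 (∫ x in G, k (t₁, x))) := by
  set S := Metric.cthickening ρ G with hS
  have hScpt : IsCompact S := hG.cthickening
  have hGS : G ⊆ S := Metric.self_subset_cthickening G
  obtain ⟨C, hC⟩ := (isCompact_Icc.prod hScpt).exists_bound_of_continuousOn hk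
  have hslice : ∀ τ ∈ Icc a c, ContinuousOn (fun x => k (τ, x)) S := fun τ hτ =>
    hk.comp (by fun_prop) fun x hx => ⟨hτ, hx⟩
  have hmeas : ∀ τ, MeasurableSet (X t₁ τ ⁻¹' G) := fun τ =>
    (hG.isClosed.preimage (hX.lipschitzWith h t₁ τ).continuous).measurableSet
  have hsmall : Tendsto (fun τ => M * |t₁ - τ|) (𝓝 t₁) (𝓝 0) := by
    have : Tendsto (fun τ => M * |t₁ - τ|) (𝓝 t₁) (𝓝 (M * |t₁ - t₁|)) := by
      apply Continuous.tendsto; fun_prop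
    simpa using this
  have hI := Icc_mem_nhds ha hc
  have h1 : Tendsto (fun τ => (∫ x in X t₁ τ ⁻¹' G, k (τ, x)) - ∫ x in G, k (τ, x)) (𝓝 t₁)
      (𝓝 0) := by
    obtain ⟨hv1, hv2⟩ := tendsto_volume_comoving_sdiff h hX hG t₁
    have hv : Tendsto (fun τ => C * volume.real (X t₁ τ ⁻¹' G \ G) +
        C * volume.real (G \ X t₁ τ ⁻¹' G)) (𝓝 t₁) (𝓝 0) := by
      have e1 := ((ENNReal.tendsto_toReal ENNReal.zero_ne_top).comp hv1).const_mul C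
      have e2 := ((ENNReal.tendsto_toReal ENNReal.zero_ne_top).comp hv2).const_mul C
      have e3 := e1.add e2
      simp only [ENNReal.toReal_zero, mul_zero, add_zero] at e3
      exact e3
    refine squeeze_zero_norm' ?_ hv
    filter_upwards [hI, hsmall.eventually_lt_const hρ] with τ hτ hτM
    have hsub : X t₁ τ ⁻¹' G ⊆ S := fun x hx => by
      refine Metric.mem_cthickening_of_dist_le x (X t₁ τ x) ρ G hx ?_
      rw [dist_comm, dist_eq_norm]
      exact (hX.norm_sub_le h t₁ τ x).trans hτM.le
    have hi := (hslice τ hτ).integrableOn_compact (μ := volume) hScpt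
    exact abs_setIntegral_sub_setIntegral_le (hmeas τ) hG.measurableSet (hi.mono_set hsub)
      (hi.mono_set hGS) (fun x hx => hC _ ⟨hτ, hsub hx⟩) (fun x hx => hC _ ⟨hτ, hGS hx⟩)
      ((measure_mono hsub).trans_lt hScpt.measure_lt_top) hG.measure_lt_top
  have h2 : Tendsto (fun τ => ∫ x in G, k (τ, x)) (𝓝 t₁) (𝓝 (∫ x in G, k (t₁, x))) := by
    refine tendsto_integral_filter_of_dominated_convergence (fun _ => C) ?_ ?_
      (integrableOn_const hG.measure_lt_top.ne) ?_
    · filter_upwards [hI] with τ hτ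
      exact ((hslice τ hτ).mono hGS).aestronglyMeasurable hG.measurableSet
    · filter_upwards [hI] with τ hτ
      filter_upwards [ae_restrict_mem hG.measurableSet] with x hx using hC _ ⟨hτ, hGS hx⟩
    · filter_upwards [ae_restrict_mem hG.measurableSet] with x hx
      have h3 : ContinuousWithinAt (fun τ => k (τ, x)) (Icc a c) t₁ :=
        (hk (t₁, x) ⟨⟨ha.le, hc.le⟩, hGS hx⟩).comp (f := fun τ => (τ, x)) (by fun_prop)
          fun τ hτ => ⟨hτ, hGS hx⟩
      exact h3.continuousAt hI
  have h3 := h1.add h2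
  simpa using h3

end

theorem hasDerivAt_of_sub_eq_integral {F K : ℝ → ℝ} {α β t₁ : ℝ} (hK : IntegrableOn K (Icc α β))
    (h : ∀ s r, α ≤ s → s ≤ r → r < β → F r - F s = ∫ t in s..r, K t) (hα : α < t₁) (hβ : t₁ < β)
    (hc : ContinuousAt K t₁) : HasDerivAt F (K t₁) t₁ := by
  have h1 : HasDerivAt (fun s => ∫ t in t₁..s, K t) (K t₁) t₁ :=
    intervalIntegral.integral_hasDerivAt_right (by simp)
      ⟨Icc α β, Icc_mem_nhds hα hβ, hK.aestronglyMeasurable⟩ hc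
  refine (h1.const_add (F t₁)).congr_of_eventuallyEq ?_
  filter_upwards [Ioo_mem_nhds hα hβ] with s hs
  rcases le_total t₁ s with hts | hst
  · have := h t₁ s hα.le hts hs.2
    linarith
  · have := h s t₁ hs.1.le hst hβ
    rw [intervalIntegral.integral_symm]
    linarith

/-- On a bounded cylinder, a continuous function is its own time-continuous representative. -/
theorem isTimeContinuousRep_self {J : Set ℝ} {Ω S : Set E3} {a c : ℝ} (hΩ : IsOpen Ω)
    (hS : IsCompact S) (hJ : J ⊆ Icc a c) (hΩS : Ω ⊆ S) {ψ : ℝ × E3 → ℝ}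
    (hψ : ContinuousOn ψ (Icc a c ×ˢ S)) : IsTimeContinuousRep J Ω ψ ψ := by
  obtain ⟨C, hC⟩ := (isCompact_Icc.prod hS).exists_bound_of_continuousOn hψ
  have hslice : ∀ τ ∈ Icc a c, ContinuousOn (fun x => ψ (τ, x)) S := fun τ hτ =>
    hψ.comp (by fun_prop) fun x hx => ⟨hτ, hx⟩
  have hint : ∀ t ∈ J, IntegrableOn (fun x => ψ (t, x)) Ω := fun t ht =>
    ((hslice t (hJ ht)).integrableOn_compact hS).mono_set hΩS
  refine ⟨ae_eq_refl _, hint, fun t ht => ?_⟩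
  have hfin : volume Ω ≠ (∞ : ℝ≥0∞) := ((measure_mono hΩS).trans_lt hS.measure_lt_top).ne
  have : Tendsto (fun s => ∫ x in Ω, |ψ (s, x) - ψ (t, x)|) (𝓝[J] t) (𝓝 (∫ x in Ω, 0)) := by
    refine tendsto_integral_filter_of_dominated_convergence (fun _ => C + C) ?_ ?_
      (integrableOn_const hfin) ?_
    · filter_upwards [self_mem_nhdsWithin] with s hs
      exact ((hint s hs).sub (hint t ht)).abs.aestronglyMeasurable
    · filter_upwards [self_mem_nhdsWithin] with s hs
      filter_upwards [ae_restrict_mem hΩ.measurableSet] with x hx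
      rw [Real.norm_eq_abs, abs_abs]
      exact (abs_sub _ _).trans (add_le_add (hC _ ⟨hJ hs, hΩS hx⟩) (hC _ ⟨hJ ht, hΩS hx⟩))
    · filter_upwards [ae_restrict_mem hΩ.measurableSet] with x hx
      have h3 : ContinuousWithinAt (fun s => ψ (s, x)) J t :=
        (hψ (t, x) ⟨hJ ht, hΩS hx⟩).comp (f := fun s => (s, x)) (by fun_prop)
          fun s hs => ⟨hJ hs, hΩS hx⟩
      have h4 := (h3.tendsto.sub_const (ψ (t, x))).abs
      simpa using h4
  simpa using this

/-- The classical transport identity. Near `t₁` the co-moving volumes stay in a compact part of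
`J × Ω`, where the classical derivatives are integrable weak derivatives, so that the increments are
integrals of a density which is continuous at `t₁`. -/
theorem hasDerivAt_integral_comovingVolume {J J₀ : Set ℝ} {Ω : Set E3} {b v : ℝ × E3 → E3}
    {M K t₀ : ℝ} (hJ : IsOpen J) (hΩ : IsOpen Ω) (hM0 : 0 ≤ M) (hK : 0 ≤ K) (hb : Measurable b)
    (hM : ∀ p, ‖b p‖ ≤ M) (hLip : ∀ t x y, ‖b (t, x) - b (t, y)‖ ≤ K * ‖x - y‖)
    (hbv : ∀ᵐ t ∂(volume.restrict J), ∀ x ∈ Ω, b (t, x) = v (t, x)) (hJ₀ : IsOpen J₀)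
    (hJ₀J : J₀ ⊆ J) {G₀ : Set E3} (hsol : ∀ x₀ ∈ G₀, ∃ x, IsSolution v Ω J₀ t₀ x₀ x)
    (hv : IsClassicalField (J ×ˢ Ω) v) {ψ : ℝ × E3 → ℝ} (hψ : ContDiffOn ℝ 1 ψ (J ×ˢ Ω))
    {t₁ : ℝ} (ht₁ : t₁ ∈ J₀) (hG : IsCompact (comovingVolume v Ω J₀ t₀ G₀ t₁))
    (hGΩ : comovingVolume v Ω J₀ t₀ G₀ t₁ ⊆ Ω) :
    IntegrableOn (fun x => ψ (t₁, x)) (comovingVolume v Ω J₀ t₀ G₀ t₁) ∧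
      IntegrableOn (fun x => timeDeriv ψ (t₁, x) + spaceDiv (fun p => ψ p • v p) (t₁, x))
        (comovingVolume v Ω J₀ t₀ G₀ t₁) ∧
      HasDerivAt (fun s => ∫ x in comovingVolume v Ω J₀ t₀ G₀ s, ψ (s, x))
        (∫ x in comovingVolume v Ω J₀ t₀ G₀ t₁,
          (timeDeriv ψ (t₁, x) + spaceDiv (fun p => ψ p • v p) (t₁, x))) t₁ := by
  set G := comovingVolume v Ω J₀ t₀ G₀ with hGdef
  set k : ℝ × E3 → ℝ := fun p => timeDeriv ψ p + spaceDiv (fun p => ψ p • v p) p with hk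
  have hU : IsOpen (J ×ˢ Ω) := hJ.prod hΩ
  have hkc : ContinuousOn k (J ×ˢ Ω) :=
    (continuousOn_timeDeriv hU hψ).add (continuousOn_spaceDiv hU hv hψ)
  have hsl : ∀ f : ℝ × E3 → ℝ, ContinuousOn f (J ×ˢ Ω) →
      IntegrableOn (fun x => f (t₁, x)) (G t₁) := fun f hf =>
    (hf.comp (by fun_prop) fun x hx => ⟨hJ₀J ht₁, hGΩ hx⟩).integrableOn_compact hG
  refine ⟨hsl ψ hψ.continuousOn, hsl k hkc, ?_⟩
  -- a relatively compact space-time neighborhood of the moving set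
  obtain ⟨ρ', hρ', hρ'Ω⟩ := hG.exists_cthickening_subset_open hΩ hGΩ
  obtain ⟨ρ, hρ, hρΩ⟩ : ∃ ρ > 0, Metric.cthickening (3 * ρ) (G t₁) ⊆ Ω :=
    ⟨ρ' / 3, by positivity, by rwa [show 3 * (ρ' / 3) = ρ' by ring]⟩
  set S := Metric.cthickening (3 * ρ) (G t₁) with hS
  have hScpt : IsCompact S := hG.cthickening
  set Ω' := Metric.thickening (3 * ρ) (G t₁) with hΩ'
  have hΩ'o : IsOpen Ω' := Metric.isOpen_thickening
  have hΩ'S : Ω' ⊆ S := Metric.thickening_subset_cthickening _ _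
  have h2Ω' : Metric.cthickening (2 * ρ) (G t₁) ⊆ Ω' :=
    Metric.cthickening_subset_thickening' (by positivity) (by linarith) _
  have h1Ω' : Metric.cthickening ρ (G t₁) ⊆ Ω' :=
    (Metric.cthickening_mono (by linarith) _).trans h2Ω'
  obtain ⟨δ, hδ, hδJ⟩ := Metric.nhds_basis_closedBall.mem_iff.1 (hJ₀.mem_nhds ht₁)
  rw [Real.closedBall_eq_Icc] at hδJ
  set a := t₁ - δ with ha
  set c := t₁ + δ with hc
  have hQ : Icc a c ×ˢ S ⊆ J ×ˢ Ω := prod_mono (hδJ.trans hJ₀J) hρΩ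
  have hQcpt : IsCompact (Icc a c ×ˢ S) := isCompact_Icc.prod hScpt
  have hU'Q : Ioo a c ×ˢ Ω' ⊆ Icc a c ×ˢ S := prod_mono Ioo_subset_Icc_self hΩ'S
  have hU' : IsOpen (Ioo a c ×ˢ Ω') := isOpen_Ioo.prod hΩ'o
  have hint : ∀ f : ℝ × E3 → ℝ, ContinuousOn f (J ×ˢ Ω) → IntegrableOn f (Ioo a c ×ˢ Ω') :=
    fun f hf => ((hf.mono hQ).integrableOn_compact hQcpt).mono_set hU'Q
  have hψv : IntegrableOn (fun p => ψ p • v p) (Ioo a c ×ˢ Ω') :=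
    (((hψ.continuousOn.smul hv.continuousOn).mono hQ).integrableOn_compact hQcpt).mono_set hU'Q
  have hU'U : Ioo a c ×ˢ Ω' ⊆ J ×ˢ Ω := hU'Q.trans hQ
  have hψ' : ContDiffOn ℝ 1 ψ (Ioo a c ×ˢ Ω') := hψ.mono hU'U
  have hv' : IsClassicalField (Ioo a c ×ˢ Ω') v :=
    ⟨hv.continuousOn.mono hU'U, fun p hp => hv.differentiableAt p (hU'U hp),
      hv.continuousOn_fderiv.mono hU'U⟩
  have hg := hasWeakTimeDeriv_timeDeriv hU' hψ' (hint _ (continuousOn_timeDeriv hU hψ))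
  have hd := hasWeakSpaceDiv_spaceDiv hU' hv' hψ' hψv
    fun i => hint _ (continuousOn_diagonalDeriv hU hv hψ i)
  have hrep : IsTimeContinuousRep (Ioo a c) Ω' ψ ψ :=
    isTimeContinuousRep_self hΩ'o hScpt Ioo_subset_Icc_self hΩ'S (hψ.continuousOn.mono hQ)
  obtain ⟨α, β, b', X, hα, hβ, hsub, hMρ, h, hX, hbv'⟩ := exists_local_flow hM0 hK hb hM hLip
    (ae_restrict_of_ae_restrict_of_subset
      (Ioo_subset_Icc_self.trans (hδJ.trans hJ₀J) : Ioo a c ⊆ J) hbv) isOpen_Ioo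
    (show t₁ ∈ Ioo a c from ⟨by linarith, by linarith⟩) hρ
  have ht₁' : t₁ ∈ Icc α β := ⟨hα.le, hβ.le⟩
  have hGX : ∀ s ∈ Icc α β, X t₁ s ⁻¹' G t₁ = G s := fun s hs =>
    (comovingVolume_eq_preimage h hX (hsub.trans (Ioo_subset_Icc_self.trans hδJ)) hbv' hsol
      hs ht₁').symm
  have hbv'' : ∀ᵐ t ∂(volume.restrict (Icc α β)), ∀ x ∈ Ω', b' (t, x) = v (t, x) := by
    filter_upwards [hbv'] with t ht x hx using ht x (hρΩ (hΩ'S hx))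
  have hKi := integrableOn_integral_comoving h hX (hint k hkc) hG h1Ω' hMρ hsub ht₁'
  have hinc : ∀ s r, α ≤ s → s ≤ r → r < β → (∫ x in G r, ψ (r, x)) - ∫ x in G s, ψ (s, x) =
      ∫ t in s..r, ∫ x in X t₁ t ⁻¹' G t₁, k (t, x) := by
    intro s r hs hsr hr
    rw [← hGX r ⟨hs.trans hsr, hr.le⟩, ← hGX s ⟨hs, hsr.trans hr.le⟩]
    exact integral_comoving_sub isOpen_Ioo hΩ'o h hX hsub hbv'' (hint ψ hψ.continuousOn) hψv hrep
      hg hd hG hρ h2Ω' hMρ ht₁' hs hsr hr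
  have hcont := tendsto_integral_comoving h hX hG (show a < t₁ by linarith)
    (show t₁ < c by linarith) (ρ := ρ) hρ
    (hkc.mono ((prod_mono Subset.rfl (h1Ω'.trans hΩ'S)).trans hQ))
  have e : ∫ x in X t₁ t₁ ⁻¹' G t₁, k (t₁, x) = ∫ x in G t₁, k (t₁, x) := by rw [hGX t₁ ht₁']
  have hfin := hasDerivAt_of_sub_eq_integral hKi hinc hα hβ (by rw [ContinuousAt, e]; exact hcont)
  rwa [e] at hfin

/-! ### The transport theorem -/

theorem theorem1
    (J : Set ℝ) (hJo : IsOpen J) (hJi : J.OrdConnected)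
    (Ω : Set E3) (hΩ : IsOpen Ω)
    (v : ℝ × E3 → E3)
    (hv : MemLp v ∞ (volume.restrict (J ×ˢ Ω)))
    (L : ℝ) (hL : 0 ≤ L)
    (hLip : ∀ t ∈ J, ∀ x ∈ Ω, ∀ y ∈ Ω, ‖v (t, x) - v (t, y)‖ ≤ L * ‖x - y‖)
    (t₀ : ℝ) (ht₀ : t₀ ∈ J)
    (G₀ : Set E3) (hG₀ : IsCompactLipschitzDomain G₀) (hG₀Ω : G₀ ⊆ Ω)
    (r : ℝ) (hr : 0 < r)
    (J₀ : Set ℝ) (hJ₀ : J₀ = Ioo (t₀ - r) (t₀ + r) ∩ J)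
    (hsol : ∀ x₀ ∈ G₀, ∃ x : ℝ → E3, IsSolution v Ω J₀ t₀ x₀ x)
    (G : ℝ → Set E3) (hG : G = comovingVolume v Ω J₀ t₀ G₀) :
    -- the solutions are unique, so that the flow map and the co-moving volumes are well defined
    (∀ x₀ ∈ G₀, IsSolution v Ω J₀ t₀ x₀ (fun t => flowMap v Ω J₀ t₀ t x₀) ∧
      ∀ x : ℝ → E3, IsSolution v Ω J₀ t₀ x₀ x →
        ∀ t ∈ J₀, x t = flowMap v Ω J₀ t₀ t x₀) ∧
    (∀ t ∈ J₀, IsCompact (G t) ∧ G t ⊆ Ω) ∧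
    -- the transport identity almost everywhere, for Sobolev functions
    (∀ ψ : ℝ × E3 → ℝ, MemW11 (J ×ˢ Ω) ψ →
      (∃ ψ' : ℝ × E3 → ℝ, IsTimeContinuousRep J Ω ψ ψ') ∧
      (∃ d : ℝ × E3 → ℝ, HasWeakSpaceDiv (J ×ˢ Ω) (fun p => ψ p • v p) d) ∧
      ∀ ψ' g d : ℝ × E3 → ℝ, IsTimeContinuousRep J Ω ψ ψ' →
        HasWeakTimeDeriv (J ×ˢ Ω) ψ g →
        HasWeakSpaceDiv (J ×ˢ Ω) (fun p => ψ p • v p) d →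
        ∀ᵐ t ∂(volume.restrict J₀),
          IntegrableOn (fun x => ψ' (t, x)) (G t) ∧
          IntegrableOn (fun x => g (t, x) + d (t, x)) (G t) ∧
          HasDerivAt (fun s => ∫ x in G s, ψ' (s, x)) (∫ x in G t, (g (t, x) + d (t, x))) t) ∧
    -- the transport identity at every time, under the classical regularity assumptions
    (ContinuousOn v (J ×ˢ Ω) →
      (∀ t ∈ J, ∀ x ∈ Ω, DifferentiableAt ℝ (fun y => v (t, y)) x) →
      ContinuousOn (fun p : ℝ × E3 => fderiv ℝ (fun y => v (p.1, y)) p.2) (J ×ˢ Ω) →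
      ∀ ψ : ℝ × E3 → ℝ, ContDiffOn ℝ 1 ψ (J ×ˢ Ω) →
        ∀ t ∈ J₀,
          IntegrableOn (fun x => ψ (t, x)) (G t) ∧
          IntegrableOn
            (fun x => timeDeriv ψ (t, x) + spaceDiv (fun p => ψ p • v p) (t, x)) (G t) ∧
          HasDerivAt (fun s => ∫ x in G s, ψ (s, x))
            (∫ x in G t, (timeDeriv ψ (t, x) + spaceDiv (fun p => ψ p • v p) (t, x))) t) := by
  subst hJ₀ hG
  set J₀ := Ioo (t₀ - r) (t₀ + r) ∩ J with hJ₀def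
  have hJ₀ : IsOpen J₀ := isOpen_Ioo.inter hJo
  have hJ₀c : IsPreconnected J₀ := (ordConnected_Ioo.inter hJi).isPreconnected
  have hJ₀J : J₀ ⊆ J := inter_subset_right
  have ht₀J₀ : t₀ ∈ J₀ := ⟨⟨by linarith, by linarith⟩, ht₀⟩
  obtain ⟨b, M, K, hM0, hK, hb, hM, hbLip, hbv⟩ :=
    exists_caratheodory_extension hΩ hv hL hLip hJo.measurableSet
  have hbv₀ : ∀ᵐ t ∂(volume.restrict J₀), ∀ x ∈ Ω, b (t, x) = v (t, x) :=
    ae_restrict_of_ae_restrict_of_subset hJ₀J hbv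
  have hflow : ∀ x₀ ∈ G₀, IsSolution v Ω J₀ t₀ x₀ (fun t => flowMap v Ω J₀ t₀ t x₀) :=
    fun x₀ hx₀ => isSolution_flowMap (hsol x₀ hx₀)
  have hG : ∀ t ∈ J₀, IsCompact (comovingVolume v Ω J₀ t₀ G₀ t) ∧
      comovingVolume v Ω J₀ t₀ G₀ t ⊆ Ω := fun t ht =>
    ⟨hG₀.isCompact.image_of_continuousOn
      (continuousOn_flowMap hM0 hK hb hM hbLip hbv₀ hJ₀ hJ₀c ht₀J₀ hsol ht),
      image_subset_iff.2 fun x hx => (hflow x hx).mem t ht⟩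
  refine ⟨fun x₀ hx₀ => ⟨hflow x₀ hx₀, fun x hx t ht =>
    IsSolution.unique hM0 hK hb hM hbLip hbv₀ hJ₀ hJ₀c ht₀J₀ hx (hflow x₀ hx₀) ht⟩, hG, ?_, ?_⟩
  · intro ψ hψ
    have hae : (fun p => ψ p • b p) =ᵐ[volume.restrict (J ×ˢ Ω)] fun p => ψ p • v p := by
      have h1 : ∀ᵐ p ∂(volume.restrict (J ×ˢ Ω)), ∀ x ∈ Ω, b (p.1, x) = v (p.1, x) := by
        rw [volume_restrict_prod]
        exact Measure.quasiMeasurePreserving_fst.ae hbv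
      filter_upwards [h1, ae_restrict_mem (hJo.prod hΩ).measurableSet] with p hp hpU
      rw [hp p.2 hpU.2]
    have hψb : IntegrableOn (fun p => ψ p • b p) (J ×ˢ Ω) := by
      refine (hψ.integrable.norm.mul_const M).mono'
        (hψ.integrable.aestronglyMeasurable.smul hb.aestronglyMeasurable)
        (Eventually.of_forall fun p => ?_)
      rw [norm_smul]
      exact mul_le_mul_of_nonneg_left (hM p) (norm_nonneg _)
    obtain ⟨g₀, hg₀⟩ := hψ.time
    obtain ⟨d₀, hd₀⟩ := exists_hasWeakSpaceDiv (hJo.prod hΩ) hb hM hK hbLip hψ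
    exact ⟨exists_isTimeContinuousRep hJo hJi hΩ hψ.integrable hg₀, ⟨d₀, hd₀.congr_ae hae⟩,
      fun ψ' g d hψ' hg hd => ae_hasDerivAt_integral_comovingVolume hJo hΩ hM0 hK hb hM hbLip hbv
        hJ₀ hJ₀J hsol hG hψ.integrable (hψb.congr hae) hψ' hg hd⟩
  · intro hvc hvd hvf ψ hψ t ht
    exact hasDerivAt_integral_comovingVolume hJo hΩ hM0 hK hb hM hbLip hbv hJ₀ hJ₀J hsol
      ⟨hvc, fun p hp => hvd p.1 hp.1 p.2 hp.2, hvf⟩ hψ ht (hG t ht).1 (hG t ht).2
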